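/- **Setting.** Let $\mathsf D$ be a unique factorization domain of characteristic zero, $\mathsf R=\mathsf D[q,q^{-1}]$ with $q$ an indeterminate, $n\in\mathbb N$, and $\mathsf R[\mathbf x]=\mathsf R[x_1,\dots,x_n]$. For $\mathbf v\in\mathbb Z^n$ write $\mathbf x^{\mathbf v}=x_1^{v_1}\cdots x_n^{v_n}$. The definitions and algorithms below are also used over the coefficient rings $\mathsf A=\mathsf R[x_{j},\dots,x_n]$ in place of $\mathsf R$. The content $\operatorname{cont}$ is the gcd of the coefficients, $\operatorname{prim}(p)=p/\operatorname{cont}(p)$; indices $\operatorname{cont}_{x_i}$, $\operatorname{cont}_{x_1,x_2}$, etc. mean that $p$ is viewed as a polynomial in the indicated variables, the others being in the coefficients. Gcds are defined up to units and any choice of them is allowed, as is any order of visiting finite sets. Numerator and denominator of a Laurent polynomial are taken in lowest terms, the denominator being a monomial. An irreducible $p$ is *$q$-integer linear* over $\mathsf A$ if $p=\mathbf x^{\boldsymbol\alpha}P(\mathbf x^{\boldsymbol\lambda})$ for some $P\in\mathsf A[y]$ and integer vectors $\boldsymbol\alpha,\boldsymbol\lambda$. A polynomial $P\in\mathsf A[y]$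 is *$q$-primitive* if it is primitive and $P(0)\ne0$. A *$q$-integer linear decomposition* (QILD) of $p$ over $\mathsf A$ is an identity $$p=c\,\mathbf x^{\boldsymbol\alpha}P_0\prod_{i=1}^mP_i(\mathbf x^{\boldsymbol\lambda_i}),\qquad c\in\mathsf A,\ m\in\mathbb N,\ \boldsymbol\alpha\in\mathbb N^n,\ \boldsymbol\lambda_i\in\mathbb Z^n\setminus\{\mathbf 0\},\ P_0\in\mathsf A[\mathbf x],\ P_i\in\mathsf A[y],$$ in which (1) $P_0$ is primitive and none of its irreducible factors of positive total degree is $q$-integer linear; (2) each $P_i$ is $q$-primitive of positive degree; (3) the coordinates of each $\boldsymbol\lambda_i$ have gcd $1$ and the last nonzero one is positive; (4) the $\boldsymbol\lambda_i$ are pairwise distinct. It is unique up to the order of the factors and units. The *direction vector* of a segment $[\mathbf u,\mathbf v]$, $\mathbf u\neq\mathbf v$, is the integer vector $\boldsymbol\lambda$ as in (3) with $\mathbf u-\mathbf v\in\mathbb R\boldsymbol\lambda$, if there is one. $\operatorname{supp}(f)$ is the set of exponent vectors of $f$ and $\operatorname{Newt}(f)\subset\mathbb R^n$ its convex hull; an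 edge is a one-dimensional face. In all recursive calls and subcalls below the input is primitive, so that the constant $c$ returned is a unit; the returned decomposition is used with this unit made part of its $P_0$. **Common steps** (input $p$). (i) If $p$ is a constant, return $c=p$. (ii) Set $c=\operatorname{cont}(p)$, $f=\operatorname{prim}(p)$; if $f=b\,\mathbf x^{\boldsymbol\alpha}$ has a single term, return $(cb)\,\mathbf x^{\boldsymbol\alpha}$. (iii) If $n=1$, let $\alpha_1$ be the lowest degree of $f$ and return $c\,x_1^{\alpha_1}P_1(x_1)$ with $P_1(y)=f(y)/y^{\alpha_1}$. **MultivariateQILD$_1$.** Perform the common steps. If $n\ge2$, set $\boldsymbol\alpha=\mathbf 0$, $P_0=1$, $m=0$. For $i=1,\dots,n$: set $g=\operatorname{cont}_{x_i}(f)$, $f=\operatorname{prim}_{x_i}(f)$; if $g\ne1$, call the algorithm recursively on $g$ as a polynomial in the remaining $n-1$ variables, and merge the result: add its exponent vector to $\boldsymbol\alpha$, multiply $P_0$ by its $P_0$, and append its pairs $(\boldsymbol\lambda,P)$, all vectors being given $i$-th coordinate $0$. If $\deg f=0$, replace $c$ by $cf$ and return. Otherwise let $\Lambda$ be the multiset of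 the direction vectors without zero coordinates of the edges of $\operatorname{Newt}(f)$. If $\Lambda$ has more than one element, replace it by the set of those of its elements of multiplicity at least two that are direction vectors of segments joining some fixed $\mathbf v\in\operatorname{supp}(f)$ to other points of $\operatorname{supp}(f)$. For each $\boldsymbol\lambda\in\Lambda$: let $P^*(y)$ be the content, with respect to $x_1,\dots,x_{n-1}$, of the numerator of $f(x_1^{\lambda_n},\dots,x_{n-1}^{\lambda_n},y\,x_1^{-\lambda_1}\cdots x_{n-1}^{-\lambda_{n-1}})$; if $\deg P^*>0$, increase $m$ by one, set $\boldsymbol\lambda_m=\boldsymbol\lambda$ and $P_m(y)=P^*(y^{1/\lambda_n})$, divide $f$ by the numerator of $P_m(\mathbf x^{\boldsymbol\lambda})$, and add the exponent vector of its denominator to $\boldsymbol\alpha$. Finally, if $\deg f>0$ replace $P_0$ by $P_0f$, else $c$ by $cf$; return $c\,\mathbf x^{\boldsymbol\alpha}P_0\prod_{i=1}^mP_i(\mathbf x^{\boldsymbol\lambda_i})$. **MultivariateQILD$_2$.** Perform the common steps. If $n=2$, call MultivariateQILD$_1$ on $f$, giving $f=\mathbf x^{\boldsymbol\alpha}P_0\prod_iP_i(\mathbf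 x^{\boldsymbol\lambda_i})$, and return $c\,\mathbf x^{\boldsymbol\alpha}P_0\prod_iP_i(\mathbf x^{\boldsymbol\lambda_i})$. If $n\ge3$, set $\boldsymbol\alpha=\mathbf 0$, $P_0=1$, $m=0$, $g=\operatorname{cont}_{x_1,x_2}(f)\in\mathsf R[x_3,\dots,x_n]$, $f=\operatorname{prim}_{x_1,x_2}(f)$. If $g\neq1$, call the algorithm recursively on $g$ as a polynomial in $x_3,\dots,x_n$ and merge the result as above, all vectors being given first two coordinates $0$. If $f=b\,\mathbf x^{\boldsymbol\alpha^*}$ has a single term, replace $c$ by $cb$ and $\boldsymbol\alpha$ by $\boldsymbol\alpha+\boldsymbol\alpha^*$ and return. Otherwise set $\Lambda_1=\{((1),f(y,x_2,\dots,x_n))\}$. For $k=1,\dots,n-1$: start with $\Lambda_{k+1}=\emptyset$; for each $((\mu_1,\dots,\mu_k),h(y,x_{k+1},\dots,x_n))\in\Lambda_k$ call MultivariateQILD$_1$ on $h$ as a polynomial in the two variables $y,x_{k+1}$ over $\mathsf R[x_{k+2},\dots,x_n]$, giving $$h=y^{\alpha^*}x_{k+1}^{\beta^*}P_0^*\prod_{i=1}^{m^*}P_i^*(y^{\lambda_i^*}x_{k+1}^{\mu_i^*},x_{k+2},\dots,x_n),$$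 add $(\mu_1\alpha^*,\dots,\mu_k\alpha^*,\beta^*,0,\dots,0)$ to $\boldsymbol\alpha$, multiply $P_0$ by $P_0^*(x_1^{\mu_1}\cdots x_k^{\mu_k},x_{k+1},\dots,x_n)$, and put the pairs $((\mu_1\lambda_i^*,\dots,\mu_k\lambda_i^*,\mu_i^*),P_i^*(y,x_{k+2},\dots,x_n))$, $1\le i\le m^*$, into $\Lambda_{k+1}$. Finally replace $P_0$ by its numerator, subtract the exponent vector of its denominator from $\boldsymbol\alpha$, append all pairs $(\boldsymbol\mu,h(y))\in\Lambda_n$ as further pairs $(\boldsymbol\lambda_m,P_m)$, and return $c\,\mathbf x^{\boldsymbol\alpha}P_0\prod_{i=1}^mP_i(\mathbf x^{\boldsymbol\lambda_i})$. **Theorem.** For every $n$ and every $p\in\mathsf R[x_1,\dots,x_n]$, the output of MultivariateQILD$_2$ on input $p$ is the $q$-integer linear decomposition of $p$ over $\mathsf R$. -/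

import Mathlib

universe u

noncomputable section

namespace QILD

/-- The arbitrary choices that a run of the algorithms makes: greatest common divisors in unique
factorization domains (which are determined only up to units), the order in which the elements of
a finite set of vectors are visited, and a point picked from a nonempty finite set.  Such choices
exist (see the instance below); the algorithms are total functions for each of them. -/
structure Choices : Type (u + 1) where
  gcd : ∀ (B : Type u) [CommRing B], Finset B → B
  dvd_gcd_iff : ∀ (B : Type u) [CommRing B] [IsDomain B] [UniqueFactorizationMonoid B]
    (s : Finset B) (d : B), d ∣ gcd B s ↔ ∀ b ∈ s, d ∣ b
  enum : ∀ {n : ℕ}, Set (Fin n → ℤ) → List (Fin n → ℤ)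
  enum_nodup : ∀ {n : ℕ} (s : Set (Fin n → ℤ)), s.Finite → (enum s).Nodup
  mem_enum : ∀ {n : ℕ} (s : Set (Fin n → ℤ)), s.Finite → ∀ v, v ∈ enum s ↔ v ∈ s
  point : ∀ {n : ℕ}, Finset (Fin n →₀ ℕ) → (Fin n →₀ ℕ)
  point_mem : ∀ {n : ℕ} (s : Finset (Fin n →₀ ℕ)), s.Nonempty → point s ∈ s

theorem exists_finset_gcd (B : Type u) [CommRing B] [IsDomain B] [UniqueFactorizationMonoid B]
    (s : Finset B) : ∃ g : B, ∀ d : B, d ∣ g ↔ ∀ b ∈ s, d ∣ b := by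
  classical
  obtain ⟨i⟩ : Nonempty (NormalizedGCDMonoid B) := inferInstance
  exact ⟨s.gcd id, fun d => Finset.dvd_gcd_iff⟩

instance : Nonempty Choices.{u} := by
  classical
  refine ⟨{
    gcd := fun B _ s =>
      if h : ∃ g : B, ∀ d : B, d ∣ g ↔ ∀ b ∈ s, d ∣ b then h.choose else 0
    dvd_gcd_iff := ?_
    enum := fun s => if h : s.Finite then h.toFinset.toList else []
    enum_nodup := ?_
    mem_enum := ?_
    point := fun s => if h : s.Nonempty then h.choose else 0
    point_mem := ?_ }⟩
  · intro B _ _ _ s d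
    rw [dif_pos (exists_finset_gcd B s)]
    exact (exists_finset_gcd B s).choose_spec d
  · intro n s hs
    rw [dif_pos hs]
    exact Finset.nodup_toList _
  · intro n s hs v
    rw [dif_pos hs]
    simp
  · intro n s hs
    rw [dif_pos hs]
    exact hs.choose_spec

section Basics

variable {A : Type u} [CommRing A] {n : ℕ}

/-- The Laurent polynomial ring `A[x₁, x₁⁻¹, …, xₙ, xₙ⁻¹]`. -/
abbrev Laurent (n : ℕ) (A : Type u) [CommRing A] : Type u := AddMonoidAlgebra A (Fin n → ℤ)

/-- The Laurent monomial `x ^ v`. -/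
def mono (A : Type u) [CommRing A] (v : Fin n → ℤ) : Laurent n A := AddMonoidAlgebra.single v 1

/-- The variable `xᵢ` as a Laurent polynomial. -/
def var (A : Type u) [CommRing A] (i : Fin n) : Laurent n A := mono A (Pi.single i 1)

/-- The inclusion `A[x] → A[x, x⁻¹]`. -/
def toLaurent : MvPolynomial (Fin n) A →ₐ[A] Laurent n A := MvPolynomial.aeval (var A)

/-- `P(x ^ v)` for a univariate polynomial `P` and an integer vector `v`. -/
def evalMono (v : Fin n → ℤ) (P : Polynomial A) : Laurent n A := Polynomial.aeval (mono A v) P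

/-- The integers in `v` have no common divisor and the last nonzero one is positive. -/
def Normalized (v : Fin n → ℤ) : Prop :=
  Finset.univ.gcd v = 1 ∧ ∃ i, 0 < v i ∧ ∀ j, i < j → v j = 0

/-- `p = x ^ α * P(x ^ v)` for a univariate polynomial `P` and integer vectors `α`, `v`: for
irreducible `p` this says that `p` is `q`-integer linear. -/
def IsIntegerLinear (p : MvPolynomial (Fin n) A) : Prop :=
  ∃ (P : Polynomial A) (α v : Fin n → ℤ), toLaurent p = mono A α * evalMono v P

/-- The coefficients of `p` have no common divisor except units. -/
def Primitive (p : MvPolynomial (Fin n) A) : Prop :=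
  ∀ a : A, MvPolynomial.C a ∣ p → IsUnit a

/-- Primitive with nonzero constant term. -/
def QPrimitive (P : Polynomial A) : Prop := P.IsPrimitive ∧ P.coeff 0 ≠ 0

end Basics

/-- The data `c`, `α`, `P₀` and `(λ₁, P₁), …, (λₘ, Pₘ)` of an expression
`c x^α P₀ ∏ᵢ Pᵢ(x^λᵢ)`. -/
structure Decomp (n : ℕ) (A : Type u) [CommRing A] : Type u where
  const : A
  expo : Fin n → ℤ
  rest : MvPolynomial (Fin n) A
  types : List ((Fin n → ℤ) × Polynomial A)

section Decompositions

variable {A : Type u} [CommRing A] {n : ℕ}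

/-- The Laurent polynomial `c x^α P₀ ∏ᵢ Pᵢ(x^λᵢ)`. -/
def Decomp.value (d : Decomp n A) : Laurent n A :=
  algebraMap A (Laurent n A) d.const * mono A d.expo * toLaurent d.rest *
    (d.types.map fun t => evalMono t.1 t.2).prod

/-- `d` is the `q`-integer linear decomposition of `p` over `A` (unique up to order and units). -/
structure IsQILD (p : MvPolynomial (Fin n) A) (d : Decomp n A) : Prop where
  value_eq : toLaurent p = d.value
  expo_nonneg : ∀ i, 0 ≤ d.expo i
  rest_primitive : Primitive d.rest
  rest_factors : ∀ r : MvPolynomial (Fin n) A, Irreducible r → 0 < r.totalDegree → r ∣ d.rest →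
    ¬ IsIntegerLinear r
  poly_qPrimitive : ∀ t ∈ d.types, QPrimitive t.2
  poly_degree : ∀ t ∈ d.types, 0 < t.2.natDegree
  type_ne_zero : ∀ t ∈ d.types, t.1 ≠ 0
  type_normalized : ∀ t ∈ d.types, Normalized t.1
  types_distinct : (d.types.map Prod.fst).Nodup

/-- `c P₀`.  When the input of a call is primitive, the `c` that it returns is a unit, and the
decomposition is used in the form `x^α P₀ ∏ᵢ Pᵢ(x^λᵢ)`, with that unit as part of `P₀`. -/
def Decomp.unitRest (d : Decomp n A) : MvPolynomial (Fin n) A := MvPolynomial.C d.const * d.rest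

end Decompositions

section Operations

variable (ch : Choices.{u}) {A : Type u} [CommRing A] {n : ℕ}

open scoped Classical in
/-- The exact quotient `f / g` (`0` if `g` does not divide `f`). -/
def exactDiv {B : Type u} [CommRing B] (f g : B) : B :=
  if h : ∃ e, f = g * e then h.choose else 0

/-- The content of `f` with respect to all its variables. -/
def cont {σ : Type} (f : MvPolynomial σ A) : A := ch.gcd A f.coeffs

/-- `f` as a polynomial in `xᵢ` over the polynomials in the other variables. -/
def viewVar (i : Fin (n + 1)) :
    MvPolynomial (Fin (n + 1)) A →ₐ[A] Polynomial (MvPolynomial (Fin n) A) :=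
  MvPolynomial.aeval (i.insertNth (α := fun _ => Polynomial (MvPolynomial (Fin n) A))
    Polynomial.X (fun j => Polynomial.C (MvPolynomial.X j)))

/-- The content of `f` with respect to the variable `xᵢ`. -/
def contVar (i : Fin (n + 1)) (f : MvPolynomial (Fin (n + 1)) A) : MvPolynomial (Fin n) A :=
  ch.gcd _ (viewVar i f).coeffs

/-- `f` as a polynomial in all variables but the last one, which goes into the coefficients. -/
def viewInit :
    MvPolynomial (Fin (n + 1)) A →ₐ[A] MvPolynomial (Fin n) (Polynomial A) :=
  MvPolynomial.aeval (Fin.snoc (α := fun _ => MvPolynomial (Fin n) (Polynomial A))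
    (fun j => MvPolynomial.X j) (MvPolynomial.C Polynomial.X))

/-- `f` as a polynomial in the first two variables over the polynomials in the others. -/
def viewPair :
    MvPolynomial (Fin (n + 2)) A →ₐ[A] MvPolynomial (Fin 2) (MvPolynomial (Fin n) A) :=
  MvPolynomial.aeval (Fin.cons (α := fun _ => MvPolynomial (Fin 2) (MvPolynomial (Fin n) A))
    (MvPolynomial.X 0) (Fin.cons (α := fun _ => MvPolynomial (Fin 2) (MvPolynomial (Fin n) A))
      (MvPolynomial.X 1) (fun j => MvPolynomial.C (MvPolynomial.X j))))

/-- A polynomial in one variable, as a univariate polynomial. -/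
def toUni : MvPolynomial (Fin 1) A →ₐ[A] Polynomial A :=
  MvPolynomial.aeval (fun _ => Polynomial.X)

/-- The exponent vector of the denominator (a monomial) of a Laurent polynomial. -/
def den (f : Laurent n A) : Fin n → ℕ := fun i => f.coeff.support.sup fun e => (-(e i)).toNat

/-- The numerator of a Laurent polynomial. -/
def num (f : Laurent n A) : MvPolynomial (Fin n) A :=
  f.coeff.sum fun e a =>
    MvPolynomial.monomial (Finsupp.equivFunOnFinite.symm fun i => (e i + den f i).toNat) a

end Operations

section Newton

variable {A : Type u} [CommRing A] {n : ℕ}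

/-- An exponent vector as a point of `ℝⁿ`. -/
def toPoint (e : Fin n →₀ ℕ) : Fin n → ℝ := fun i => (e i : ℝ)

/-- The Newton polytope. -/
def newt (f : MvPolynomial (Fin n) A) : Set (Fin n → ℝ) :=
  convexHull ℝ (toPoint '' (f.support : Set (Fin n →₀ ℕ)))

/-- The face of `K` determined by the outward normal `a`. -/
def face (K : Set (Fin n → ℝ)) (a : Fin n → ℝ) : Set (Fin n → ℝ) :=
  {x ∈ K | ∀ y ∈ K, a ⬝ᵥ y ≤ a ⬝ᵥ x}

/-- `v` is the direction vector of the segment with the distinct endpoints `x` and `y`. -/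
def IsDirection (v : Fin n → ℤ) (x y : Fin n → ℝ) : Prop :=
  x ≠ y ∧ (∃ t : ℝ, x - y = t • fun i => (v i : ℝ)) ∧ Normalized v

/-- The edges of `K` with direction vector `v`. -/
def edgesWithDirection (K : Set (Fin n → ℝ)) (v : Fin n → ℤ) : Set (Set (Fin n → ℝ)) :=
  {F | (∃ a, a ≠ 0 ∧ F = face K a) ∧ ∃ x y, F = segment ℝ x y ∧ IsDirection v x y}

/-- The multiplicity of `v` in the multiset `Λ` of direction vectors of edges of the Newton
polytope of `f` is the number of edges with direction vector `v`. -/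
def edgeMult (f : MvPolynomial (Fin n) A) (v : Fin n → ℤ) : ℕ :=
  (edgesWithDirection (newt f) v).ncard

/-- The number of elements, with multiplicities, of the multiset `Λ` of direction vectors, with no
zero coordinates, of edges of the Newton polytope of `f`. -/
def edgeCount (f : MvPolynomial (Fin n) A) : ℕ :=
  {F | ∃ v : Fin n → ℤ, (∀ i, v i ≠ 0) ∧ F ∈ edgesWithDirection (newt f) v}.ncard

open scoped Classical in
/-- The candidates for types. -/
def candidates (ch : Choices.{u}) (f : MvPolynomial (Fin n) A) : Set (Fin n → ℤ) :=
  if 1 < edgeCount f then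
    {v | (∀ i, v i ≠ 0) ∧ 2 ≤ edgeMult f v ∧
      ∃ e ∈ f.support, IsDirection v (toPoint (ch.point f.support)) (toPoint e)}
  else
    {v | (∀ i, v i ≠ 0) ∧ 1 ≤ edgeMult f v}

end Newton

section Algorithms

variable (ch : Choices.{u}) {A : Type u} [CommRing A]

open scoped Classical in
/-- The first two steps of both algorithms: constants, and constant multiples of monomials, are
treated at once; otherwise `next` continues with the content and the primitive part. -/
def prepare {n : ℕ} (p : MvPolynomial (Fin n) A)
    (next : A → MvPolynomial (Fin n) A → Decomp n A) : Decomp n A :=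
  if ∃ a, p = MvPolynomial.C a then ⟨p.coeff 0, 0, 1, []⟩
  else
    let c := cont ch p
    let f := exactDiv p (MvPolynomial.C c)
    if h : ∃ e, f.support = {e} then ⟨c * f.coeff h.choose, fun i => (h.choose i : ℤ), 1, []⟩
    else next c f

/-- The case of one variable: `c x^α P(x)` with `α` the lowest degree of `f = x^α P(x)`. -/
def univariate (c : A) (f : MvPolynomial (Fin 1) A) : Decomp 1 A :=
  let F := toUni f
  ⟨c, fun _ => (F.natTrailingDegree : ℤ), 1,
    [(fun _ => 1, exactDiv F (Polynomial.X ^ F.natTrailingDegree))]⟩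

open scoped Classical in
/-- Remove from `f`, for each variable in turn, the content with respect to that variable, and
decompose that content by `call`.  The state consists of the current `f` and the part of the
decomposition found so far. -/
def removeContents {n : ℕ} (call : MvPolynomial (Fin n) A → Decomp n A)
    (s : MvPolynomial (Fin (n + 1)) A × Decomp (n + 1) A) :
    MvPolynomial (Fin (n + 1)) A × Decomp (n + 1) A :=
  (List.finRange (n + 1)).foldl (fun s i =>
    let g := contVar ch i s.1
    let f := exactDiv s.1 (MvPolynomial.rename i.succAbove g)
    if g = 1 then (f, s.2)
    else
      let d := call g
      (f, { const := s.2.const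
            expo := s.2.expo + i.insertNth (α := fun _ => ℤ) 0 d.expo
            rest := s.2.rest * MvPolynomial.rename i.succAbove d.unitRest
            types := s.2.types ++
              d.types.map fun t => (i.insertNth (α := fun _ => ℤ) 0 t.1, t.2) })) s

/-- The content, with respect to `x₁, …, xₙ`, of the numerator of
`f(x₁^v_{n+1}, …, xₙ^v_{n+1}, y x₁^(-v₁) ⋯ xₙ^(-vₙ))`. -/
def typeContent {n : ℕ} (f : MvPolynomial (Fin (n + 1)) A) (v : Fin (n + 1) → ℤ) :
    Polynomial A :=
  cont ch (viewInit (num (MvPolynomial.aeval (Fin.snoc (α := fun _ => Laurent (n + 1) A)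
    (fun i : Fin n => mono A (Pi.single i.castSucc (v (Fin.last n))))
    (mono A (Fin.snoc (α := fun _ => ℤ) (fun i : Fin n => -v i.castSucc) 1))) f)))

open scoped Classical in
/-- Test the candidate `v`, and split off the corresponding univariate polynomial. -/
def testCandidate {n : ℕ} (s : MvPolynomial (Fin (n + 1)) A × Decomp (n + 1) A)
    (v : Fin (n + 1) → ℤ) : MvPolynomial (Fin (n + 1)) A × Decomp (n + 1) A :=
  let Q := typeContent ch s.1 v
  if 0 < Q.natDegree then
    let P := Q.contract (v (Fin.last n)).toNat
    let E := evalMono v P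
    (exactDiv s.1 (num E),
      { const := s.2.const
        expo := s.2.expo + fun i => (den E i : ℤ)
        rest := s.2.rest
        types := s.2.types ++ [(v, P)] })
  else s

open scoped Classical in
/-- What follows the removal of the contents in the first algorithm. -/
def extractTypes {n : ℕ} (s : MvPolynomial (Fin (n + 1)) A × Decomp (n + 1) A) :
    Decomp (n + 1) A :=
  if s.1.totalDegree = 0 then { s.2 with const := s.2.const * s.1.coeff 0 }
  else
    let r := (ch.enum (candidates ch s.1)).foldl (testCandidate ch) s
    if 0 < r.1.totalDegree then { r.2 with rest := r.2.rest * r.1 }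
    else { r.2 with const := r.2.const * r.1.coeff 0 }

/-- The algorithm **MultivariateQILD₁**. -/
def multivariateQILD1 : (n : ℕ) → MvPolynomial (Fin n) A → Decomp n A
  | 0, p => ⟨p.coeff 0, 0, 1, []⟩
  | 1, p => prepare ch p univariate
  | n + 2, p => prepare ch p fun c f =>
      extractTypes ch (removeContents ch (fun g => multivariateQILD1 (n + 1) g) (f, ⟨c, 0, 1, []⟩))

/-- One pass through the body of the inner loop of the second algorithm, for the element
`t = (μ, h)` of `Λ_k`, where `h` is a polynomial in `y, x_{k+1}, …, x_N` and `N = k + m + 1`.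
The vectors `μ` are filled up with zeros to length `N`.  The state consists of `α`, of `P₀` (a
Laurent polynomial here), and of the elements of `Λ_{k+1}` found so far. -/
def pairStep {N : ℕ} (m : ℕ) (hm : m + 1 < N)
    (s : ((Fin N → ℤ) × Laurent N A) × List ((Fin N → ℤ) × MvPolynomial (Fin (m + 1)) A))
    (t : (Fin N → ℤ) × MvPolynomial (Fin (m + 2)) A) :
    ((Fin N → ℤ) × Laurent N A) × List ((Fin N → ℤ) × MvPolynomial (Fin (m + 1)) A) :=
  let μ := t.1
  let d := multivariateQILD1 ch 2 (viewPair t.2)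
  -- the index of `x_{k+1}`, counted from zero
  let k : Fin N := ⟨N - (m + 1), by omega⟩
  -- the coefficients of `h`, polynomials in `x_{k+2}, …, x_N`
  let coeffs : MvPolynomial (Fin m) A →ₐ[A] Laurent N A :=
    MvPolynomial.aeval fun j => var A ⟨N - m + j, by omega⟩
  ((s.1.1 + d.expo 0 • μ + Pi.single k (d.expo 1),
    s.1.2 * MvPolynomial.eval₂ (coeffs : MvPolynomial (Fin m) A →+* Laurent N A)
      ![mono A μ, var A k] d.unitRest),
   s.2 ++ d.types.map fun r =>
    (r.1 0 • μ + Pi.single k (r.1 1), (MvPolynomial.finSuccEquiv A m).symm r.2))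

/-- The main loop of the second algorithm, from the point where `m` variables remain; in the end
the elements of `Λ_N` are read as univariate polynomials. -/
def pairLoop {N : ℕ} : (m : ℕ) → m < N → (Fin N → ℤ) × Laurent N A →
    List ((Fin N → ℤ) × MvPolynomial (Fin (m + 1)) A) →
    ((Fin N → ℤ) × Laurent N A) × List ((Fin N → ℤ) × Polynomial A)
  | 0, _, s, L => (s, L.map fun t => (t.1, toUni t.2))
  | m + 1, hm, s, L =>
      let r := L.foldl (pairStep ch m hm) (s, [])
      pairLoop m (by omega) r.1 r.2

open scoped Classical in
/-- The second algorithm for at least three variables, after the initial steps; `call` is the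
recursive call. -/
def manyVariables {n : ℕ} (call : MvPolynomial (Fin (n + 1)) A → Decomp (n + 1) A)
    (c : A) (f₀ : MvPolynomial (Fin (n + 3)) A) : Decomp (n + 3) A :=
  let g := cont ch (viewPair f₀)
  let f := exactDiv f₀ (MvPolynomial.rename (fun j : Fin (n + 1) => j.succ.succ) g)
  let s : Decomp (n + 3) A :=
    if g = 1 then ⟨c, 0, 1, []⟩
    else
      let d := call g
      { const := c
        expo := Fin.cons (α := fun _ => ℤ) 0 (Fin.cons (α := fun _ => ℤ) 0 d.expo)
        rest := MvPolynomial.rename (fun j : Fin (n + 1) => j.succ.succ) d.unitRest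
        types := d.types.map fun t =>
          (Fin.cons (α := fun _ => ℤ) 0 (Fin.cons (α := fun _ => ℤ) 0 t.1), t.2) }
  if h : ∃ e, f.support = {e} then
    { const := s.const * f.coeff h.choose
      expo := s.expo + fun i => (h.choose i : ℤ)
      rest := s.rest
      types := s.types }
  else
    let r := pairLoop ch (n + 2) (by omega) (s.expo, toLaurent s.rest) [(Pi.single 0 1, f)]
    { const := s.const
      expo := r.1.1 - fun i => (den r.1.2 i : ℤ)
      rest := num r.1.2
      types := s.types ++ r.2 }

/-- The algorithm **MultivariateQILD₂**. -/
def multivariateQILD2 : (n : ℕ) → MvPolynomial (Fin n) A → Decomp n A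
  | 0, p => ⟨p.coeff 0, 0, 1, []⟩
  | 1, p => prepare ch p univariate
  | 2, p => prepare ch p fun c f =>
      let d := multivariateQILD1 ch 2 f
      ⟨c, d.expo, d.unitRest, d.types⟩
  | n + 3, p => prepare ch p fun c f =>
      manyVariables ch (fun g => multivariateQILD2 (n + 1) g) c f

end Algorithms

end QILD

end

/-! The proof works in the Laurent ring, where monomials are units and a factor of type `v` is an
element `P(x ^ v)`, that is, `evalMono v P`. Condition (1) on `P₀` is replaced by membership in
`nonlinear`, the monoid generated by the elements whose divisors of the form `P(x ^ v)` are all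
units. A prime of this form divides no member, since it would divide a generator. Over a unique
factorization domain this yields both primitivity and the absence of integer-linear irreducible
factors (`IsSplit.isQILD`). Each stage of the algorithm then only has to preserve the product and
leave a remainder in `nonlinear`.

Two variables. Choose `w` with `w · v = 1`. The forms `cross v` and `w ·` are coordinates on `ℤ²`,
so a Laurent polynomial splits along the lines parallel to `v`, and `P(x ^ v)` divides it exactly
when `P` divides the one-variable Laurent polynomial on every line (`evalMono_dvd_iff`). This has
two consequences. If `P` has positive degree and nonzero constant term, every line that meets the
support of `f` meets it at least twice, so both extreme lines carry edges of the Newton polygon and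
`v` is a candidate (`mem_candidates`). And the substitution of the algorithm produces the same line
polynomials in `T ^ k`, with `k` the last coordinate of `v`; gcds commute with `T ↦ T ^ k`, so the
content is `P(y ^ k)` for the largest possible `P` (`typeContent_spec`). Factors in coordinate
directions have gone with the contents. Hence the bivariate algorithm is correct
(`multivariateQILD1_two_isSplit`).

More variables. The remainder of a bivariate call stays in `nonlinear` on its way to all variables.
First, an element `x ^ β P(x ^ v)` keeps this form when all variables but two are absorbed into the
coefficients (`noLinearDivisor_flatten`). Second, the substitution `y = x ^ μ` with normalized `μ`
is a split embedding of exponent lattices; a suitable left inverse turns a divisor `P(x ^ v)` into a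
unit `P(x ^ v')` with `v' ≠ 0` if `v ≠ 0`, so `P` is a unit times a power of its variable
(`NoLinearDivisor.expMap`).

Types stay distinct because, after the first pass, every `h` is primitive in `y`: each new type is
`a • μ` plus a multiple of the next unit vector, with `a ≠ 0`, and this determines the normalized
`μ` (`foldl_pairStep_spec`). The types of the recursive call vanish in the first two coordinates,
those of the loop do not. -/

noncomputable section

namespace QILD

/-! ### Laurent polynomials, numerators, and elements of the form `P(x ^ v)` -/

section LaurentBasics

variable {A : Type u} [CommRing A] {n : ℕ}

/-- The ring homomorphism on a group ring given by its values on coefficients and monomials. -/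
def monoidLift {G : Type*} [AddMonoid G] {S : Type*} [CommRing S] (φ : A →+* S)
    (χ : Multiplicative G →* S) : AddMonoidAlgebra A G →+* S :=
  AddMonoidAlgebra.liftNCRingHom φ χ fun _ _ => Commute.all _ _

@[simp] theorem monoidLift_single {G : Type*} [AddMonoid G] {S : Type*} [CommRing S]
    (φ : A →+* S) (χ : Multiplicative G →* S) (g : G) (a : A) :
    monoidLift φ χ (AddMonoidAlgebra.single g a) = φ a * χ (Multiplicative.ofAdd g) :=
  AddMonoidAlgebra.liftNC_single _ _ _ _

theorem mono_zero : mono A (0 : Fin n → ℤ) = 1 := rfl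

theorem mono_add (v w : Fin n → ℤ) : mono A (v + w) = mono A v * mono A w := by
  simp [mono, AddMonoidAlgebra.single_mul_single]

theorem mono_nsmul (k : ℕ) (v : Fin n → ℤ) : mono A (k • v) = mono A v ^ k := by
  induction k with
  | zero => simp [mono_zero]
  | succ k ih => rw [succ_nsmul, mono_add, ih, pow_succ]

theorem mono_neg_mul (v : Fin n → ℤ) : mono A (-v) * mono A v = 1 := by
  rw [← mono_add, neg_add_cancel, mono_zero]

theorem isUnit_mono (v : Fin n → ℤ) : IsUnit (mono A v) :=
  IsUnit.of_mul_eq_one (mono A (-v)) (by rw [mul_comm, mono_neg_mul])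

theorem single_eq_algebraMap_mul (v : Fin n → ℤ) (a : A) :
    (AddMonoidAlgebra.single v a : Laurent n A) = algebraMap A (Laurent n A) a * mono A v := by
  simp [mono, AddMonoidAlgebra.single_mul_single]

theorem algebraMap_eq_single (a : A) :
    algebraMap A (Laurent n A) a = AddMonoidAlgebra.single 0 a := rfl

/-- An exponent vector, with integer entries. -/
def intVec (e : Fin n →₀ ℕ) : Fin n → ℤ := fun i => (e i : ℤ)

theorem intVec_injective : Function.Injective (intVec (n := n)) := by
  intro e e' h
  ext i
  have := congrFun h i
  simpa [intVec] using this

theorem toLaurent_monomial (e : Fin n →₀ ℕ) (a : A) :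
    toLaurent (MvPolynomial.monomial e a) = AddMonoidAlgebra.single (intVec e) a := by
  rw [toLaurent, MvPolynomial.aeval_monomial, single_eq_algebraMap_mul]
  congr 1
  rw [Finsupp.prod_fintype _ _ (by simp)]
  have : intVec e = ∑ i, (e i) • (Pi.single i 1 : Fin n → ℤ) := by
    ext j
    simp [intVec, Finset.sum_apply, Pi.single_apply]
  rw [this]
  have key : ∀ s : Finset (Fin n), mono A (∑ i ∈ s, (e i) • (Pi.single i 1 : Fin n → ℤ)) =
      ∏ i ∈ s, var A i ^ e i := by
    intro s
    classical
    induction s using Finset.induction_on with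
    | empty => simp [mono_zero]
    | insert a s ha ih => rw [Finset.sum_insert ha, Finset.prod_insert ha, mono_add, ih,
        mono_nsmul, var]
  rw [key]

theorem toLaurent_C (a : A) : toLaurent (MvPolynomial.C a : MvPolynomial (Fin n) A) =
    algebraMap A (Laurent n A) a := by
  simp [toLaurent]

theorem toLaurent_X (i : Fin n) : toLaurent (MvPolynomial.X i : MvPolynomial (Fin n) A) =
    var A i := by
  simp [toLaurent]

theorem coeff_toLaurent (f : MvPolynomial (Fin n) A) (e : Fin n →₀ ℕ) :
    (toLaurent f).coeff (intVec e) = f.coeff e := by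
  classical
  induction f using MvPolynomial.induction_on' with
  | monomial e' a =>
    rw [toLaurent_monomial, AddMonoidAlgebra.coeff_single, MvPolynomial.coeff_monomial,
      Finsupp.single_apply]
    simp [intVec_injective.eq_iff]
  | add p q hp hq => simp [hp, hq]

theorem exists_of_coeff_toLaurent_ne_zero (f : MvPolynomial (Fin n) A) (w : Fin n → ℤ)
    (h : (toLaurent f).coeff w ≠ 0) : ∃ e ∈ f.support, intVec e = w := by
  classical
  suffices hs : ∃ e, intVec e = w by
    obtain ⟨e, rfl⟩ := hs
    exact ⟨e, by rwa [MvPolynomial.mem_support_iff, ← coeff_toLaurent], rfl⟩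
  contrapose! h
  induction f using MvPolynomial.induction_on' with
  | monomial e' a =>
    rw [toLaurent_monomial, AddMonoidAlgebra.coeff_single, Finsupp.single_apply]
    simp [h]
  | add p q hp hq => simp [hp, hq]

theorem toLaurent_injective : Function.Injective (toLaurent (A := A) (n := n)) := by
  intro f g h
  ext e
  rw [← coeff_toLaurent, h, coeff_toLaurent]

theorem toLaurent_eq_zero {f : MvPolynomial (Fin n) A} : toLaurent f = 0 ↔ f = 0 :=
  map_eq_zero_iff _ toLaurent_injective

theorem coeff_mono_mul (v w : Fin n → ℤ) (F : Laurent n A) :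
    (mono A v * F).coeff w = F.coeff (w - v) := by
  rw [mono, AddMonoidAlgebra.coeff_single_mul_apply, one_mul]
  congr 1; abel

theorem toLaurent_num (F : Laurent n A) :
    toLaurent (num F) = mono A (fun i => (den F i : ℤ)) * F := by
  have h : mono A (fun i => (den F i : ℤ)) * F = ∑ e ∈ F.coeff.support,
      mono A (fun i => (den F i : ℤ)) * AddMonoidAlgebra.single e (F.coeff e) := by
    rw [← Finset.mul_sum]
    exact congrArg _ F.sum_coeff_single.symm
  rw [num, Finsupp.sum, map_sum, h]
  refine Finset.sum_congr rfl fun e he => ?_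
  rw [toLaurent_monomial, mono, AddMonoidAlgebra.single_mul_single, one_mul]
  congr 1
  ext i
  have : (-(e i)).toNat ≤ den F i :=
    Finset.le_sup (f := fun e : Fin n → ℤ => (-(e i)).toNat) he
  simp only [intVec, Finsupp.equivFunOnFinite_symm_apply_apply, Pi.add_apply]
  omega

theorem X_dvd_iff {f : MvPolynomial (Fin n) A} {j : Fin n} :
    MvPolynomial.X j ∣ f ↔ ∀ e ∈ f.support, e j ≠ 0 := by
  classical
  rw [MvPolynomial.X_dvd_iff_modMonomial_eq_zero]
  constructor
  · intro h e he h0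
    have := congrArg (MvPolynomial.coeff e) h
    rw [MvPolynomial.coeff_modMonomial_of_not_le] at this
    · exact MvPolynomial.mem_support_iff.1 he (by simpa using this)
    · intro hle
      have := hle j
      simp [h0] at this
  · intro h
    ext e
    by_cases hle : Finsupp.single j 1 ≤ e
    · rw [MvPolynomial.coeff_modMonomial_of_le _ hle]; simp
    · rw [MvPolynomial.coeff_modMonomial_of_not_le _ hle]
      by_contra hne
      have := h e (MvPolynomial.mem_support_iff.2 hne)
      exact hle (by simpa [Finsupp.single_le_iff] using Nat.one_le_iff_ne_zero.2 this)

theorem exists_toLaurent_eq_mul_of_dvd [IsDomain A] {F : Laurent n A}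
    {b : MvPolynomial (Fin n) A} (h : F ∣ toLaurent b) :
    ∃ e : Fin n →₀ ℕ, num F ∣ MvPolynomial.monomial e 1 * b := by
  obtain ⟨G, hG⟩ := h
  refine ⟨Finsupp.equivFunOnFinite.symm (den F + den G), num G, toLaurent_injective ?_⟩
  rw [map_mul, map_mul, toLaurent_num, toLaurent_num, hG, toLaurent_monomial]
  have : intVec (Finsupp.equivFunOnFinite.symm (den F + den G)) =
      (fun i => (den F i : ℤ)) + fun i => (den G i : ℤ) := by
    ext i; simp [intVec]
  rw [this, ← mono, mono_add]
  ring

theorem dvd_of_dvd_monomial_mul [IsDomain A] {a b : MvPolynomial (Fin n) A} {e : Fin n →₀ ℕ}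
    (ha : ∀ j, ¬ MvPolynomial.X j ∣ a) (h : a ∣ MvPolynomial.monomial e 1 * b) : a ∣ b := by
  obtain ⟨m, r, -, hr, rfl⟩ := MvPolynomial.dvd_monomial_mul_iff_exists.1 h
  by_cases hm : m = 0
  · subst hm; simpa using hr
  · obtain ⟨j, hj⟩ := Finsupp.ne_iff.1 hm
    exact absurd (Dvd.dvd.mul_right (MvPolynomial.X_dvd_monomial.2 (Or.inr hj)) r) (ha j)

/-- Clearing the denominator of the cofactor costs a monomial, and an `a` divisible by no variable
has no variable in common with it. This is how divisibility comes back from the Laurent ring. -/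
theorem dvd_of_toLaurent_dvd [IsDomain A] {a b : MvPolynomial (Fin n) A}
    (ha : ∀ j, ¬ MvPolynomial.X j ∣ a) (h : toLaurent a ∣ toLaurent b) : a ∣ b := by
  obtain ⟨G, hG⟩ := h
  refine dvd_of_dvd_monomial_mul (e := Finsupp.equivFunOnFinite.symm (den G)) ha
    ⟨num G, toLaurent_injective ?_⟩
  rw [map_mul, map_mul, toLaurent_num, hG, toLaurent_monomial]
  have : intVec (Finsupp.equivFunOnFinite.symm (den G)) = fun i => (den G i : ℤ) := by
    ext i; simp [intVec]
  rw [this, ← mono]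
  ring

theorem C_dvd_of_algebraMap_dvd {a : A} {b : MvPolynomial (Fin n) A}
    (h : algebraMap A (Laurent n A) a ∣ toLaurent b) : MvPolynomial.C a ∣ b := by
  rw [MvPolynomial.C_dvd_iff_dvd_coeff]
  intro e
  obtain ⟨G, hG⟩ := h
  rw [← coeff_toLaurent, hG, algebraMap_eq_single, AddMonoidAlgebra.coeff_single_mul_apply]
  exact dvd_mul_right _ _

theorem primitive_iff {f : MvPolynomial (Fin n) A} :
    Primitive f ↔ ∀ a : A, algebraMap A (Laurent n A) a ∣ toLaurent f → IsUnit a := by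
  constructor
  · exact fun h a ha => h a (C_dvd_of_algebraMap_dvd ha)
  · intro h a ha
    apply h
    rw [← toLaurent_C]
    exact map_dvd _ ha

/-- In each variable, some exponent that occurs in `F` is not positive. -/
def TouchesAxes (F : Laurent n A) : Prop := ∀ j, ∃ e, F.coeff e ≠ 0 ∧ e j ≤ 0

theorem touchesAxes_toLaurent {f : MvPolynomial (Fin n) A} :
    TouchesAxes (toLaurent f) ↔ ∀ j, ¬ MvPolynomial.X j ∣ f := by
  refine forall_congr' fun j => ?_
  rw [X_dvd_iff]
  push Not
  constructor
  · rintro ⟨w, hw, hj⟩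
    obtain ⟨e, he, rfl⟩ := exists_of_coeff_toLaurent_ne_zero f w hw
    refine ⟨e, he, ?_⟩
    simpa [intVec] using hj
  · rintro ⟨e, he, hj⟩
    refine ⟨intVec e, ?_, by simp [intVec, hj]⟩
    rwa [coeff_toLaurent, ← MvPolynomial.mem_support_iff]

theorem touchesAxes_iff {F : Laurent n A} :
    TouchesAxes F ↔ ∀ j, ¬ MvPolynomial.X j ∣ num F := by
  rw [← touchesAxes_toLaurent, toLaurent_num]
  refine forall_congr' fun j => ?_
  constructor
  · rintro ⟨e, he, hj⟩
    by_cases hd : den F j = 0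
    · refine ⟨e + fun i => (den F i : ℤ), ?_, ?_⟩
      · rw [coeff_mono_mul]; simpa using he
      · simp [hd, hj]
    · obtain ⟨e', he', hj'⟩ := Finset.exists_mem_eq_sup F.coeff.support
        ⟨e, Finsupp.mem_support_iff.2 he⟩ fun e => (-(e j)).toNat
      refine ⟨e' + fun i => (den F i : ℤ), ?_, ?_⟩
      · rw [coeff_mono_mul]; simpa using he'
      · have : den F j = (-(e' j)).toNat := hj'
        simp only [Pi.add_apply]
        omega
  · rintro ⟨w, hw, hj⟩
    rw [coeff_mono_mul] at hw
    refine ⟨_, hw, ?_⟩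
    simp only [Pi.sub_apply]
    omega

/-- Numerators turn the condition into divisibility by no variable, which products preserve because
variables are prime. -/
theorem TouchesAxes.mul [IsDomain A] {F G : Laurent n A} (hF : TouchesAxes F)
    (hG : TouchesAxes G) : TouchesAxes (F * G) := by
  rw [touchesAxes_iff] at hF hG
  have h : TouchesAxes (toLaurent (num F * num G)) :=
    touchesAxes_toLaurent.2 fun j hj => (MvPolynomial.X_dvd_mul_iff.1 hj).elim (hF j) (hG j)
  have e : toLaurent (num F * num G) =
      mono A ((fun i => (den F i : ℤ)) + fun i => (den G i : ℤ)) * (F * G) := by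
    rw [map_mul, toLaurent_num, toLaurent_num, mono_add]; ring
  intro j
  obtain ⟨w, hw, hj⟩ := h j
  rw [e, coeff_mono_mul] at hw
  refine ⟨_, hw, ?_⟩
  simp only [Pi.sub_apply, Pi.add_apply]
  omega

theorem touchesAxes_one [Nontrivial A] : TouchesAxes (1 : Laurent n A) := fun j =>
  ⟨0, by rw [AddMonoidAlgebra.one_def]; simp, le_rfl⟩

theorem TouchesAxes.list_prod [IsDomain A] {l : List (Laurent n A)}
    (h : ∀ F ∈ l, TouchesAxes F) : TouchesAxes l.prod := by
  induction l with
  | nil => simpa using touchesAxes_one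
  | cons F l ih =>
    rw [List.prod_cons]
    exact (h F (by simp)).mul (ih fun G hG => h G (by simp [hG]))

theorem evalMono_eq_sum (v : Fin n → ℤ) (P : Polynomial A) :
    evalMono v P = P.sum fun i a => AddMonoidAlgebra.single (i • v) a := by
  rw [evalMono, Polynomial.aeval_eq_sum_range, Polynomial.sum_over_range _ (by simp)]
  refine Finset.sum_congr rfl fun i _ => ?_
  rw [← mono_nsmul, mono, AddMonoidAlgebra.smul_single, smul_eq_mul, mul_one]

theorem evalMono_mul (v : Fin n → ℤ) (P Q : Polynomial A) :
    evalMono v (P * Q) = evalMono v P * evalMono v Q := map_mul _ _ _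

theorem evalMono_C (v : Fin n → ℤ) (a : A) :
    evalMono v (Polynomial.C a) = algebraMap A (Laurent n A) a := by simp [evalMono]

theorem evalMono_X_pow (v : Fin n → ℤ) (i : ℕ) :
    evalMono v (Polynomial.X ^ i : Polynomial A) = mono A (i • v) := by
  rw [evalMono, map_pow, Polynomial.aeval_X, mono_nsmul]

theorem evalMono_zero_left (P : Polynomial A) :
    evalMono (0 : Fin n → ℤ) P = algebraMap A (Laurent n A) (P.eval 1) := by
  rw [evalMono, mono_zero, Polynomial.aeval_def, ← map_one (algebraMap A (Laurent n A)),
    Polynomial.eval₂_at_apply]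

theorem evalMono_nsmul (v : Fin n → ℤ) (k : ℕ) (P : Polynomial A) :
    evalMono (k • v) P = evalMono v (Polynomial.expand A k P) := by
  rw [evalMono, evalMono, Polynomial.expand_aeval, mono_nsmul]

/-- Reversing the coefficients trades `-v` for `v` up to a unit, so only one of two opposite
directions needs attention. -/
theorem evalMono_neg (v : Fin n → ℤ) (P : Polynomial A) :
    evalMono (-v) P = mono A (-(P.natDegree • v)) * evalMono v P.reverse := by
  let : Invertible (mono A (-v)) :=
    ⟨mono A v, by rw [mul_comm, mono_neg_mul], mono_neg_mul v⟩
  have h := Polynomial.eval₂_reverse_mul_pow (algebraMap A (Laurent n A)) (mono A (-v)) P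
  have hi : ⅟(mono A (-v)) = mono A v := rfl
  rw [hi] at h
  rw [evalMono, evalMono, Polynomial.aeval_def, Polynomial.aeval_def, ← smul_neg, mono_nsmul,
    mul_comm, h]

theorem coeff_evalMono {v : Fin n → ℤ} (hv : v ≠ 0) (P : Polynomial A) (i : ℕ) :
    (evalMono v P).coeff (i • v) = P.coeff i := by
  classical
  rw [evalMono_eq_sum, Polynomial.sum, AddMonoidAlgebra.coeff_sum, Finsupp.finsetSum_apply]
  have hinj : ∀ j : ℕ, j • v = i • v ↔ j = i := fun j => by
    obtain ⟨l, hl⟩ := Function.ne_iff.1 hv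
    constructor
    · intro h
      have := congrFun h l
      simp only [Pi.smul_apply, nsmul_eq_mul] at this
      exact_mod_cast mul_right_cancel₀ hl this
    · rintro rfl; rfl
  simp only [AddMonoidAlgebra.coeff_single, Finsupp.single_apply, hinj]
  simp only [Finset.sum_ite_eq', Polynomial.mem_support_iff, ne_eq, ite_not]
  split_ifs with h
  · exact h.symm
  · rfl

theorem touchesAxes_evalMono {v : Fin n → ℤ} (hv : v ≠ 0) {P : Polynomial A}
    (hP : P.coeff 0 ≠ 0) : TouchesAxes (evalMono v P) := fun j =>
  ⟨0, by have := coeff_evalMono hv P 0; rw [zero_smul] at this; rwa [this], le_rfl⟩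

theorem isUnit_evalMono_of_monomial (v : Fin n → ℤ) {a : A} (ha : IsUnit a) (i : ℕ) :
    IsUnit (evalMono v (Polynomial.C a * Polynomial.X ^ i)) := by
  rw [evalMono_mul, evalMono_C, evalMono_X_pow]
  exact (ha.map _).mul (isUnit_mono _)

/-- The homomorphism `x ^ u ↦ T ^ (v · u)` sends `P(x ^ v)` to `P(T ^ d)` with `d = v · v > 0`. A
unit there divides a power of the prime `T`, so `P(T ^ d)`, and with it `P`, is a unit times a power
of the variable. -/
theorem eq_C_mul_X_pow_of_isUnit [IsDomain A] {v : Fin n → ℤ} (hv : v ≠ 0) {P : Polynomial A}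
    (h : IsUnit (evalMono v P)) :
    ∃ a i, IsUnit a ∧ P = Polynomial.C a * Polynomial.X ^ i := by
  let χ : Multiplicative (Fin n → ℤ) →* LaurentPolynomial A :=
    { toFun := fun u => LaurentPolynomial.T (v ⬝ᵥ u.toAdd)
      map_one' := by simp
      map_mul' := fun a b => by rw [toAdd_mul, dotProduct_add, LaurentPolynomial.T_add] }
  let d : ℕ := (v ⬝ᵥ v).toNat
  have hd0 : 0 < v ⬝ᵥ v := by
    refine lt_of_le_of_ne (Finset.sum_nonneg fun i _ => mul_self_nonneg _) (Ne.symm ?_)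
    rwa [Ne, dotProduct_self_eq_zero]
  have hd : ((d : ℕ) : ℤ) = v ⬝ᵥ v := Int.toNat_of_nonneg hd0.le
  have key : monoidLift LaurentPolynomial.C χ (evalMono v P) =
      Polynomial.toLaurent (Polynomial.expand A d P) := by
    rw [evalMono_eq_sum, Polynomial.sum, map_sum]
    conv_rhs => rw [P.as_sum_support, map_sum, map_sum]
    refine Finset.sum_congr rfl fun i _ => ?_
    rw [monoidLift_single, Polynomial.expand_monomial, ← Polynomial.C_mul_X_pow_eq_monomial,
      Polynomial.toLaurent_C_mul_X_pow]
    have hχ : χ (Multiplicative.ofAdd (i • v)) = LaurentPolynomial.T (v ⬝ᵥ (i • v)) := rfl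
    rw [hχ, dotProduct_smul, ← hd]
    congr 2
  have hu := h.map (monoidLift LaurentPolynomial.C χ)
  rw [key] at hu
  obtain ⟨H, hH⟩ := hu.dvd (a := (1 : LaurentPolynomial A))
  obtain ⟨s, H', hH'⟩ := H.exists_T_pow
  have hpoly : Polynomial.expand A d P * H' = Polynomial.X ^ s := by
    apply Polynomial.toLaurent_injective
    rw [map_mul, hH', ← mul_assoc, ← hH, one_mul, Polynomial.toLaurent_X_pow]
  obtain ⟨i, -, hi⟩ := (dvd_prime_pow Polynomial.prime_X s).1 ⟨H', hpoly.symm⟩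
  obtain ⟨w, hw⟩ := hi.symm
  obtain ⟨a, ha, hwa⟩ := Polynomial.isUnit_iff.1 w.isUnit
  have hd1 : 0 < d := by omega
  have hPd : P = Polynomial.contract d (Polynomial.C a * Polynomial.X ^ i) := by
    rw [hwa, mul_comm, hw, Polynomial.contract_expand _ hd1.ne']
  by_cases hdi : d ∣ i
  · obtain ⟨l, rfl⟩ := hdi
    refine ⟨a, l, ha, ?_⟩
    rw [hPd]
    ext j
    rw [Polynomial.coeff_contract hd1.ne', Polynomial.coeff_C_mul_X_pow,
      Polynomial.coeff_C_mul_X_pow]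
    congr 1
    rw [mul_comm j d, Nat.mul_right_inj hd1.ne']
  · exfalso
    have : P = 0 := by
      rw [hPd]
      ext j
      rw [Polynomial.coeff_contract hd1.ne', Polynomial.coeff_C_mul_X_pow, if_neg]
      · simp
      · rintro rfl; exact hdi (dvd_mul_left _ _)
    rw [this, evalMono, map_zero] at h
    exact not_isUnit_zero h

/-- Every divisor of `F` of the form `P(x ^ v)` is a unit. -/
def NoLinearDivisor (F : Laurent n A) : Prop :=
  ∀ (v : Fin n → ℤ) (P : Polynomial A), evalMono v P ∣ F → IsUnit (evalMono v P)

theorem noLinearDivisor_of_isUnit {F : Laurent n A} (h : IsUnit F) : NoLinearDivisor F :=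
  fun _ _ hd => isUnit_of_dvd_unit hd h

theorem NoLinearDivisor.of_dvd {F G : Laurent n A} (h : NoLinearDivisor G) (hd : F ∣ G) :
    NoLinearDivisor F := fun v P hP => h v P (hP.trans hd)

/-- The products of Laurent polynomials without integer-linear divisors. -/
def nonlinear (n : ℕ) (A : Type u) [CommRing A] : Submonoid (Laurent n A) :=
  Submonoid.closure {F | NoLinearDivisor F}

theorem mem_nonlinear_of_isUnit {F : Laurent n A} (h : IsUnit F) : F ∈ nonlinear n A :=
  Submonoid.subset_closure (noLinearDivisor_of_isUnit h)

theorem mem_nonlinear {F : Laurent n A} (h : NoLinearDivisor F) : F ∈ nonlinear n A :=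
  Submonoid.subset_closure h

/-- No prime element `P(x ^ v)` divides a product of elements without such divisors. -/
theorem not_dvd_of_mem_nonlinear {F : Laurent n A} (hF : F ∈ nonlinear n A) {v : Fin n → ℤ}
    {P : Polynomial A} (hp : Prime (evalMono v P)) : ¬ evalMono v P ∣ F := by
  induction hF using Submonoid.closure_induction with
  | mem F hF => exact fun h => hp.not_isUnit (hF v P h)
  | one => exact fun h => hp.not_isUnit (isUnit_of_dvd_one h)
  | mul F G _ _ h1 h2 => exact fun h => (hp.dvd_or_dvd h).elim h1 h2

/-- A prime polynomial is prime as a Laurent polynomial unless it is a variable. -/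
theorem prime_toLaurent [IsDomain A] {r : MvPolynomial (Fin n) A} (hr : Prime r)
    (hX : ∀ j, ¬ MvPolynomial.X j ∣ r) : Prime (toLaurent r) := by
  refine ⟨fun h => hr.ne_zero (toLaurent_eq_zero.1 h), fun h => ?_, fun F G h => ?_⟩
  · have : toLaurent r ∣ toLaurent 1 := by rw [map_one]; exact h.dvd
    exact hr.not_isUnit (isUnit_of_dvd_one (dvd_of_toLaurent_dvd hX this))
  · have h' : toLaurent r ∣ toLaurent (num F * num G) := by
      rw [map_mul, toLaurent_num, toLaurent_num]
      refine h.trans ⟨mono A (fun i => (den F i : ℤ)) * mono A (fun i => (den G i : ℤ)), ?_⟩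
      ring
    have key : ∀ H : Laurent n A, r ∣ num H → toLaurent r ∣ H := by
      intro H hH
      have := map_dvd (toLaurent (A := A) (n := n)) hH
      rw [toLaurent_num] at this
      exact (isUnit_mono _).dvd_mul_left.1 this
    exact (hr.dvd_or_dvd (dvd_of_toLaurent_dvd hX h')).imp (key F) (key G)

end LaurentBasics

/-! ### Greatest common divisors under `X ↦ X ^ k` -/

section GcdExpand

variable {B : Type u} [CommRing B] [IsDomain B] [UniqueFactorizationMonoid B]

/-- Up to a unit of the fraction field, a nonzero polynomial over it comes from a primitive one. -/
theorem exists_isPrimitive_map_associated (g : Polynomial (FractionRing B)) (hg : g ≠ 0) :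
    ∃ G : Polynomial B, G.IsPrimitive ∧
      Associated (G.map (algebraMap B (FractionRing B))) g := by
  obtain ⟨i⟩ : Nonempty (NormalizedGCDMonoid B) := inferInstance
  obtain ⟨b, hbm, hb⟩ := IsLocalization.integerNormalization_spec (nonZeroDivisors B) g
  set N := IsLocalization.integerNormalization (nonZeroDivisors B) g with hN
  have hb0 : algebraMap B (FractionRing B) b ≠ 0 := by
    simpa using nonZeroDivisors.ne_zero hbm
  have hbg : N.map (algebraMap B (FractionRing B)) =
      Polynomial.C (algebraMap B (FractionRing B) b) * g := by
    rw [hb, Algebra.smul_def]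
    rfl
  have hN0 : N ≠ 0 := by
    intro h
    rw [h, Polynomial.map_zero] at hbg
    exact mul_ne_zero (Polynomial.C_ne_zero.2 hb0) hg hbg.symm
  refine ⟨N.primPart, N.isPrimitive_primPart, ?_⟩
  have hc : algebraMap B (FractionRing B) N.content ≠ 0 := by
    simpa [Polynomial.content_eq_zero_iff] using hN0
  have h1 : N.map (algebraMap B (FractionRing B)) =
      Polynomial.C (algebraMap B (FractionRing B) N.content) *
        N.primPart.map (algebraMap B (FractionRing B)) := by
    conv_lhs => rw [N.eq_C_content_mul_primPart]
    rw [Polynomial.map_mul, Polynomial.map_C]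
  rw [h1] at hbg
  refine (associated_unit_mul_left _ _ (Polynomial.isUnit_C.2 hc.isUnit)).symm.trans ?_
  rw [hbg]
  exact associated_unit_mul_left _ _ (Polynomial.isUnit_C.2 hb0.isUnit)

/-- Greatest common divisors commute with the substitution `X ↦ X ^ k`. -/
theorem exists_common_divisor_of_dvd_expand (S : Set (Polynomial B)) {Q : Polynomial B}
    (hQ : Q.IsPrimitive) {k : ℕ} (h : ∀ q ∈ S, Q ∣ Polynomial.expand B k q) :
    ∃ G, (∀ q ∈ S, G ∣ q) ∧ Q ∣ Polynomial.expand B k G := by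
  let K := FractionRing B
  let φ : Polynomial B →+* Polynomial K := Polynomial.mapRingHom (algebraMap B K)
  let I : Ideal (Polynomial K) := Ideal.span (φ '' S)
  obtain ⟨g, hg⟩ := IsPrincipalIdealRing.principal I
  have hgI : g ∈ I := by rw [hg]; exact Ideal.mem_span_singleton_self g
  have hdiv : ∀ q ∈ S, g ∣ φ q := fun q hq => by
    have : φ q ∈ I := Ideal.subset_span ⟨q, hq, rfl⟩
    rw [hg] at this
    exact Ideal.mem_span_singleton.1 this
  have hmap : ∀ q : Polynomial B, φ (Polynomial.expand B k q) = Polynomial.expand K k (φ q) :=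
    fun q => Polynomial.map_expand
  -- Over the field `K` the gcd `g` is a combination of the images of `S`, and a ring homomorphism
  -- such as `X ↦ X ^ k` preserves this relation.
  have hQg : φ Q ∣ Polynomial.expand K k g := by
    have hle : I ≤ (Ideal.span {φ Q}).comap (Polynomial.expand K k : _ →+* _) := by
      refine Ideal.span_le.2 ?_
      rintro _ ⟨q, hq, rfl⟩
      refine Ideal.mem_comap.2 (Ideal.mem_span_singleton.2 ?_)
      exact (map_dvd φ (h q hq)).trans (dvd_of_eq (hmap q))
    exact Ideal.mem_span_singleton.1 (Ideal.mem_comap.1 (hle hgI))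
  by_cases hg0 : g = 0
  · refine ⟨0, fun q hq => ?_, by simp⟩
    have := hdiv q hq
    rw [hg0, zero_dvd_iff] at this
    rw [(Polynomial.map_eq_zero_iff (IsFractionRing.injective B K)).1 this]
  -- Gauss's lemma, for the primitive polynomials `G` and `Q`, brings both divisibilities back to
  -- `B`.
  · obtain ⟨G, hG, hGg⟩ := exists_isPrimitive_map_associated g hg0
    refine ⟨G, fun q hq => ?_, ?_⟩
    · exact hG.dvd_of_fraction_map_dvd_fraction_map (K := K) (hGg.dvd.trans (hdiv q hq))
    · refine hQ.dvd_of_fraction_map_dvd_fraction_map (K := K) (hQg.trans ?_)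
      change _ ∣ φ _
      rw [hmap]
      exact map_dvd _ hGg.symm.dvd

end GcdExpand

/-! ### Splitting a bivariate Laurent polynomial along parallel lines -/

section Grading

variable {B : Type u} [CommRing B]

/-- The graded form of a bivariate Laurent polynomial: `x ^ u` becomes `T ^ t(u)` in degree
`c(u)`. -/
def gradeHom (c t : (Fin 2 → ℤ) →+ ℤ) :
    Laurent 2 B →+* AddMonoidAlgebra (LaurentPolynomial B) ℤ :=
  monoidLift (AddMonoidAlgebra.singleZeroRingHom.comp LaurentPolynomial.C)
    { toFun := fun u => AddMonoidAlgebra.single (c u.toAdd) (LaurentPolynomial.T (t u.toAdd))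
      map_one' := by
        rw [toAdd_one, map_zero, map_zero, LaurentPolynomial.T_zero]; rfl
      map_mul' := fun a b => by
        rw [toAdd_mul, map_add, map_add, LaurentPolynomial.T_add,
          AddMonoidAlgebra.single_mul_single] }

theorem gradeHom_single (c t : (Fin 2 → ℤ) →+ ℤ) (u : Fin 2 → ℤ) (a : B) :
    gradeHom c t (AddMonoidAlgebra.single u a) =
      AddMonoidAlgebra.single (c u) (AddMonoidAlgebra.single (t u) a) := by
  have h : gradeHom c t (AddMonoidAlgebra.single u a) =
      AddMonoidAlgebra.single 0 (LaurentPolynomial.C a) *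
        AddMonoidAlgebra.single (c u) (LaurentPolynomial.T (t u)) := monoidLift_single _ _ _ _
  rw [h, AddMonoidAlgebra.single_mul_single, zero_add, ← LaurentPolynomial.single_eq_C_mul_T]

theorem coeff_gradeHom {c t : (Fin 2 → ℤ) →+ ℤ}
    (hinj : ∀ u u', c u = c u' → t u = t u' → u = u') (F : Laurent 2 B) (u : Fin 2 → ℤ) :
    ((gradeHom c t F).coeff (c u)).coeff (t u) = F.coeff u := by
  classical
  induction F using AddMonoidAlgebra.induction_linear with
  | zero => simp
  | add F G hF hG =>
    rw [map_add, AddMonoidAlgebra.coeff_add, Finsupp.add_apply, AddMonoidAlgebra.coeff_add,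
      Finsupp.add_apply, hF, hG, AddMonoidAlgebra.coeff_add, Finsupp.add_apply]
  | single u' a =>
    rw [gradeHom_single, AddMonoidAlgebra.coeff_single, AddMonoidAlgebra.coeff_single,
      Finsupp.single_apply, Finsupp.single_apply]
    by_cases hu : u' = u
    · subst hu
      rw [if_pos rfl, if_pos rfl, AddMonoidAlgebra.coeff_single, Finsupp.single_eq_same]
    · rw [if_neg hu]
      split_ifs with h
      · rw [AddMonoidAlgebra.coeff_single, Finsupp.single_apply,
          if_neg fun h' => hu (hinj _ _ h h')]
      · rfl

theorem exists_of_coeff_gradeHom_ne_zero {c t : (Fin 2 → ℤ) →+ ℤ} (F : Laurent 2 B) (a b : ℤ)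
    (h : ((gradeHom c t F).coeff a).coeff b ≠ 0) : ∃ u, F.coeff u ≠ 0 ∧ c u = a ∧ t u = b := by
  classical
  contrapose! h
  have hs : F = ∑ u ∈ F.coeff.support, AddMonoidAlgebra.single u (F.coeff u) :=
    F.sum_coeff_single.symm
  rw [hs, map_sum, AddMonoidAlgebra.coeff_sum, Finsupp.finsetSum_apply,
    AddMonoidAlgebra.coeff_sum, Finsupp.finsetSum_apply]
  refine Finset.sum_eq_zero fun u hu => ?_
  rw [gradeHom_single, AddMonoidAlgebra.coeff_single, Finsupp.single_apply]
  split_ifs with h1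
  · rw [AddMonoidAlgebra.coeff_single, Finsupp.single_apply,
      if_neg (h u (Finsupp.mem_support_iff.1 hu) h1)]
  · rfl

theorem gradeHom_evalMono {c t : (Fin 2 → ℤ) →+ ℤ} {v : Fin 2 → ℤ} {k : ℕ} (hc : c v = 0)
    (ht : t v = k) (P : Polynomial B) : gradeHom c t (evalMono v P) =
      AddMonoidAlgebra.single 0 (Polynomial.toLaurent (Polynomial.expand B k P)) := by
  rw [evalMono_eq_sum, Polynomial.sum, map_sum]
  conv_rhs => rw [P.as_sum_support, map_sum, map_sum]
  rw [← AddMonoidAlgebra.singleAddHom_apply, map_sum]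
  refine Finset.sum_congr rfl fun i _ => ?_
  rw [gradeHom_single, map_nsmul, map_nsmul, hc, ht, smul_zero, Polynomial.expand_monomial,
    ← Polynomial.C_mul_X_pow_eq_monomial, Polynomial.toLaurent_C_mul_X_pow,
    AddMonoidAlgebra.singleAddHom_apply, ← LaurentPolynomial.single_eq_C_mul_T]
  congr 2

theorem single_zero_dvd_iff {R : Type*} [CommRing R] {r : R} {F : AddMonoidAlgebra R ℤ} :
    AddMonoidAlgebra.single 0 r ∣ F ↔ ∀ a, r ∣ F.coeff a := by
  constructor
  · rintro ⟨G, rfl⟩ a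
    rw [AddMonoidAlgebra.coeff_single_mul_apply]
    exact dvd_mul_right _ _
  · intro h
    have hs : F = ∑ u ∈ F.coeff.support, AddMonoidAlgebra.single u (F.coeff u) :=
      F.sum_coeff_single.symm
    rw [hs]
    refine Finset.dvd_sum fun u _ => ?_
    obtain ⟨s, hs⟩ := h u
    exact ⟨AddMonoidAlgebra.single u s, by
      rw [AddMonoidAlgebra.single_mul_single, zero_add, hs]⟩

/-- The value on `u` is constant on the lines with direction `v`. -/
def cross (v : Fin 2 → ℤ) : (Fin 2 → ℤ) →+ ℤ where
  toFun u := v 1 * u 0 - v 0 * u 1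
  map_zero' := by simp
  map_add' a b := by simp only [Pi.add_apply]; ring

theorem cross_apply (v u : Fin 2 → ℤ) : cross v u = v 1 * u 0 - v 0 * u 1 := rfl

/-- The dot product with `w`. -/
def dotHom (w : Fin 2 → ℤ) : (Fin 2 → ℤ) →+ ℤ where
  toFun u := w 0 * u 0 + w 1 * u 1
  map_zero' := by simp
  map_add' a b := by simp only [Pi.add_apply]; ring

theorem dotHom_apply (w u : Fin 2 → ℤ) : dotHom w u = w 0 * u 0 + w 1 * u 1 := rfl

variable {v w : Fin 2 → ℤ} (hw : dotHom w v = 1)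
include hw

theorem cross_dotHom_injective (u u' : Fin 2 → ℤ) (h1 : cross v u = cross v u')
    (h2 : dotHom w u = dotHom w u') : u = u' := by
  simp only [cross_apply, dotHom_apply] at h1 h2 hw
  ext i
  fin_cases i
  · change u 0 = u' 0
    linear_combination v 0 * h2 + w 1 * h1 - (u 0 - u' 0) * hw
  · change u 1 = u' 1
    linear_combination v 1 * h2 - w 0 * h1 - (u 1 - u' 1) * hw

/-- Since `w · v = 1`, the two forms are coordinates on `ℤ²` and the grading loses nothing. It sends
`x ^ v` to `T` in degree zero, and an element of degree zero divides exactly when it divides every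
homogeneous component. -/
theorem evalMono_dvd_iff (P : Polynomial B) (F : Laurent 2 B) :
    evalMono v P ∣ F ↔
      ∀ a, Polynomial.toLaurent P ∣ (gradeHom (cross v) (dotHom w) F).coeff a := by
  have hP := gradeHom_evalMono (c := cross v) (t := dotHom w) (v := v) (k := 1)
    (by rw [cross_apply]; ring) (by rw [hw]; simp) P
  rw [Polynomial.expand_one] at hP
  rw [← single_zero_dvd_iff, ← hP]
  refine ⟨fun h => map_dvd _ h, fun h => ?_⟩
  -- The basis dual to `dotHom w`, `cross v` consists of `v` and `(w 1, -w 0)`; the two characters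
  -- define a left inverse of the grading.
  let χ₁ : Multiplicative ℤ →* Laurent 2 B :=
    { toFun := fun a => mono B (a.toAdd • v)
      map_one' := by rw [toAdd_one, zero_smul, mono_zero]
      map_mul' := fun a b => by rw [toAdd_mul, add_smul, mono_add] }
  let χ₂ : Multiplicative ℤ →* Laurent 2 B :=
    { toFun := fun a => mono B (a.toAdd • ![w 1, -w 0])
      map_one' := by rw [toAdd_one, zero_smul, mono_zero]
      map_mul' := fun a b => by rw [toAdd_mul, add_smul, mono_add] }
  let ψ : AddMonoidAlgebra (LaurentPolynomial B) ℤ →+* Laurent 2 B :=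
    monoidLift (monoidLift (algebraMap B (Laurent 2 B)) χ₁) χ₂
  have hψ : ∀ G : Laurent 2 B, ψ (gradeHom (cross v) (dotHom w) G) = G := by
    intro G
    induction G using AddMonoidAlgebra.induction_linear with
    | zero => simp
    | add F G hF hG => rw [map_add, map_add, hF, hG]
    | single u a =>
      rw [gradeHom_single, monoidLift_single, monoidLift_single]
      change _ * mono B (dotHom w u • v) * mono B (cross v u • ![w 1, -w 0]) = _
      rw [mul_assoc, ← mono_add, single_eq_algebraMap_mul]
      congr 2
      simp only [cross_apply, dotHom_apply] at hw ⊢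
      ext i
      fin_cases i
      · change (w 0 * u 0 + w 1 * u 1) * v 0 + (v 1 * u 0 - v 0 * u 1) * w 1 = u 0
        linear_combination u 0 * hw
      · change (w 0 * u 0 + w 1 * u 1) * v 1 + (v 1 * u 0 - v 0 * u 1) * (-w 0) = u 1
        linear_combination u 1 * hw
  have := map_dvd ψ h
  rwa [hψ, hψ] at this

omit hw in
/-- The substitution `T ↦ T ^ k`. -/
def expandLaurent (B : Type u) [CommRing B] (k : ℕ) :
    LaurentPolynomial B →+* LaurentPolynomial B :=
  monoidLift LaurentPolynomial.C
    { toFun := fun a => LaurentPolynomial.T (k * a.toAdd)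
      map_one' := by rw [toAdd_one, mul_zero, LaurentPolynomial.T_zero]
      map_mul' := fun a b => by rw [toAdd_mul, mul_add, LaurentPolynomial.T_add] }

omit hw in
theorem expandLaurent_single (k : ℕ) (i : ℤ) (a : B) :
    expandLaurent B k (AddMonoidAlgebra.single i a) = AddMonoidAlgebra.single (k * i) a := by
  rw [LaurentPolynomial.single_eq_C_mul_T a (k * i)]
  exact monoidLift_single _ _ _ _

omit hw in
theorem expandLaurent_T (k : ℕ) (i : ℤ) :
    expandLaurent B k (LaurentPolynomial.T i) = LaurentPolynomial.T (k * i) :=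
  expandLaurent_single k i 1

omit hw in
theorem expandLaurent_toLaurent (k : ℕ) (P : Polynomial B) :
    expandLaurent B k (Polynomial.toLaurent P) =
      Polynomial.toLaurent (Polynomial.expand B k P) := by
  conv_lhs => rw [P.as_sum_support, map_sum, map_sum]
  conv_rhs => rw [P.as_sum_support, map_sum, map_sum]
  refine Finset.sum_congr rfl fun i _ => ?_
  rw [Polynomial.expand_monomial, ← Polynomial.C_mul_X_pow_eq_monomial,
    Polynomial.toLaurent_C_mul_X_pow, ← Polynomial.C_mul_X_pow_eq_monomial,
    Polynomial.toLaurent_C_mul_X_pow, ← LaurentPolynomial.single_eq_C_mul_T,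
    expandLaurent_single, LaurentPolynomial.single_eq_C_mul_T]
  congr 2
  push_cast; ring

/-- By `u 1 = v 1 * (w · u) - w 0 * cross v u`, parametrizing a line by the last exponent instead of
`w · u` replaces `T` by `T ^ k`, up to a power of `T` that depends only on the line. -/
theorem coeff_gradeHom_dotHom_last {k : ℕ} (hk : v 1 = k) (F : Laurent 2 B) (a : ℤ) :
    (gradeHom (cross v) (dotHom ![0, 1]) F).coeff a = LaurentPolynomial.T (-(w 0 * a)) *
      expandLaurent B k ((gradeHom (cross v) (dotHom w) F).coeff a) := by
  induction F using AddMonoidAlgebra.induction_linear with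
  | zero => simp
  | add F G hF hG => simp only [map_add, AddMonoidAlgebra.coeff_add, Finsupp.add_apply, hF, hG,
      mul_add]
  | single u b =>
    classical
    rw [gradeHom_single, gradeHom_single, AddMonoidAlgebra.coeff_single,
      AddMonoidAlgebra.coeff_single, Finsupp.single_apply, Finsupp.single_apply]
    split_ifs with h
    · rw [expandLaurent_single, LaurentPolynomial.T, AddMonoidAlgebra.single_mul_single, one_mul]
      congr 1
      rw [← h, ← hk]
      simp only [cross_apply, dotHom_apply] at hw ⊢
      change 0 * u 0 + 1 * u 1 = _
      linear_combination -u 1 * hw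
    · simp

end Grading

/-! ### The content after the substitution for a type -/

section TypeContent

variable {B : Type u} [CommRing B]

theorem dvd_cont_iff [IsDomain B] [UniqueFactorizationMonoid B] (ch : Choices.{u}) {σ : Type}
    (f : MvPolynomial σ B) (d : B) : d ∣ cont ch f ↔ ∀ e, d ∣ f.coeff e := by
  rw [cont, ch.dvd_gcd_iff]
  constructor
  · intro h e
    by_cases he : f.coeff e = 0
    · rw [he]; exact dvd_zero _
    · exact h _ (MvPolynomial.coeff_mem_coeffs e he)
  · intro h b hb
    obtain ⟨e, -, rfl⟩ := MvPolynomial.mem_coeffs_iff.1 hb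
    exact h e

theorem toLaurent_dvd_toLaurent [IsDomain B] {D p : Polynomial B} (hD : D.coeff 0 ≠ 0)
    (h : Polynomial.toLaurent D ∣ Polynomial.toLaurent p) : D ∣ p := by
  obtain ⟨H, hH⟩ := h
  obtain ⟨s, H', hH'⟩ := H.exists_T_pow
  have h1 : D * H' = p * Polynomial.X ^ s := by
    apply Polynomial.toLaurent_injective
    rw [map_mul, map_mul, hH', hH, Polynomial.toLaurent_X_pow]; ring
  have hX : ¬ Polynomial.X ∣ D := by rwa [Polynomial.X_dvd_iff]
  obtain ⟨H'', rfl⟩ := Polynomial.prime_X.pow_dvd_of_dvd_mul_left s hX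
    (show Polynomial.X ^ s ∣ D * H' from h1 ▸ dvd_mul_left _ _)
  refine ⟨H'', ?_⟩
  have hXs : (Polynomial.X : Polynomial B) ^ s ≠ 0 := pow_ne_zero _ Polynomial.X_ne_zero
  apply mul_right_cancel₀ hXs
  rw [← h1]; ring

theorem viewInit_monomial (e : Fin 2 →₀ ℕ) (a : B) :
    viewInit (MvPolynomial.monomial e a : MvPolynomial (Fin 2) B) =
      MvPolynomial.monomial (Finsupp.single 0 (e 0))
        (Polynomial.C a * Polynomial.X ^ (e 1)) := by
  rw [viewInit, MvPolynomial.aeval_monomial, Finsupp.prod_fintype _ _ (by simp),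
    Fin.prod_univ_two]
  have h0 : (Fin.snoc (α := fun _ => MvPolynomial (Fin 1) (Polynomial B))
    (fun j => MvPolynomial.X j) (MvPolynomial.C Polynomial.X) : Fin 2 → _) 0 =
      MvPolynomial.X 0 := rfl
  have h1 : (Fin.snoc (α := fun _ => MvPolynomial (Fin 1) (Polynomial B))
    (fun j => MvPolynomial.X j) (MvPolynomial.C Polynomial.X) : Fin 2 → _) 1 =
      MvPolynomial.C Polynomial.X := rfl
  have ha : algebraMap B (MvPolynomial (Fin 1) (Polynomial B)) a =
      MvPolynomial.C (Polynomial.C a) := rfl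
  rw [h0, h1, ha, ← MvPolynomial.C_pow, MvPolynomial.monomial_eq, Finsupp.prod_single_index
    (by simp), MvPolynomial.C_mul]
  ring

theorem toLaurent_coeff_viewInit (g : MvPolynomial (Fin 2) B) (m : Fin 1 →₀ ℕ) :
    Polynomial.toLaurent ((viewInit g).coeff m) =
      (gradeHom (dotHom ![1, 0]) (dotHom ![0, 1]) (toLaurent g)).coeff (m 0 : ℤ) := by
  classical
  induction g using MvPolynomial.induction_on' with
  | monomial e a =>
    rw [viewInit_monomial, MvPolynomial.coeff_monomial, toLaurent_monomial, gradeHom_single,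
      AddMonoidAlgebra.coeff_single, Finsupp.single_apply]
    have h0 : dotHom ![1, 0] (intVec e) = (e 0 : ℤ) := by simp [dotHom_apply, intVec]
    have h1 : dotHom ![0, 1] (intVec e) = (e 1 : ℤ) := by simp [dotHom_apply, intVec]
    have hm : Finsupp.single 0 (e 0) = m ↔ (e 0 : ℤ) = (m 0 : ℤ) := by
      rw [Nat.cast_inj]
      constructor
      · rintro rfl; simp
      · intro h
        ext
        simpa using h
    rw [h0, h1]
    simp only [hm]
    split_ifs
    · rw [Polynomial.toLaurent_C_mul_X_pow, LaurentPolynomial.single_eq_C_mul_T]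
    · simp
  | add p q hp hq => simp only [map_add, MvPolynomial.coeff_add, hp, hq,
      AddMonoidAlgebra.coeff_add, Finsupp.add_apply]

/-- The substitution made to split off factors of type `v`. -/
def typeSubst (v : Fin 2 → ℤ) (f : MvPolynomial (Fin 2) B) : Laurent 2 B :=
  MvPolynomial.aeval (Fin.snoc (α := fun _ => Laurent 2 B)
    (fun i : Fin 1 => mono B (Pi.single i.castSucc (v (Fin.last 1))))
    (mono B (Fin.snoc (α := fun _ => ℤ) (fun i : Fin 1 => -v i.castSucc) 1))) f

theorem typeSubst_monomial (v : Fin 2 → ℤ) (e : Fin 2 →₀ ℕ) (a : B) :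
    typeSubst v (MvPolynomial.monomial e a) =
      AddMonoidAlgebra.single ![cross v (intVec e), (e 1 : ℤ)] a := by
  rw [typeSubst, MvPolynomial.aeval_monomial, Finsupp.prod_fintype _ _ (by simp),
    Fin.prod_univ_two, single_eq_algebraMap_mul]
  congr 1
  change mono B (Pi.single 0 (v 1)) ^ e 0 * mono B (Fin.snoc (α := fun _ => ℤ)
    (fun i : Fin 1 => -v i.castSucc) 1) ^ e 1 = _
  rw [← mono_nsmul, ← mono_nsmul, ← mono_add]
  congr 1
  ext i
  fin_cases i
  · change e 0 • v 1 + e 1 • (-v 0) = v 1 * e 0 - v 0 * e 1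
    simp only [nsmul_eq_mul]; ring
  · change e 0 • (0 : ℤ) + e 1 • (1 : ℤ) = e 1
    simp

/-- The substitution moves the term at `e` to the exponent `(cross v e, e 1)`: powers of the first
variable in the result index the lines of direction `v`. -/
theorem gradeHom_typeSubst (v : Fin 2 → ℤ) (f : MvPolynomial (Fin 2) B) :
    gradeHom (dotHom ![1, 0]) (dotHom ![0, 1]) (typeSubst v f) =
      gradeHom (cross v) (dotHom ![0, 1]) (toLaurent f) := by
  induction f using MvPolynomial.induction_on' with
  | monomial e a =>
    rw [typeSubst_monomial, toLaurent_monomial, gradeHom_single, gradeHom_single]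
    congr 1
    · simp [dotHom_apply]
    · simp [dotHom_apply, intVec]
  | add p q hp hq =>
    have : typeSubst v (p + q) = typeSubst v p + typeSubst v q := map_add _ _ _
    rw [this, map_add, hp, hq, map_add, map_add]

theorem dotHom_basis_injective (u u' : Fin 2 → ℤ) (h0 : dotHom ![1, 0] u = dotHom ![1, 0] u')
    (h1 : dotHom ![0, 1] u = dotHom ![0, 1] u') : u = u' := by
  ext i
  fin_cases i
  · simpa [dotHom_apply] using h0
  · simpa [dotHom_apply] using h1

theorem den_typeSubst_one (v : Fin 2 → ℤ) (f : MvPolynomial (Fin 2) B) :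
    den (typeSubst v f) 1 = 0 := by
  refine Nat.eq_zero_of_le_zero (Finset.sup_le fun e he => ?_)
  rw [Finsupp.mem_support_iff, ← coeff_gradeHom dotHom_basis_injective, gradeHom_typeSubst] at he
  obtain ⟨u, hu, -, h1⟩ := exists_of_coeff_gradeHom_ne_zero _ _ _ he
  obtain ⟨e', -, rfl⟩ := exists_of_coeff_toLaurent_ne_zero _ _ hu
  simp only [dotHom_apply, intVec, Matrix.cons_val_zero, Matrix.cons_val_one, zero_mul, one_mul,
    zero_add] at h1
  omega

/-- Taking the numerator only shifts the index of the line, because the substitution creates no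
negative powers of `y`. -/
theorem coeff_gradeHom_typeSubst (v : Fin 2 → ℤ) (f : MvPolynomial (Fin 2) B) (m : Fin 1 →₀ ℕ) :
    Polynomial.toLaurent ((viewInit (num (typeSubst v f))).coeff m) =
      (gradeHom (cross v) (dotHom ![0, 1]) (toLaurent f)).coeff
        ((m 0 : ℤ) - den (typeSubst v f) 0) := by
  rw [toLaurent_coeff_viewInit, toLaurent_num, map_mul, mono, gradeHom_single, gradeHom_typeSubst]
  have h1 : dotHom ![0, 1] (fun i => (den (typeSubst v f) i : ℤ)) = 0 := by
    simp [dotHom_apply, den_typeSubst_one]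
  have h0 : dotHom ![1, 0] (fun i => (den (typeSubst v f) i : ℤ)) = den (typeSubst v f) 0 := by
    simp [dotHom_apply]
  rw [h0, h1, LaurentPolynomial.single_zero_one_eq_one, AddMonoidAlgebra.coeff_single_mul_apply,
    one_mul]
  congr 1
  ring

variable [IsDomain B] [UniqueFactorizationMonoid B] (ch : Choices.{u})

theorem toLaurent_dvd_of_dvd_typeContent {v : Fin 2 → ℤ} {f : MvPolynomial (Fin 2) B}
    {D : Polynomial B} (h : D ∣ typeContent ch f v) (a : ℤ) :
    Polynomial.toLaurent D ∣
      (gradeHom (cross v) (dotHom ![0, 1]) (toLaurent f)).coeff a := by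
  have h' := (dvd_cont_iff ch (viewInit (num (typeSubst v f))) D).1 h
  by_cases ha : 0 ≤ a + den (typeSubst v f) 0
  · have := map_dvd (Polynomial.toLaurent (R := B))
      (h' (Finsupp.single 0 (a + den (typeSubst v f) 0).toNat))
    rw [coeff_gradeHom_typeSubst, Finsupp.single_eq_same] at this
    convert this using 2
    omega
  · have h0 : (gradeHom (cross v) (dotHom ![0, 1]) (toLaurent f)).coeff a = 0 := by
      ext b
      by_contra hne
      rw [← gradeHom_typeSubst] at hne
      obtain ⟨u, hu, h0, -⟩ := exists_of_coeff_gradeHom_ne_zero _ _ _ hne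
      have hle : (-(u 0)).toNat ≤ den (typeSubst v f) 0 :=
        Finset.le_sup (f := fun e : Fin 2 → ℤ => (-(e 0)).toNat) (Finsupp.mem_support_iff.2 hu)
      simp only [dotHom_apply, Matrix.cons_val_zero, Matrix.cons_val_one, zero_mul, one_mul,
        add_zero] at h0
      omega
    rw [h0]
    exact dvd_zero _

theorem dvd_typeContent {v : Fin 2 → ℤ} {f : MvPolynomial (Fin 2) B} {D : Polynomial B}
    (hD : D.coeff 0 ≠ 0) (h : ∀ a, Polynomial.toLaurent D ∣
      (gradeHom (cross v) (dotHom ![0, 1]) (toLaurent f)).coeff a) : D ∣ typeContent ch f v := by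
  refine (dvd_cont_iff ch (viewInit (num (typeSubst v f))) D).2 fun m => ?_
  apply toLaurent_dvd_toLaurent hD
  rw [coeff_gradeHom_typeSubst]
  exact h _

/-- A term of `f` free of the last variable gives a nonzero constant term on its line; terms do not
collide there because `v 1 ≠ 0`. So `X` does not divide the content. -/
theorem coeff_typeContent_zero {v : Fin 2 → ℤ} (hv : v 1 ≠ 0) {f : MvPolynomial (Fin 2) B}
    (hf : ¬ MvPolynomial.X 1 ∣ f) : (typeContent ch f v).coeff 0 ≠ 0 := by
  intro h0
  rw [X_dvd_iff] at hf
  push Not at hf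
  obtain ⟨e, he, he1⟩ := hf
  have hinj : ∀ u u', cross v u = cross v u' → dotHom ![0, 1] u = dotHom ![0, 1] u' → u = u' := by
    intro u u' h1 h2
    simp only [dotHom_apply, cross_apply, Matrix.cons_val_zero, Matrix.cons_val_one, zero_mul,
      one_mul, zero_add] at h1 h2
    rw [h2] at h1
    ext i
    fin_cases i
    · exact mul_left_cancel₀ hv (sub_left_injective h1)
    · exact h2
  have hc := coeff_gradeHom hinj (toLaurent f) (intVec e)
  rw [coeff_toLaurent] at hc
  set m : Fin 1 →₀ ℕ := Finsupp.single 0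
    (cross v (intVec e) + den (typeSubst v f) 0).toNat with hm
  have hX : Polynomial.X ∣ (viewInit (num (typeSubst v f))).coeff m :=
    (Polynomial.X_dvd_iff.2 h0).trans
      ((dvd_cont_iff ch (viewInit (num (typeSubst v f))) _).1 dvd_rfl m)
  have hnn : 0 ≤ cross v (intVec e) + den (typeSubst v f) 0 := by
    have hne : (typeSubst v f).coeff ![cross v (intVec e), 0] ≠ 0 := by
      rw [← coeff_gradeHom dotHom_basis_injective, gradeHom_typeSubst]
      have h2 : dotHom ![1, 0] ![cross v (intVec e), 0] = cross v (intVec e) := by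
        simp [dotHom_apply]
      have h3 : dotHom ![0, 1] ![cross v (intVec e), 0] = dotHom ![0, 1] (intVec e) := by
        simp [dotHom_apply, intVec, he1]
      rw [h2, h3, hc]
      exact MvPolynomial.mem_support_iff.1 he
    have hle : (-(cross v (intVec e))).toNat ≤ den (typeSubst v f) 0 :=
      Finset.le_sup (f := fun e : Fin 2 → ℤ => (-(e 0)).toNat) (Finsupp.mem_support_iff.2 hne)
    omega
  have hT := coeff_gradeHom_typeSubst v f m
  have hm0 : (m 0 : ℤ) - den (typeSubst v f) 0 = cross v (intVec e) := by
    rw [hm, Finsupp.single_eq_same]; omega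
  rw [hm0] at hT
  have h1 : dotHom ![0, 1] (intVec e) = 0 := by simp [dotHom_apply, intVec, he1]
  rw [← hT, h1] at hc
  obtain ⟨p, hp⟩ := hX
  rw [hp, map_mul, Polynomial.toLaurent_X, LaurentPolynomial.T,
    AddMonoidAlgebra.coeff_single_mul_apply] at hc
  have hneg : (Polynomial.toLaurent p).coeff (-1 + 0) = 0 := by
    by_contra hne
    have := Finsupp.mem_support_iff.2 hne
    rw [LaurentPolynomial.support_coeff_toLaurent, Finset.mem_map] at this
    obtain ⟨i, -, hi⟩ := this
    simp only [Nat.castEmbedding_apply] at hi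
    omega
  rw [hneg, mul_zero] at hc
  exact MvPolynomial.mem_support_iff.1 he hc.symm

omit [IsDomain B] [UniqueFactorizationMonoid B] in
theorem exists_X_pow_mul {P : Polynomial B} (hP : P ≠ 0) :
    ∃ i P', P = Polynomial.X ^ i * P' ∧ P'.coeff 0 ≠ 0 := by
  obtain ⟨P', hP', h⟩ := Polynomial.exists_eq_pow_rootMultiplicity_mul_and_not_dvd P hP 0
  rw [Polynomial.C_0, sub_zero] at hP' h
  exact ⟨_, P', hP', fun h0 => h (Polynomial.X_dvd_iff.2 h0)⟩

omit [IsDomain B] [UniqueFactorizationMonoid B] in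
theorem expand_dvd_expand {k : ℕ} (hk : 0 < k) {P Q : Polynomial B}
    (h : Polynomial.expand B k P ∣ Polynomial.expand B k Q) : P ∣ Q := by
  obtain ⟨H, hH⟩ := h
  refine ⟨Polynomial.contract k H, ?_⟩
  have := congrArg (Polynomial.contract k) hH
  rwa [Polynomial.contract_expand _ hk.ne', mul_comm, Polynomial.contract_mul_expand hk.ne',
    mul_comm] at this

/-- On each line the substituted polynomial is the line polynomial of `f` in `T ^ k`, up to a power
of `T`. A gcd of expansions is the expansion of a gcd, so the content is `P(y ^ k)` where `P` is, up
to units, the gcd of the line polynomials, the largest `P` with nonzero constant term for which `P(x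
^ v)` divides `f`. -/
theorem typeContent_spec {v w : Fin 2 → ℤ} (hw : dotHom w v = 1) (hv1 : 0 < v 1)
    {f : MvPolynomial (Fin 2) B} (hf : Primitive f) (hX : ¬ MvPolynomial.X 1 ∣ f) :
    ∃ P : Polynomial B, typeContent ch f v = Polynomial.expand B (v 1).toNat P ∧
      P.coeff 0 ≠ 0 ∧ evalMono v P ∣ toLaurent f ∧
      ∀ P' : Polynomial B, P'.coeff 0 ≠ 0 → evalMono v P' ∣ toLaurent f → P' ∣ P := by
  set k := (v 1).toNat with hk
  have hkv : v 1 = (k : ℤ) := (Int.toNat_of_nonneg hv1.le).symm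
  have hk0 : 0 < k := by omega
  set Q := typeContent ch f v with hQ
  have hQ0 : Q.coeff 0 ≠ 0 := coeff_typeContent_zero ch hv1.ne' hX
  set Λ := fun a => (gradeHom (cross v) (dotHom w) (toLaurent f)).coeff a with hΛ
  -- divisors of the substituted polynomial in terms of the graded form
  have hdvd : ∀ D : Polynomial B, D.coeff 0 ≠ 0 →
      (D ∣ Q ↔ ∀ a, Polynomial.toLaurent D ∣ expandLaurent B k (Λ a)) := by
    intro D hD
    have hu : ∀ a, Polynomial.toLaurent D ∣
        (gradeHom (cross v) (dotHom ![0, 1]) (toLaurent f)).coeff a ↔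
        Polynomial.toLaurent D ∣ expandLaurent B k (Λ a) := fun a => by
      rw [coeff_gradeHom_dotHom_last hw hkv, (LaurentPolynomial.isUnit_T _).dvd_mul_left]
    constructor
    · exact fun h a => (hu a).1 (toLaurent_dvd_of_dvd_typeContent ch h a)
    · exact fun h => dvd_typeContent ch hD fun a => (hu a).2 (h a)
  -- A power of `T`, which is a unit, makes each line an honest polynomial `q a` without affecting
  -- divisibility.
  choose s q hq using fun a => (Λ a).exists_T_pow
  have hqe : ∀ a, Polynomial.toLaurent (Polynomial.expand B k (q a)) =
      expandLaurent B k (Λ a) * LaurentPolynomial.T (k * s a) := fun a => by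
    rw [← expandLaurent_toLaurent, hq, map_mul, expandLaurent_T]
  have hqd : ∀ (D : Polynomial B) a, Polynomial.toLaurent D ∣ expandLaurent B k (Λ a) ↔
      Polynomial.toLaurent D ∣ Polynomial.toLaurent (Polynomial.expand B k (q a)) :=
    fun D a => by rw [hqe, (LaurentPolynomial.isUnit_T _).dvd_mul_right]
  have hqd' : ∀ (D : Polynomial B) a, Polynomial.toLaurent D ∣ Λ a ↔
      Polynomial.toLaurent D ∣ Polynomial.toLaurent (q a) :=
    fun D a => by rw [hq, (LaurentPolynomial.isUnit_T _).dvd_mul_right]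
  -- A constant that divides `Q` divides every coefficient on every line, hence the primitive `f`.
  have hQprim : Q.IsPrimitive := by
    intro b hb
    apply primitive_iff.1 hf
    rw [← evalMono_C v, evalMono_dvd_iff hw]
    intro a
    have hb0 : (Polynomial.C b).coeff 0 ≠ 0 := by
      rw [Polynomial.coeff_C_zero]
      rintro rfl
      rw [Polynomial.C_0, zero_dvd_iff] at hb
      exact hQ0 (by rw [hb]; simp)
    have h1 := toLaurent_dvd_toLaurent hb0 ((hqd _ a).1 ((hdvd _ hb0).1 hb a))
    refine (hqd' _ a).2 (map_dvd _ ?_)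
    rw [Polynomial.C_dvd_iff_dvd_coeff] at h1 ⊢
    intro i
    have := h1 (k * i)
    rwa [mul_comm, Polynomial.coeff_expand_mul hk0] at this
  obtain ⟨G, hGq, hQG⟩ := exists_common_divisor_of_dvd_expand (Set.range q) hQprim (k := k) (by
    rintro _ ⟨a, rfl⟩
    exact toLaurent_dvd_toLaurent hQ0 ((hqd _ a).1 ((hdvd _ hQ0).1 dvd_rfl a)))
  have hG0 : G ≠ 0 := by
    rintro rfl
    have hΛ0 : ∀ a, Λ a = 0 := fun a => by
      have h0 := zero_dvd_iff.1 (hGq (q a) ⟨a, rfl⟩)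
      have := hq a
      rw [h0, map_zero] at this
      exact ((LaurentPolynomial.isUnit_T _).mul_left_eq_zero.1 this.symm)
    have hf0 : toLaurent f = 0 := by
      have h0 : evalMono v (0 : Polynomial B) ∣ toLaurent f := by
        rw [evalMono_dvd_iff hw]
        intro a
        exact (dvd_zero _).trans (dvd_of_eq (hΛ0 a).symm)
      rwa [evalMono, map_zero, zero_dvd_iff] at h0
    exact hX ((toLaurent_eq_zero.1 hf0).symm ▸ dvd_zero _)
  -- Powers of `X` in `G` are units for Laurent polynomials. Without them `Q` still divides the
  -- expansion, its constant term being nonzero.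
  obtain ⟨i, G', rfl, hG'⟩ := exists_X_pow_mul hG0
  have hQG' : Q ∣ Polynomial.expand B k G' := by
    rw [map_mul, map_pow, Polynomial.expand_X] at hQG
    apply toLaurent_dvd_toLaurent hQ0
    have := map_dvd (Polynomial.toLaurent (R := B)) hQG
    rwa [map_mul, ← pow_mul, Polynomial.toLaurent_X_pow,
      (LaurentPolynomial.isUnit_T _).dvd_mul_left] at this
  have hcoe : ∀ D : Polynomial B, D.coeff 0 ≠ 0 → (Polynomial.expand B k D).coeff 0 ≠ 0 := by
    intro D hD
    have := Polynomial.coeff_expand_mul hk0 D 0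
    rw [zero_mul] at this
    rwa [this]
  have hdvdΛ : ∀ D : Polynomial B, D.coeff 0 ≠ 0 → (∀ a, Polynomial.toLaurent D ∣ Λ a) →
      Polynomial.expand B k D ∣ Q := by
    intro D hD h
    rw [hdvd _ (hcoe D hD)]
    intro a
    rw [← expandLaurent_toLaurent]
    exact map_dvd _ (h a)
  have hG'Λ : ∀ a, Polynomial.toLaurent G' ∣ Λ a := fun a =>
    (hqd' _ a).2 (map_dvd _ ((dvd_mul_left _ _).trans (hGq (q a) ⟨a, rfl⟩)))
  have hass : Associated (Polynomial.expand B k G') Q :=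
    associated_of_dvd_dvd (hdvdΛ G' hG' hG'Λ) hQG'
  obtain ⟨x, hx⟩ := hass
  obtain ⟨b, hb, hxb⟩ := Polynomial.isUnit_iff.1 x.isUnit
  have hQe : Q = Polynomial.expand B k (G' * Polynomial.C b) := by
    rw [map_mul, Polynomial.expand_C, hxb, hx]
  refine ⟨G' * Polynomial.C b, hQe, ?_, ?_, ?_⟩
  · rw [Polynomial.coeff_mul_C]
    exact mul_ne_zero hG' hb.ne_zero
  · rw [evalMono_mul, (show IsUnit (evalMono v (Polynomial.C b)) by
      rw [evalMono_C]; exact hb.map _).mul_right_dvd, evalMono_dvd_iff hw]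
    exact hG'Λ
  · intro P' hP' h
    rw [evalMono_dvd_iff hw] at h
    apply expand_dvd_expand hk0
    rw [← hQe]
    exact hdvdΛ P' hP' h

end TypeContent

/-! ### Normalized vectors and directions -/

section Directions

variable {n : ℕ}

/-- Comparing the gcds of the coordinates gives `|a| = |b|`; opposite signs are excluded by the sign
of the last nonzero coordinate. -/
theorem Normalized.eq_of_smul_eq {v v' : Fin n → ℤ} (hv : Normalized v) (hv' : Normalized v')
    {a b : ℤ} (ha : a ≠ 0) (h : a • v = b • v') : v = v' := by
  have hg : normalize a = normalize b := by
    have h1 : Finset.univ.gcd (fun i => a * v i) = normalize a * Finset.univ.gcd v :=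
      Finset.gcd_mul_left
    have h2 : Finset.univ.gcd (fun i => b * v' i) = normalize b * Finset.univ.gcd v' :=
      Finset.gcd_mul_left
    have h3 : (fun i => a * v i) = fun i => b * v' i := by
      funext i; simpa using congrFun h i
    rw [h3, h2, hv.1, hv'.1] at h1
    simpa using h1.symm
  have habs : |a| = |b| := by rwa [← Int.abs_eq_normalize, ← Int.abs_eq_normalize] at hg
  rcases abs_eq_abs.1 habs with rfl | rfl
  · exact smul_right_injective _ ha h
  · exfalso
    have hb : b ≠ 0 := by simpa using ha
    have h' : ∀ i, v' i = -v i := fun i => by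
      have := congrFun h i
      simp only [Pi.smul_apply, smul_eq_mul] at this
      apply mul_left_cancel₀ hb
      linarith
    obtain ⟨i, hi, hi'⟩ := hv.2
    obtain ⟨j, hj, hj'⟩ := hv'.2
    rcases lt_trichotomy i j with hij | rfl | hij
    · rw [h' j, hi' j hij] at hj; simp at hj
    · rw [h' i] at hj; omega
    · have := hj' i hij
      rw [h' i] at this; omega

theorem Normalized.ne_zero {v : Fin n → ℤ} (hv : Normalized v) : v ≠ 0 := by
  rintro rfl
  obtain ⟨i, hi, -⟩ := hv.2
  simp at hi

theorem IsDirection.unique {v v' : Fin n → ℤ} {x y : Fin n → ℝ} (h : IsDirection v x y)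
    (h' : IsDirection v' x y) : v = v' := by
  obtain ⟨hxy, ⟨t, ht⟩, hv⟩ := h
  obtain ⟨-, ⟨t', ht'⟩, hv'⟩ := h'
  have ht0 : t ≠ 0 := by
    rintro rfl
    rw [zero_smul, sub_eq_zero] at ht
    exact hxy ht
  have hi : ∀ i, t * v i = t' * v' i := fun i => by
    have := congrFun (ht.symm.trans ht') i
    simpa using this
  obtain ⟨j, hj⟩ := Function.ne_iff.1 hv'.ne_zero
  -- Eliminating the real factors by means of the coordinate `j` leaves an integral proportionality.
  refine hv.eq_of_smul_eq hv' (a := v' j) (b := v j) hj ?_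
  ext i
  have : t * ((v' j * v i : ℤ) : ℝ) = t * ((v j * v' i : ℤ) : ℝ) := by
    push_cast
    linear_combination (v' j : ℝ) * hi i - (v' i : ℝ) * hi j
  exact_mod_cast mul_left_cancel₀ ht0 this

theorem Normalized.exists_dotHom_eq_one {v : Fin 2 → ℤ} (hv : Normalized v) :
    ∃ w, dotHom w v = 1 := by
  have h : IsCoprime (v 0) (v 1) := by
    rw [← gcd_isUnit_iff, Int.isUnit_iff]
    left
    have := hv.1
    rw [show (Finset.univ : Finset (Fin 2)) = {0, 1} from rfl, Finset.gcd_insert,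
      Finset.gcd_singleton] at this
    exact (((normalize_associated (v 1)).symm.gcd_eq_right (v 0))).trans this
  obtain ⟨a, b, hab⟩ := h
  exact ⟨![a, b], by simpa [dotHom_apply] using hab⟩

theorem Normalized.one_pos {v : Fin 2 → ℤ} (hv : Normalized v) (h : v 1 ≠ 0) : 0 < v 1 := by
  obtain ⟨i, hi, hi'⟩ := hv.2
  fin_cases i
  · exact absurd (hi' 1 (by decide)) h
  · exact hi

end Directions

/-! ### Faces of Newton polytopes and finiteness of the candidates -/

section Faces

variable {A : Type u} [CommRing A] {n : ℕ}

/-- The exponent vectors at which the functional `a` is maximal. -/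
def maxSupport (f : MvPolynomial (Fin n) A) (a : Fin n → ℝ) : Set (Fin n →₀ ℕ) :=
  {e | e ∈ f.support ∧ ∀ e' ∈ f.support, a ⬝ᵥ toPoint e' ≤ a ⬝ᵥ toPoint e}

theorem toPoint_injective : Function.Injective (toPoint (n := n)) := by
  intro e e' h
  ext i
  simpa [toPoint] using congrFun h i

theorem dotProduct_le_of_mem_newt {f : MvPolynomial (Fin n) A} {a : Fin n → ℝ} {m : ℝ}
    (h : ∀ e ∈ f.support, a ⬝ᵥ toPoint e ≤ m) {y : Fin n → ℝ} (hy : y ∈ newt f) :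
    a ⬝ᵥ y ≤ m := by
  have hc : Convex ℝ {y : Fin n → ℝ | a ⬝ᵥ y ≤ m} :=
    convex_halfSpace_le (f := fun y => a ⬝ᵥ y)
      ⟨fun x y => dotProduct_add _ _ _, fun c x => dotProduct_smul _ _ _⟩ m
  refine convexHull_min ?_ hc hy
  rintro _ ⟨e, he, rfl⟩
  exact h e he

theorem toPoint_mem_newt {f : MvPolynomial (Fin n) A} {e : Fin n →₀ ℕ} (he : e ∈ f.support) :
    toPoint e ∈ newt f := subset_convexHull _ _ ⟨e, he, rfl⟩

/-- A maximizing point is a convex combination of exponent vectors, and each of them with nonzero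
weight must itself be maximizing. Faces are thus described by finitely many exponents. -/
theorem face_newt (f : MvPolynomial (Fin n) A) (a : Fin n → ℝ) :
    face (newt f) a = convexHull ℝ (toPoint '' maxSupport f a) := by
  classical
  apply Set.Subset.antisymm
  · rintro x ⟨hx, hmax⟩
    rw [newt, show toPoint '' (f.support : Set (Fin n →₀ ℕ)) =
      ((f.support.image toPoint : Finset (Fin n → ℝ)) : Set (Fin n → ℝ)) by simp,
      Finset.mem_convexHull'] at hx
    obtain ⟨w, hw0, hw1, hwx⟩ := hx
    have hle : ∀ y ∈ f.support.image toPoint, a ⬝ᵥ y ≤ a ⬝ᵥ x := by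
      intro y hy
      obtain ⟨e, he, rfl⟩ := Finset.mem_image.1 hy
      exact hmax _ (toPoint_mem_newt he)
    -- The weighted deficits are nonnegative with sum zero, so each of them vanishes.
    have hsum : ∑ y ∈ f.support.image toPoint, w y * (a ⬝ᵥ x - a ⬝ᵥ y) = 0 := by
      simp only [mul_sub, Finset.sum_sub_distrib]
      rw [← Finset.sum_mul, hw1, one_mul]
      conv_lhs => enter [1]; rw [← hwx, dotProduct_sum]
      simp [dotProduct_smul]
    have hzero := (Finset.sum_eq_zero_iff_of_nonneg fun y hy =>
      mul_nonneg (hw0 y hy) (sub_nonneg.2 (hle y hy))).1 hsum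
    rw [← hwx]
    have hsub : ∀ y ∈ f.support.image toPoint, w y ≠ 0 → y ∈ toPoint '' maxSupport f a := by
      intro y hy hwy
      have := (mul_eq_zero.1 (hzero y hy)).resolve_left hwy
      obtain ⟨e, he, rfl⟩ := Finset.mem_image.1 hy
      refine ⟨e, ⟨he, fun e' he' => ?_⟩, rfl⟩
      rw [← sub_eq_zero.1 this]
      exact hmax _ (toPoint_mem_newt he')
    rw [← Finset.sum_filter_of_ne (p := fun y => w y ≠ 0)
      (fun y _ h hw => h (by rw [hw, zero_smul]))]
    refine (convex_convexHull ℝ _).sum_mem (fun y hy => hw0 y (Finset.mem_filter.1 hy).1) ?_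
      fun y hy => subset_convexHull _ _
        (hsub y (Finset.mem_filter.1 hy).1 (Finset.mem_filter.1 hy).2)
    rw [Finset.sum_filter_ne_zero, hw1]
  · have hc : Convex ℝ (face (newt f) a) := by
      intro x hx y hy s t hs ht hst
      refine ⟨convex_convexHull ℝ _ hx.1 hy.1 hs ht hst, fun z hz => ?_⟩
      rw [dotProduct_add, dotProduct_smul, dotProduct_smul, smul_eq_mul, smul_eq_mul]
      have h1 := hx.2 z hz
      have h2 := hy.2 z hz
      calc a ⬝ᵥ z = s * (a ⬝ᵥ z) + t * (a ⬝ᵥ z) := by rw [← add_mul, hst, one_mul]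
        _ ≤ _ := add_le_add (mul_le_mul_of_nonneg_left h1 hs) (mul_le_mul_of_nonneg_left h2 ht)
    refine convexHull_min ?_ hc
    rintro _ ⟨e, ⟨he, hmax⟩, rfl⟩
    exact ⟨toPoint_mem_newt he, fun y hy => dotProduct_le_of_mem_newt hmax hy⟩

theorem maxSupport_nonempty {f : MvPolynomial (Fin n) A} (hf : f ≠ 0) (a : Fin n → ℝ) :
    (maxSupport f a).Nonempty := by
  obtain ⟨e, he, hmax⟩ := f.support.exists_max_image (fun e => a ⬝ᵥ toPoint e)
    (MvPolynomial.support_nonempty.2 hf)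
  exact ⟨e, he, hmax⟩

theorem finite_directions (f : MvPolynomial (Fin n) A) :
    {v : Fin n → ℤ | ∃ e ∈ f.support, ∃ e' ∈ f.support,
      IsDirection v (toPoint e) (toPoint e')}.Finite := by
  have : {v : Fin n → ℤ | ∃ e ∈ f.support, ∃ e' ∈ f.support,
      IsDirection v (toPoint e) (toPoint e')} =
      ⋃ e ∈ f.support, ⋃ e' ∈ f.support, {v | IsDirection v (toPoint e) (toPoint e')} := by
    ext v; simp
  rw [this]
  refine f.support.finite_toSet.biUnion fun e _ => f.support.finite_toSet.biUnion fun e' _ => ?_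
  exact Set.Subsingleton.finite fun v hv v' hv' => IsDirection.unique hv hv'

/-- An edge has distinct endpoints, so it is not the hull of fewer than two exponent vectors, and
any two of them have its direction. With `finite_directions` this makes the set of candidates
finite. -/
theorem exists_isDirection_of_mem_edges {f : MvPolynomial (Fin n) A} {v : Fin n → ℤ}
    {F : Set (Fin n → ℝ)} (h : F ∈ edgesWithDirection (newt f) v) :
    ∃ e ∈ f.support, ∃ e' ∈ f.support, IsDirection v (toPoint e) (toPoint e') := by
  obtain ⟨⟨a, -, hFa⟩, x, y, hF, hxy, ⟨t, ht⟩, hv⟩ := h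
  rw [face_newt] at hFa
  have hsub : ¬ (toPoint '' maxSupport f a).Subsingleton := by
    intro hs
    have hF' : F.Subsingleton := by
      rw [hFa]
      rcases hs.eq_empty_or_singleton with h0 | ⟨z, hz⟩
      · rw [h0, convexHull_empty]; exact Set.subsingleton_empty
      · rw [hz, convexHull_singleton]; exact Set.subsingleton_singleton
    exact hxy (hF' (hF ▸ left_mem_segment ℝ x y) (hF ▸ right_mem_segment ℝ x y))
  rw [Set.not_subsingleton_iff] at hsub
  obtain ⟨_, ⟨e, he, rfl⟩, _, ⟨e', he', rfl⟩, hne⟩ := hsub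
  refine ⟨e, he.1, e', he'.1, hne, ?_, hv⟩
  have hmem : ∀ z ∈ toPoint '' maxSupport f a, ∃ s : ℝ, z - y = s • fun i => (v i : ℝ) := by
    intro z hz
    have hz' : z ∈ F := hFa ▸ subset_convexHull ℝ _ hz
    rw [hF, segment_symm, segment_eq_image'] at hz'
    obtain ⟨θ, -, rfl⟩ := hz'
    exact ⟨θ * t, by
      change y + θ • (x - y) - y = _
      rw [add_sub_cancel_left, ht, smul_smul]⟩
  obtain ⟨s, hs⟩ := hmem _ ⟨e, he, rfl⟩
  obtain ⟨s', hs'⟩ := hmem _ ⟨e', he', rfl⟩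
  exact ⟨s - s', by rw [sub_smul, ← hs, ← hs']; abel⟩

theorem candidates_subset (ch : Choices.{u}) {f : MvPolynomial (Fin n) A} (hf : f ≠ 0) :
    candidates ch f ⊆ {v | (∀ i, v i ≠ 0) ∧ ∃ e ∈ f.support, ∃ e' ∈ f.support,
      IsDirection v (toPoint e) (toPoint e')} := by
  intro v hv
  rw [candidates] at hv
  split_ifs at hv
  · obtain ⟨h0, -, e, he, hd⟩ := hv
    exact ⟨h0, _, ch.point_mem _ (MvPolynomial.support_nonempty.2 hf), e, he, hd⟩
  · obtain ⟨h0, h1⟩ := hv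
    have : (edgesWithDirection (newt f) v).Nonempty := by
      by_contra hne
      rw [Set.not_nonempty_iff_eq_empty] at hne
      rw [edgeMult, hne, Set.ncard_empty] at h1
      omega
    obtain ⟨F, hF⟩ := this
    exact ⟨h0, exists_isDirection_of_mem_edges hF⟩

theorem finite_candidates (ch : Choices.{u}) {f : MvPolynomial (Fin n) A} (hf : f ≠ 0) :
    (candidates ch f).Finite :=
  (finite_directions f).subset fun _ hv => (candidates_subset ch hf hv).2

end Faces

/-! ### Newton polygons: the type of a divisor is an edge direction -/

section Plane

variable {A : Type u} [CommRing A]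

/-- A normal vector of the lines with direction `v`. -/
def normal (s : ℝ) (v : Fin 2 → ℤ) : Fin 2 → ℝ := ![s * v 1, -(s * v 0)]

theorem normal_dotProduct (s : ℝ) (v : Fin 2 → ℤ) (x : Fin 2 → ℝ) :
    normal s v ⬝ᵥ x = s * (v 1 * x 0 - v 0 * x 1) := by
  rw [dotProduct, Fin.sum_univ_two]
  simp only [normal, Matrix.cons_val_zero, Matrix.cons_val_one]
  ring

theorem normal_dotProduct_toPoint (s : ℝ) (v : Fin 2 → ℤ) (e : Fin 2 →₀ ℕ) :
    normal s v ⬝ᵥ toPoint e = s * (cross v (intVec e) : ℤ) := by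
  rw [normal_dotProduct, cross_apply]
  simp [toPoint, intVec]

/-- On the line through `e`, `f` is a multiple of `P`. A single term is no multiple of a `P` with
positive degree and nonzero constant term, so the line contains a second exponent. -/
theorem exists_cross_eq [IsDomain A] {v : Fin 2 → ℤ} (hv : Normalized v)
    {f : MvPolynomial (Fin 2) A} {P : Polynomial A} (hP0 : P.coeff 0 ≠ 0) (hP : 0 < P.natDegree)
    (h : evalMono v P ∣ toLaurent f) {e : Fin 2 →₀ ℕ} (he : e ∈ f.support) :
    ∃ e' ∈ f.support, e' ≠ e ∧ cross v (intVec e') = cross v (intVec e) := by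
  obtain ⟨w, hw⟩ := hv.exists_dotHom_eq_one
  have hd := (evalMono_dvd_iff hw P (toLaurent f)).1 h (cross v (intVec e))
  set L := (gradeHom (cross v) (dotHom w) (toLaurent f)).coeff (cross v (intVec e)) with hL
  have hLe : L.coeff (dotHom w (intVec e)) = f.coeff e := by
    rw [hL, coeff_gradeHom (cross_dotHom_injective hw), coeff_toLaurent]
  by_contra hno
  push Not at hno
  have hsingle : ∀ b, b ≠ dotHom w (intVec e) → L.coeff b = 0 := by
    intro b hb
    by_contra hne
    obtain ⟨u, hu, hcu, htu⟩ := exists_of_coeff_gradeHom_ne_zero _ _ _ hne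
    obtain ⟨e', he', rfl⟩ := exists_of_coeff_toLaurent_ne_zero _ _ hu
    refine hno e' he' ?_ hcu
    rintro rfl
    exact hb htu.symm
  have hLs : L = LaurentPolynomial.C (f.coeff e) * LaurentPolynomial.T (dotHom w (intVec e)) := by
    rw [← LaurentPolynomial.single_eq_C_mul_T]
    ext b
    rw [AddMonoidAlgebra.coeff_single, Finsupp.single_apply]
    split_ifs with hb
    · rw [← hb, hLe]
    · exact hsingle b fun h => hb h.symm
  rw [hLs, (LaurentPolynomial.isUnit_T _).dvd_mul_right, ← Polynomial.toLaurent_C] at hd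
  have hd' := toLaurent_dvd_toLaurent hP0 hd
  have := Polynomial.natDegree_le_of_dvd hd'
    (Polynomial.C_ne_zero.2 (MvPolynomial.mem_support_iff.1 he))
  rw [Polynomial.natDegree_C] at this
  omega

theorem isDirection_of_cross_eq {v : Fin 2 → ℤ} (hv : Normalized v) (h1 : v 1 ≠ 0)
    {e e' : Fin 2 →₀ ℕ} (hne : e ≠ e') (hc : cross v (intVec e) = cross v (intVec e')) :
    IsDirection v (toPoint e) (toPoint e') := by
  refine ⟨toPoint_injective.ne hne, ⟨((e 1 : ℝ) - e' 1) / v 1, ?_⟩, hv⟩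
  have h1' : (v 1 : ℝ) ≠ 0 := by exact_mod_cast h1
  have hc' : (v 1 * e 0 - v 0 * e 1 : ℝ) = v 1 * e' 0 - v 0 * e' 1 := by
    rw [cross_apply, cross_apply] at hc
    exact_mod_cast hc
  ext i
  fin_cases i
  · change (e 0 : ℝ) - e' 0 = ((e 1 : ℝ) - e' 1) / v 1 * v 0
    field_simp
    linear_combination hc'
  · change (e 1 : ℝ) - e' 1 = ((e 1 : ℝ) - e' 1) / v 1 * v 1
    field_simp

/-- By `exists_cross_eq` the extreme line contains at least two exponents. As `v 1 ≠ 0`, its points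
are ordered by the second coordinate, and the face is the segment from the lowest exponent to the
highest. -/
theorem face_mem_edges [IsDomain A] {v : Fin 2 → ℤ} (hv : Normalized v) (h1 : v 1 ≠ 0)
    {f : MvPolynomial (Fin 2) A} (hf : f ≠ 0) {P : Polynomial A} (hP0 : P.coeff 0 ≠ 0)
    (hP : 0 < P.natDegree) (h : evalMono v P ∣ toLaurent f) {s : ℝ} (hs : s ≠ 0) :
    face (newt f) (normal s v) ∈ edgesWithDirection (newt f) v := by
  classical
  have h1' : (v 1 : ℝ) ≠ 0 := by exact_mod_cast h1
  refine ⟨⟨normal s v, fun h0 => ?_, rfl⟩, ?_⟩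
  · have := congrFun h0 0
    simp only [normal, Matrix.cons_val_zero, Pi.zero_apply] at this
    exact mul_ne_zero hs h1' this
  have hfin : (maxSupport f (normal s v)).Finite :=
    f.support.finite_toSet.subset fun e he => he.1
  obtain ⟨e₀, he₀⟩ := maxSupport_nonempty hf (normal s v)
  obtain ⟨a, ha, hamin⟩ := hfin.toFinset.exists_min_image (fun e => e 1)
    ⟨e₀, hfin.mem_toFinset.2 he₀⟩
  obtain ⟨b, hb, hbmax⟩ := hfin.toFinset.exists_max_image (fun e => e 1)
    ⟨e₀, hfin.mem_toFinset.2 he₀⟩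
  simp only [Set.Finite.mem_toFinset] at ha hb hamin hbmax
  have hcross : ∀ e ∈ maxSupport f (normal s v), cross v (intVec e) = cross v (intVec a) := by
    intro e he
    have hle := le_antisymm (ha.2 e he.1) (he.2 a ha.1)
    rw [normal_dotProduct_toPoint, normal_dotProduct_toPoint] at hle
    exact_mod_cast mul_left_cancel₀ hs hle
  have hcr : ∀ e ∈ maxSupport f (normal s v),
      (v 1 * e 0 - v 0 * e 1 : ℝ) = v 1 * a 0 - v 0 * a 1 := by
    intro e he
    have := hcross e he
    rw [cross_apply, cross_apply] at this
    exact_mod_cast this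
  have hab : a ≠ b := by
    rintro rfl
    obtain ⟨e', he', hne, hc⟩ := exists_cross_eq hv hP0 hP h ha.1
    have hm : e' ∈ maxSupport f (normal s v) := by
      refine ⟨he', fun e'' he'' => (ha.2 e'' he'').trans ?_⟩
      rw [normal_dotProduct_toPoint, normal_dotProduct_toPoint, hc]
    have h1e : e' 1 = a 1 := le_antisymm (hbmax e' hm) (hamin e' hm)
    apply hne
    ext i
    fin_cases i
    · rw [cross_apply, cross_apply] at hc
      simp only [intVec, h1e] at hc
      have := mul_left_cancel₀ h1 (sub_left_injective hc)
      exact_mod_cast this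
    · exact h1e
  have hab1 : (a 1 : ℝ) < b 1 := by
    have hle := hamin b hb
    refine lt_of_le_of_ne (by exact_mod_cast hle) fun heq => hab ?_
    have hc := hcr b hb
    rw [← heq] at hc
    have h0 := mul_left_cancel₀ h1' (sub_left_injective hc)
    ext i
    fin_cases i
    · exact_mod_cast h0.symm
    · exact_mod_cast heq
  refine ⟨toPoint a, toPoint b, ?_, isDirection_of_cross_eq hv h1 hab (hcross b hb).symm⟩
  rw [face_newt]
  apply Set.Subset.antisymm
  · refine convexHull_min ?_ (convex_segment _ _)
    rintro _ ⟨e, he, rfl⟩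
    rw [segment_eq_image']
    have hd : (0 : ℝ) < b 1 - a 1 := sub_pos.2 hab1
    refine ⟨((e 1 : ℝ) - a 1) / (b 1 - a 1), ⟨?_, ?_⟩, ?_⟩
    · refine div_nonneg (sub_nonneg.2 ?_) hd.le
      exact_mod_cast hamin e he
    · rw [div_le_one hd]
      have : (e 1 : ℝ) ≤ b 1 := by exact_mod_cast hbmax e he
      linarith
    · have hce := hcr e he
      have hcb := hcr b hb
      ext i
      fin_cases i
      · change (a 0 : ℝ) + ((e 1 : ℝ) - a 1) / (b 1 - a 1) * ((b 0 : ℝ) - a 0) = e 0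
        field_simp
        apply mul_left_cancel₀ h1'
        linear_combination ((e 1 : ℝ) - a 1) * hcb - (b 1 - a 1) * hce
      · change (a 1 : ℝ) + ((e 1 : ℝ) - a 1) / (b 1 - a 1) * ((b 1 : ℝ) - a 1) = e 1
        field_simp
        ring
  · exact segment_subset_convexHull ⟨a, ha, rfl⟩ ⟨b, hb, rfl⟩

theorem exists_normal_of_mem_edges {K : Set (Fin 2 → ℝ)} {v : Fin 2 → ℤ} (h1 : v 1 ≠ 0)
    {a : Fin 2 → ℝ} (ha : a ≠ 0) {x y : Fin 2 → ℝ} (hF : face K a = segment ℝ x y)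
    (hd : IsDirection v x y) : ∃ s : ℝ, s ≠ 0 ∧ a = normal s v := by
  have h1' : (v 1 : ℝ) ≠ 0 := by exact_mod_cast h1
  obtain ⟨hxy, ⟨t, ht⟩, hv⟩ := hd
  have ht0 : t ≠ 0 := by
    rintro rfl
    rw [zero_smul, sub_eq_zero] at ht
    exact hxy ht
  have hx : x ∈ face K a := hF ▸ left_mem_segment ℝ x y
  have hy : y ∈ face K a := hF ▸ right_mem_segment ℝ x y
  have heq : a ⬝ᵥ x = a ⬝ᵥ y := le_antisymm (hy.2 x hx.1) (hx.2 y hy.1)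
  have h0 : a ⬝ᵥ (x - y) = 0 := by rw [dotProduct_sub, heq, sub_self]
  rw [ht, dotProduct_smul, smul_eq_mul] at h0
  have h2 := (mul_eq_zero.1 h0).resolve_left ht0
  rw [dotProduct, Fin.sum_univ_two] at h2
  have hav : a = normal (a 0 / v 1) v := by
    ext i
    fin_cases i
    · change a 0 = a 0 / v 1 * v 1
      field_simp
    · change a 1 = -(a 0 / v 1 * v 0)
      field_simp
      linear_combination h2
  refine ⟨a 0 / v 1, fun hs => ha ?_, hav⟩
  rw [hav, hs]
  ext i
  fin_cases i <;> simp [normal]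

theorem face_normal_of_pos (K : Set (Fin 2 → ℝ)) (v : Fin 2 → ℤ) {s r : ℝ} (h : 0 < s * r) :
    face K (normal s v) = face K (normal r v) := by
  ext x
  simp only [face, Set.mem_ofPred_eq, normal_dotProduct]
  refine and_congr_right fun _ => forall₂_congr fun y _ => ?_
  rcases pos_and_pos_or_neg_and_neg_of_mul_pos h with ⟨h1, h2⟩ | ⟨h1, h2⟩
  · rw [mul_le_mul_iff_right₀ h1, mul_le_mul_iff_right₀ h2]
  · rw [mul_le_mul_left_of_neg h1, mul_le_mul_left_of_neg h2]

/-- In the plane a direction determines the normal up to a factor, of which only the sign matters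
for the face. -/
theorem edges_subset {K : Set (Fin 2 → ℝ)} {v : Fin 2 → ℤ} (h1 : v 1 ≠ 0) :
    edgesWithDirection K v ⊆ {face K (normal 1 v), face K (normal (-1) v)} := by
  rintro F ⟨⟨a, ha, rfl⟩, x, y, hF, hd⟩
  obtain ⟨s, hs, rfl⟩ := exists_normal_of_mem_edges h1 ha hF hd
  rcases lt_or_gt_of_ne hs with h | h
  · right
    exact face_normal_of_pos _ _ (by linarith)
  · left
    exact face_normal_of_pos _ _ (by linarith)

/-- If the two extreme faces agree, `cross v` is constant on the polygon, which then lies on one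
line; an edge counted by `edgeCount` can only be the whole polygon. -/
theorem edgeCount_le_one_of_face_eq {f : MvPolynomial (Fin 2) A} (hf : f ≠ 0) {v : Fin 2 → ℤ}
    (h1 : v 1 ≠ 0) (h : face (newt f) (normal 1 v) = face (newt f) (normal (-1) v)) :
    edgeCount f ≤ 1 := by
  have h1' : (v 1 : ℝ) ≠ 0 := by exact_mod_cast h1
  obtain ⟨e, he⟩ := maxSupport_nonempty hf (normal 1 v)
  have hx : toPoint e ∈ face (newt f) (normal 1 v) := by
    rw [face_newt]; exact subset_convexHull _ _ ⟨e, he, rfl⟩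
  have hx' : toPoint e ∈ face (newt f) (normal (-1) v) := h ▸ hx
  have hconst : ∀ y ∈ newt f, v 1 * y 0 - v 0 * y 1 =
      (v 1 * toPoint e 0 - v 0 * toPoint e 1 : ℝ) := by
    intro y hy
    have h2 := hx.2 y hy
    have h3 := hx'.2 y hy
    rw [normal_dotProduct, normal_dotProduct] at h2 h3
    linarith
  refine (Set.ncard_le_ncard (t := {newt f}) ?_ (Set.finite_singleton _)).trans
    (Set.ncard_singleton _).le
  rintro F ⟨v', hv', ⟨a, ha, rfl⟩, x, y, hF, hd⟩
  obtain ⟨s, hs, hav⟩ := exists_normal_of_mem_edges (hv' 1) ha hF hd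
  obtain ⟨hxy, ⟨t, ht⟩, -⟩ := hd
  have hxF : x ∈ face (newt f) a := hF ▸ left_mem_segment ℝ x y
  have hyF : y ∈ face (newt f) a := hF ▸ right_mem_segment ℝ x y
  have ht0 : t ≠ 0 := by
    rintro rfl
    rw [zero_smul, sub_eq_zero] at ht
    exact hxy ht
  have e0 := congrFun ht 0
  have e1 := congrFun ht 1
  simp only [Pi.sub_apply, Pi.smul_apply, smul_eq_mul] at e0 e1
  have hpar : (v 1 * v' 0 : ℝ) = v 0 * v' 1 := by
    apply mul_left_cancel₀ ht0
    have h2 := hconst x hxF.1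
    have h3 := hconst y hyF.1
    linear_combination h2 - h3 - (v 1 : ℝ) * e0 + (v 0 : ℝ) * e1
  rw [Set.mem_singleton_iff]
  ext z
  refine ⟨fun hz => hz.1, fun hz => ⟨hz, fun z' hz' => le_of_eq ?_⟩⟩
  rw [hav, normal_dotProduct, normal_dotProduct]
  congr 1
  apply mul_left_cancel₀ h1'
  have h2 := hconst z hz
  have h3 := hconst z' hz'
  linear_combination (v' 1 : ℝ) * (h3 - h2) + (z 1 - z' 1) * hpar

/-- The type of an integer-linear divisor is a candidate. -/
theorem mem_candidates [IsDomain A] (ch : Choices.{u}) {v : Fin 2 → ℤ} (hv : Normalized v)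
    (h0 : ∀ i, v i ≠ 0) {f : MvPolynomial (Fin 2) A} (hf : f ≠ 0) {P : Polynomial A}
    (hP0 : P.coeff 0 ≠ 0) (hP : 0 < P.natDegree) (h : evalMono v P ∣ toLaurent f) :
    v ∈ candidates ch f := by
  have hfin : (edgesWithDirection (newt f) v).Finite :=
    (Set.toFinite _).subset (edges_subset (h0 1))
  have hp := face_mem_edges hv (h0 1) hf hP0 hP h one_ne_zero
  have hm := face_mem_edges hv (h0 1) hf hP0 hP h (neg_ne_zero.2 one_ne_zero)
  rw [candidates]
  split_ifs with hc
  · refine ⟨h0, ?_, ?_⟩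
    -- With more than one edge in `Λ` the two extreme faces differ, which accounts for the
    -- multiplicity two demanded of candidates.
    · have hne : face (newt f) (normal 1 v) ≠ face (newt f) (normal (-1) v) := fun heq => by
        have := edgeCount_le_one_of_face_eq hf (h0 1) heq
        omega
      refine (Set.ncard_pair hne).symm.le.trans (Set.ncard_le_ncard ?_ hfin)
      rintro _ (rfl | rfl)
      · exact hp
      · exact hm
    · have hpt := ch.point_mem _ (MvPolynomial.support_nonempty.2 hf)
      obtain ⟨e', he', hne, hcr⟩ := exists_cross_eq hv hP0 hP h hpt
      exact ⟨e', he', isDirection_of_cross_eq hv (h0 1) hne.symm hcr.symm⟩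
  · refine ⟨h0, ?_⟩
    rw [edgeMult]
    exact (Set.ncard_pos hfin).2 ⟨_, hp⟩

end Plane

/-! ### Linear maps of exponents and reduction to normalized types -/

section ExponentMaps

variable {A : Type u} [CommRing A] {m n : ℕ}

/-- The homomorphism of Laurent polynomial rings given by a linear map of exponent vectors. -/
def expMap (A : Type u) [CommRing A] (ι : (Fin m → ℤ) →+ (Fin n → ℤ)) :
    Laurent m A →ₐ[A] Laurent n A :=
  AddMonoidAlgebra.mapDomainAlgHom A A ι

theorem expMap_single (ι : (Fin m → ℤ) →+ (Fin n → ℤ)) (u : Fin m → ℤ) (a : A) :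
    expMap A ι (AddMonoidAlgebra.single u a) = AddMonoidAlgebra.single (ι u) a :=
  AddMonoidAlgebra.mapDomain_single

theorem expMap_mono (ι : (Fin m → ℤ) →+ (Fin n → ℤ)) (u : Fin m → ℤ) :
    expMap A ι (mono A u) = mono A (ι u) := expMap_single ι u 1

theorem expMap_evalMono (ι : (Fin m → ℤ) →+ (Fin n → ℤ)) (v : Fin m → ℤ) (P : Polynomial A) :
    expMap A ι (evalMono v P) = evalMono (ι v) P := by
  rw [evalMono, ← Polynomial.aeval_algHom_apply, expMap_mono, evalMono]

theorem expMap_value (ι : (Fin m → ℤ) →+ (Fin n → ℤ)) (d : Decomp m A) :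
    expMap A ι d.value = algebraMap A (Laurent n A) d.const * mono A (ι d.expo) *
      expMap A ι (toLaurent d.rest) *
      ((d.types.map fun t => (ι t.1, t.2)).map fun t => evalMono t.1 t.2).prod := by
  rw [Decomp.value, map_mul, map_mul, map_mul, AlgHom.commutes, expMap_mono, map_list_prod,
    List.map_map, List.map_map]
  congr 2
  refine List.map_congr_left fun t _ => ?_
  exact expMap_evalMono ι t.1 t.2

/-- Insertion of a zero coordinate. -/
def insertZero (i : Fin (n + 1)) : (Fin n → ℤ) →+ (Fin (n + 1) → ℤ) where
  toFun u := i.insertNth (α := fun _ => ℤ) 0 u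
  map_zero' := by
    ext j
    refine i.succAboveCases ?_ (fun j => ?_) j <;> simp
  map_add' a b := by
    ext j
    refine i.succAboveCases ?_ (fun j => ?_) j <;> simp

theorem insertZero_apply (i : Fin (n + 1)) (u : Fin n → ℤ) :
    insertZero i u = i.insertNth (α := fun _ => ℤ) 0 u := rfl

theorem expMap_toLaurent (ι : (Fin m → ℤ) →+ (Fin n → ℤ)) (σ : Fin m → Fin n)
    (h : ∀ j, ι (Pi.single j 1) = Pi.single (σ j) 1) (g : MvPolynomial (Fin m) A) :
    toLaurent (MvPolynomial.rename σ g) = expMap A ι (toLaurent g) := by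
  have : (toLaurent (A := A)).comp (MvPolynomial.rename σ) = (expMap A ι).comp toLaurent := by
    apply MvPolynomial.algHom_ext
    intro j
    rw [AlgHom.comp_apply, AlgHom.comp_apply, MvPolynomial.rename_X, toLaurent_X, toLaurent_X,
      var, var, expMap_mono, h]
  exact DFunLike.congr_fun this g

theorem insertZero_single (i : Fin (n + 1)) (j : Fin n) :
    insertZero i (Pi.single j 1) = Pi.single (i.succAbove j) 1 := by
  ext l
  rw [insertZero_apply]
  refine i.succAboveCases ?_ (fun l => ?_) l
  · rw [Fin.insertNth_apply_same, Pi.single_eq_of_ne (Fin.succAbove_ne i j).symm]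
  · rw [Fin.insertNth_apply_succAbove]
    by_cases h : l = j
    · subst h; simp
    · rw [Pi.single_eq_of_ne h, Pi.single_eq_of_ne (i.succAbove_right_injective.ne h)]

theorem gcd_eq_one_iff {v : Fin n → ℤ} :
    Finset.univ.gcd v = 1 ↔ ∀ d : ℤ, (∀ i, d ∣ v i) → IsUnit d := by
  constructor
  · intro h d hd
    exact isUnit_of_dvd_one (h ▸ Finset.dvd_gcd fun i _ => hd i)
  · intro h
    have := h _ fun i => Finset.gcd_dvd (f := v) (Finset.mem_univ i)
    rw [← Finset.normalize_gcd]
    exact normalize_eq_one.2 this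

theorem Normalized.insertZero {v : Fin n → ℤ} (hv : Normalized v) (i : Fin (n + 1)) :
    Normalized (insertZero i v) := by
  refine ⟨gcd_eq_one_iff.2 fun d hd => gcd_eq_one_iff.1 hv.1 d fun j => ?_, ?_⟩
  · simpa [insertZero_apply] using hd (i.succAbove j)
  · obtain ⟨j, hj, hj'⟩ := hv.2
    refine ⟨i.succAbove j, by simpa [insertZero_apply] using hj, fun l => ?_⟩
    refine i.succAboveCases ?_ (fun l => ?_) l
    · intro _; simp [insertZero_apply]
    · intro hl
      simpa [insertZero_apply] using hj' l ((Fin.strictMono_succAbove i).lt_iff_lt.1 hl)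

theorem insertZero_injective (i : Fin (n + 1)) :
    Function.Injective (insertZero (n := n) i) := by
  intro u u' h
  ext j
  simpa [insertZero_apply] using congrFun h (i.succAbove j)

/-- Every nonzero integer vector is a multiple of a normalized one. -/
theorem exists_normalized {v : Fin n → ℤ} (hv : v ≠ 0) :
    ∃ (k : ℕ) (w : Fin n → ℤ), Normalized w ∧ (v = k • w ∨ v = -(k • w)) := by
  obtain ⟨i₀, hi₀⟩ := Function.ne_iff.1 hv
  obtain ⟨u, hu, hu1⟩ := Finset.extract_gcd v ⟨i₀, Finset.mem_univ i₀⟩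
  set g := Finset.univ.gcd v with hg
  have hg0 : 0 ≤ g := by
    rw [hg, ← Finset.normalize_gcd]
    rw [← Int.abs_eq_normalize]; exact abs_nonneg _
  have hvu : v = g.toNat • u := by
    ext j
    rw [hu j (Finset.mem_univ j)]
    simp only [Pi.smul_apply, nsmul_eq_mul]
    rw [Int.toNat_of_nonneg hg0]
  have hu0 : ({j | u j ≠ 0} : Finset (Fin n)).Nonempty := by
    refine ⟨i₀, Finset.mem_filter.2 ⟨Finset.mem_univ _, fun h => hi₀ ?_⟩⟩
    rw [hvu]; simp [h]
  obtain ⟨j, hj, hmax⟩ := Finset.exists_max_image _ id hu0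
  have hj0 : u j ≠ 0 := (Finset.mem_filter.1 hj).2
  have hlast : ∀ l, j < l → u l = 0 := by
    intro l hl
    by_contra hne
    exact absurd (hmax l (Finset.mem_filter.2 ⟨Finset.mem_univ _, hne⟩)) (not_le.2 hl)
  rcases lt_or_gt_of_ne hj0 with h | h
  · refine ⟨g.toNat, -u, ⟨?_, j, by simpa using h, fun l hl => by simp [hlast l hl]⟩,
      Or.inr (by rw [smul_neg, neg_neg, ← hvu])⟩
    rw [gcd_eq_one_iff] at hu1 ⊢
    exact fun d hd => hu1 d fun i => by simpa using hd i
  · exact ⟨g.toNat, u, ⟨hu1, j, h, hlast⟩, Or.inl hvu⟩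

/-- It is enough to consider normalized vectors and polynomials with nonzero constant term. -/
theorem noLinearDivisor_of_normalized [IsDomain A] {F : Laurent n A} (hF : F ≠ 0)
    (h0 : ∀ a : A, algebraMap A (Laurent n A) a ∣ F → IsUnit a)
    (h : ∀ v, Normalized v → ∀ P : Polynomial A, P.coeff 0 ≠ 0 → evalMono v P ∣ F →
      IsUnit (evalMono v P)) : NoLinearDivisor F := by
  have h1 : ∀ v, Normalized v → ∀ P : Polynomial A, evalMono v P ∣ F →
      IsUnit (evalMono v P) := by
    intro v hv P hP
    have hP0 : P ≠ 0 := by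
      rintro rfl
      rw [evalMono, map_zero, zero_dvd_iff] at hP
      exact hF hP
    obtain ⟨i, P', rfl, hP'⟩ := exists_X_pow_mul hP0
    rw [evalMono_mul, evalMono_X_pow] at hP ⊢
    exact (isUnit_mono _).mul (h v hv P' hP' ((dvd_mul_left _ _).trans hP))
  intro v P hP
  -- For `v = 0` the divisor is a constant. A multiple of a normalized vector is absorbed by
  -- expanding `P`, a sign by reversing it.
  by_cases hv : v = 0
  · subst hv
    rw [evalMono_zero_left] at hP ⊢
    exact (h0 _ hP).map _
  · obtain ⟨k, w, hw, rfl | rfl⟩ := exists_normalized hv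
    · rw [evalMono_nsmul] at hP ⊢
      exact h1 w hw _ hP
    · rw [evalMono_neg, evalMono_nsmul] at hP ⊢
      exact (isUnit_mono _).mul (h1 w hw _ ((dvd_mul_left _ _).trans hP))

end ExponentMaps

/-! ### From split decompositions to QILDs; the common steps and one variable -/

section Split

variable {A : Type u} [CommRing A] {n : ℕ}

/-- A form of `IsQILD` that is better suited to inductive arguments: the factor `P₀` is a product
of elements that have no divisors `P(x ^ v)`, and is not divisible by any variable. -/
structure IsSplit (p : MvPolynomial (Fin n) A) (d : Decomp n A) : Prop where
  value_eq : toLaurent p = d.value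
  rest_mem : toLaurent d.rest ∈ nonlinear n A
  not_X_dvd : ∀ j, ¬ MvPolynomial.X j ∣ d.rest
  poly_qPrimitive : ∀ t ∈ d.types, QPrimitive t.2
  poly_degree : ∀ t ∈ d.types, 0 < t.2.natDegree
  type_normalized : ∀ t ∈ d.types, Normalized t.1
  types_distinct : (d.types.map Prod.fst).Nodup

theorem exactDiv_spec {f g : A} (h : g ∣ f) : f = g * exactDiv f g := by
  have h' : ∃ e, f = g * e := h
  rw [exactDiv, dif_pos h']
  exact h'.choose_spec

theorem ne_zero_of_mem_nonlinear [IsDomain A] {F : Laurent n A} (hF : F ∈ nonlinear n A) :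
    F ≠ 0 := by
  induction hF using Submonoid.closure_induction with
  | mem F hF =>
    rintro rfl
    have := hF 0 0 (dvd_zero _)
    rw [evalMono, map_zero] at this
    exact not_isUnit_zero this
  | one => exact one_ne_zero
  | mul F G _ _ h1 h2 => exact mul_ne_zero h1 h2

variable {p : MvPolynomial (Fin n) A} {d : Decomp n A}

theorem IsSplit.const_dvd (h : IsSplit p d) :
    algebraMap A (Laurent n A) d.const ∣ toLaurent p := by
  rw [h.value_eq, Decomp.value, mul_assoc, mul_assoc]
  exact dvd_mul_right _ _

theorem IsSplit.isUnit_const (h : IsSplit p d) (hp : Primitive p) : IsUnit d.const :=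
  primitive_iff.1 hp _ h.const_dvd

theorem not_X_dvd_of_isUnit [IsDomain A] {f : MvPolynomial (Fin n) A}
    (h : IsUnit f) (j : Fin n) : ¬ MvPolynomial.X j ∣ f := fun hd =>
  MvPolynomial.X_prime.not_isUnit (isUnit_of_dvd_unit hd h)

/-- Parts `P₀` that are units. -/
theorem mem_nonlinear_toLaurent_of_isUnit {f : MvPolynomial (Fin n) A} (h : IsUnit f) :
    toLaurent f ∈ nonlinear n A := mem_nonlinear_of_isUnit (h.map _)

/-- Irreducible factors of `P₀`, constants included, are prime and are not variables, so they stay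
prime in the Laurent ring. An integer-linear one is associated there to a prime `P(x ^ v)`, and such
a prime divides no element of `nonlinear`. -/
theorem IsSplit.isQILD [IsDomain A] [UniqueFactorizationMonoid A] (h : IsSplit p d)
    (hp : p ≠ 0) : IsQILD p d := by
  have hrest0 : d.rest ≠ 0 := fun h0 => ne_zero_of_mem_nonlinear h.rest_mem (by rw [h0, map_zero])
  refine ⟨h.value_eq, ?_, ?_, ?_, h.poly_qPrimitive, h.poly_degree,
    fun t ht => (h.type_normalized t ht).ne_zero, h.type_normalized, h.types_distinct⟩
  · intro j
    -- In each variable the product of the remaining factors has a term with nonpositive exponent,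
    -- whereas `p` has no negative exponents; hence `α ≥ 0`.
    have hT : TouchesAxes (toLaurent d.rest * (d.types.map fun t => evalMono t.1 t.2).prod) := by
      refine (touchesAxes_toLaurent.2 h.not_X_dvd).mul (TouchesAxes.list_prod fun F hF => ?_)
      obtain ⟨t, ht, rfl⟩ := List.mem_map.1 hF
      exact touchesAxes_evalMono (h.type_normalized t ht).ne_zero (h.poly_qPrimitive t ht).2
    obtain ⟨e, he, hej⟩ := hT j
    have hval := h.value_eq
    rw [Decomp.value, mul_assoc (algebraMap _ _ _ * _), ← single_eq_algebraMap_mul] at hval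
    have hc : (toLaurent p).coeff (d.expo + e) = d.const *
        (toLaurent d.rest * (d.types.map fun t => evalMono t.1 t.2).prod).coeff e := by
      rw [hval, AddMonoidAlgebra.coeff_single_mul_apply]
      congr 2
      abel
    have hc0 : d.const ≠ 0 := by
      intro h0
      apply hp
      rw [← toLaurent_eq_zero, hval, h0, AddMonoidAlgebra.single_zero, zero_mul]
    obtain ⟨e', -, he'⟩ := exists_of_coeff_toLaurent_ne_zero p _
      (hc.symm ▸ mul_ne_zero hc0 he)
    have := congrFun he' j
    simp only [intVec, Pi.add_apply] at this
    omega
  · intro a ha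
    by_contra hau
    have ha0 : a ≠ 0 := by
      rintro rfl
      rw [MvPolynomial.C_0, zero_dvd_iff] at ha
      exact hrest0 ha
    obtain ⟨π, hπ, hπa⟩ := WfDvdMonoid.exists_irreducible_factor hau ha0
    have hπp : Prime (MvPolynomial.C π : MvPolynomial (Fin n) A) :=
      (MvPolynomial.prime_C_iff _).2 hπ.prime
    have hX : ∀ j, ¬ MvPolynomial.X j ∣ (MvPolynomial.C π : MvPolynomial (Fin n) A) := by
      intro j hj
      rw [← MvPolynomial.monomial_zero', MvPolynomial.X_dvd_monomial] at hj
      rcases hj with h | h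
      · exact hπ.ne_zero h
      · exact h rfl
    have hprime := prime_toLaurent hπp hX
    rw [toLaurent_C, ← evalMono_C 0] at hprime
    refine not_dvd_of_mem_nonlinear h.rest_mem hprime ?_
    rw [evalMono_C, ← toLaurent_C]
    exact map_dvd _ ((map_dvd MvPolynomial.C hπa).trans ha)
  · rintro r hr - hrd ⟨P, α, v, hlin⟩
    have hrp : Prime r := hr.prime
    have hX : ∀ j, ¬ MvPolynomial.X j ∣ r := by
      intro j hj
      have hass := (MvPolynomial.X_prime.irreducible.associated_of_dvd hr hj)
      exact h.not_X_dvd j (hass.dvd.trans hrd)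
    have hprime := prime_toLaurent hrp hX
    have hass : Associated (toLaurent r) (evalMono v P) := by
      rw [hlin]
      exact associated_unit_mul_left _ _ (isUnit_mono _)
    exact not_dvd_of_mem_nonlinear h.rest_mem (hass.prime hprime)
      (hass.symm.dvd.trans (map_dvd _ hrd))

theorem isSplit_C [IsDomain A] (a : A) (hp : p = MvPolynomial.C a) :
    IsSplit p ⟨p.coeff 0, 0, 1, []⟩ where
  value_eq := by
    subst hp
    simp only [Decomp.value, mono_zero, map_one, mul_one, List.map_nil, List.prod_nil]
    rw [toLaurent_C, MvPolynomial.coeff_zero_C]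
  rest_mem := by rw [map_one]; exact one_mem _
  not_X_dvd := not_X_dvd_of_isUnit isUnit_one
  poly_qPrimitive := by simp
  poly_degree := by simp
  type_normalized := by simp
  types_distinct := by simp

theorem isSplit_monomial [IsDomain A] (a : A) (e : Fin n →₀ ℕ)
    (hp : p = MvPolynomial.monomial e a) :
    IsSplit p ⟨a, fun i => (e i : ℤ), 1, []⟩ where
  value_eq := by
    subst hp
    simp only [Decomp.value, map_one, mul_one, List.map_nil, List.prod_nil]
    rw [toLaurent_monomial, single_eq_algebraMap_mul]
    rfl
  rest_mem := by rw [map_one]; exact one_mem _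
  not_X_dvd := not_X_dvd_of_isUnit isUnit_one
  poly_qPrimitive := by simp
  poly_degree := by simp
  type_normalized := by simp
  types_distinct := by simp

theorem eq_monomial_of_support {f : MvPolynomial (Fin n) A} {e : Fin n →₀ ℕ}
    (h : f.support = {e}) : f = MvPolynomial.monomial e (f.coeff e) := by
  conv_lhs => rw [f.as_sum, h, Finset.sum_singleton]

/-- A case principle for the common steps: what reaches `next` is primitive and not a monomial. -/
theorem prepare_spec [IsDomain A] [UniqueFactorizationMonoid A] (ch : Choices.{u})
    (p : MvPolynomial (Fin n) A) (next : A → MvPolynomial (Fin n) A → Decomp n A)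
    (Q : Decomp n A → Prop)
    (hC : ∀ a, p = MvPolynomial.C a → Q ⟨p.coeff 0, 0, 1, []⟩)
    (hm : ∀ a e, p = MvPolynomial.monomial e a → Q ⟨a, fun i => (e i : ℤ), 1, []⟩)
    (h : ∀ c f, p = MvPolynomial.C c * f → Primitive f → (¬ ∃ e, f.support = {e}) →
      Q (next c f)) : Q (prepare ch p next) := by
  rw [prepare]
  split_ifs with h1
  · obtain ⟨a, ha⟩ := h1
    exact hC a ha
  · have hcd : MvPolynomial.C (cont ch p) ∣ p := by
      rw [MvPolynomial.C_dvd_iff_dvd_coeff]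
      exact (dvd_cont_iff ch p _).1 dvd_rfl
    have hpf := exactDiv_spec hcd
    set c := cont ch p with hc
    set f := exactDiv p (MvPolynomial.C c) with hf
    have hc0 : c ≠ 0 := by
      intro h0
      rw [h0, MvPolynomial.C_0, zero_mul] at hpf
      exact h1 ⟨0, by rw [hpf, MvPolynomial.C_0]⟩
    dsimp only
    rw [← hf]
    split_ifs with h2
    · have hfe := eq_monomial_of_support h2.choose_spec
      refine hm _ _ ?_
      rw [← MvPolynomial.C_mul_monomial, ← hfe, ← hpf]
    · refine h c f hpf (fun a ha => ?_) h2
      -- If `a` divides `f`, then `c * a` divides all coefficients of `p`, hence their gcd `c`.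
      have hd : c * a ∣ c := by
        rw [hc, dvd_cont_iff, ← hc, ← MvPolynomial.C_dvd_iff_dvd_coeff, MvPolynomial.C_mul]
        conv_rhs => rw [hpf]
        exact mul_dvd_mul_left _ ha
      obtain ⟨b, hb⟩ := hd
      refine IsUnit.of_mul_eq_one b (mul_left_cancel₀ hc0 ?_)
      rw [← mul_assoc, ← hb, mul_one]

theorem evalMono_toUni (f : MvPolynomial (Fin 1) A) :
    evalMono (fun _ => 1) (toUni f) = toLaurent f := by
  have : (Polynomial.aeval (mono A (fun _ : Fin 1 => (1 : ℤ)))).comp toUni = toLaurent := by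
    apply MvPolynomial.algHom_ext
    intro j
    rw [AlgHom.comp_apply, toUni, MvPolynomial.aeval_X, Polynomial.aeval_X, toLaurent_X, var]
    congr 1
    ext i
    rw [Subsingleton.elim i j, Pi.single_eq_same]
  exact DFunLike.congr_fun this f

theorem toUni_injective : Function.Injective (toUni (A := A)) := by
  intro f g h
  apply toLaurent_injective
  rw [← evalMono_toUni, h, evalMono_toUni]

theorem normalized_one : Normalized (fun _ : Fin 1 => (1 : ℤ)) :=
  ⟨by simp, 0, by simp, fun j hj => by omega⟩

theorem univariate_isSplit [IsDomain A] {p f : MvPolynomial (Fin 1) A} {c : A}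
    (hp : p = MvPolynomial.C c * f) (hf : Primitive f) (hs : ¬ ∃ e, f.support = {e}) :
    IsSplit p (univariate c f) := by
  have hdvd : Polynomial.X ^ (toUni f).natTrailingDegree ∣ toUni f := by
    rw [Polynomial.X_pow_dvd_iff]
    exact fun _ => Polynomial.coeff_eq_zero_of_lt_natTrailingDegree
  have hFP := exactDiv_spec hdvd
  have hu : univariate c f = ⟨c, fun _ => ((toUni f).natTrailingDegree : ℤ), 1, [(fun _ => 1,
    exactDiv (toUni f) (Polynomial.X ^ (toUni f).natTrailingDegree))]⟩ := rfl
  rw [hu]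
  have hf0 : f ≠ 0 := by
    rintro rfl
    exact not_isUnit_zero (hf 0 (dvd_zero _))
  have hF0 : toUni f ≠ 0 := fun h => hf0 (toUni_injective (by rw [h, map_zero]))
  have htr : (toUni f).coeff (toUni f).natTrailingDegree ≠ 0 :=
    Polynomial.trailingCoeff_nonzero_iff_nonzero.2 hF0
  generalize (toUni f).natTrailingDegree = k at hFP htr
  generalize exactDiv (toUni f) (Polynomial.X ^ k) = P at hFP
  have hP0 : P.coeff 0 ≠ 0 := by
    have := Polynomial.coeff_X_pow_mul P k 0
    rw [zero_add, ← hFP] at this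
    rwa [← this]
  refine ⟨?_, ?_, not_X_dvd_of_isUnit isUnit_one, ?_, ?_, ?_, by simp⟩
  · simp only [Decomp.value, map_one, mul_one, List.map_cons, List.map_nil,
      List.prod_cons, List.prod_nil]
    rw [hp, map_mul, toLaurent_C, ← evalMono_toUni, hFP, evalMono_mul, evalMono_X_pow, mul_assoc]
    congr 3
    ext i
    simp
  · rw [map_one]
    exact one_mem _
  · simp only [List.mem_singleton, forall_eq]
    refine ⟨fun a ha => ?_, hP0⟩
    apply primitive_iff.1 hf
    rw [← evalMono_toUni, ← evalMono_C (fun _ => 1), hFP]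
    exact map_dvd _ (ha.trans (dvd_mul_left _ _))
  · simp only [List.mem_singleton, forall_eq]
    -- A constant `P` would make `f` a monomial, which `hs` excludes.
    refine Nat.pos_of_ne_zero fun h0 => hs ⟨Finsupp.single 0 k, ?_⟩
    have hfm : f = MvPolynomial.monomial (Finsupp.single 0 k) (P.coeff 0) := by
      apply toUni_injective
      have hm : toUni (MvPolynomial.monomial (Finsupp.single (0 : Fin 1) k) (P.coeff 0)) =
          Polynomial.C (P.coeff 0) * Polynomial.X ^ k := by
        rw [toUni, MvPolynomial.aeval_monomial, Finsupp.prod_single_index (by simp)]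
        rfl
      rw [hm, hFP, mul_comm]
      congr 1
      exact Polynomial.eq_C_of_natDegree_eq_zero h0
    rw [hfm]
    classical
    rw [MvPolynomial.support_monomial, if_neg hP0]
  · simp only [List.mem_singleton, forall_eq]
    exact normalized_one

variable [IsDomain A] [UniqueFactorizationMonoid A] (ch : Choices.{u})

theorem multivariateQILD1_one_isSplit (p : MvPolynomial (Fin 1) A) :
    IsSplit p (multivariateQILD1 ch 1 p) :=
  prepare_spec ch p univariate (IsSplit p) isSplit_C isSplit_monomial
    fun _ _ => univariate_isSplit

/-- A univariate call leaves nothing in `P₀`, so the removal of contents in two variables changes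
`P₀` only by units. -/
theorem multivariateQILD1_one_rest (p : MvPolynomial (Fin 1) A) :
    (multivariateQILD1 ch 1 p).rest = 1 :=
  prepare_spec ch p univariate (fun d => d.rest = 1) (fun _ _ => rfl) (fun _ _ _ => rfl)
    fun _ _ _ _ _ => rfl

end Split

/-! ### Removal of the content in one variable -/

section Contents

variable {A : Type u} [CommRing A] {n : ℕ}

theorem viewVar_rename (i : Fin (n + 1)) (g : MvPolynomial (Fin n) A) :
    viewVar i (MvPolynomial.rename i.succAbove g) = Polynomial.C g := by
  have : (viewVar (A := A) i).comp (MvPolynomial.rename i.succAbove) =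
      IsScalarTower.toAlgHom A (MvPolynomial (Fin n) A) (Polynomial (MvPolynomial (Fin n) A)) := by
    apply MvPolynomial.algHom_ext
    intro j
    rw [AlgHom.comp_apply, MvPolynomial.rename_X, viewVar, MvPolynomial.aeval_X,
      Fin.insertNth_apply_succAbove]
    rfl
  exact DFunLike.congr_fun this g

theorem eval₂_viewVar (i : Fin (n + 1)) (f : MvPolynomial (Fin (n + 1)) A) :
    (viewVar i f).eval₂ (MvPolynomial.rename i.succAbove : MvPolynomial (Fin n) A →ₐ[A] _)
      (MvPolynomial.X i) = f := by
  have : (Polynomial.eval₂RingHom ((MvPolynomial.rename i.succAbove :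
      MvPolynomial (Fin n) A →ₐ[A] _) : MvPolynomial (Fin n) A →+* MvPolynomial (Fin (n + 1)) A)
      (MvPolynomial.X i)).comp (viewVar (A := A) i : _ →+* _) = RingHom.id _ := by
    apply MvPolynomial.ringHom_ext
    · intro a
      simp [viewVar, MvPolynomial.algebraMap_eq, Polynomial.algebraMap_apply]
    · intro j
      refine i.succAboveCases ?_ (fun j => ?_) j
      · simp [viewVar]
      · simp [viewVar]
  exact DFunLike.congr_fun this f

theorem rename_dvd_iff (i : Fin (n + 1)) (g : MvPolynomial (Fin n) A)
    (f : MvPolynomial (Fin (n + 1)) A) :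
    MvPolynomial.rename i.succAbove g ∣ f ↔ ∀ k, g ∣ (viewVar i f).coeff k := by
  rw [← Polynomial.C_dvd_iff_dvd_coeff]
  constructor
  · intro h
    rw [← viewVar_rename i]
    exact map_dvd _ h
  · rintro ⟨H, hH⟩
    have := eval₂_viewVar i f
    rw [hH, Polynomial.eval₂_mul, Polynomial.eval₂_C] at this
    exact ⟨_, this.symm⟩

theorem dvd_contVar_iff [IsDomain A] [UniqueFactorizationMonoid A] (ch : Choices.{u})
    (i : Fin (n + 1)) (f : MvPolynomial (Fin (n + 1)) A) (d : MvPolynomial (Fin n) A) :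
    d ∣ contVar ch i f ↔ MvPolynomial.rename i.succAbove d ∣ f := by
  rw [contVar, ch.dvd_gcd_iff, rename_dvd_iff]
  constructor
  · intro h k
    by_cases hk : (viewVar i f).coeff k = 0
    · rw [hk]; exact dvd_zero _
    · exact h _ (Polynomial.mem_coeffs_iff.2 ⟨k, Polynomial.mem_support_iff.2 hk, rfl⟩)
  · intro h b hb
    obtain ⟨k, -, rfl⟩ := Polynomial.mem_coeffs_iff.1 hb
    exact h k

theorem value_merge {m : ℕ} (s : Decomp n A) (d : Decomp m A) (ι : (Fin m → ℤ) →+ (Fin n → ℤ))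
    (σ : Fin m → Fin n) (h : ∀ j, ι (Pi.single j 1) = Pi.single (σ j) 1) :
    Decomp.value ⟨s.const, s.expo + ι d.expo, s.rest * MvPolynomial.rename σ d.unitRest,
      s.types ++ d.types.map fun t => (ι t.1, t.2)⟩ = s.value * expMap A ι d.value := by
  rw [expMap_value]
  simp only [Decomp.value, Decomp.unitRest, map_mul, MvPolynomial.rename_C, toLaurent_C,
    expMap_toLaurent ι σ h, mono_add, List.map_append, List.prod_append]
  ring

open scoped Classical in
/-- The removal of the content with respect to one variable. -/
def contentStep (ch : Choices.{u}) (call : MvPolynomial (Fin n) A → Decomp n A)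
    (s : MvPolynomial (Fin (n + 1)) A × Decomp (n + 1) A) (i : Fin (n + 1)) :
    MvPolynomial (Fin (n + 1)) A × Decomp (n + 1) A :=
  let g := contVar ch i s.1
  let f := exactDiv s.1 (MvPolynomial.rename i.succAbove g)
  if g = 1 then (f, s.2)
  else
    let d := call g
    (f, { const := s.2.const
          expo := s.2.expo + i.insertNth (α := fun _ => ℤ) 0 d.expo
          rest := s.2.rest * MvPolynomial.rename i.succAbove d.unitRest
          types := s.2.types ++
            d.types.map fun t => (i.insertNth (α := fun _ => ℤ) 0 t.1, t.2) })

/-- The effect of the removal of the content with respect to `xᵢ`. -/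
structure ContentStepSpec (i : Fin (n + 1))
    (s s' : MvPolynomial (Fin (n + 1)) A × Decomp (n + 1) A) : Prop where
  value : s.2.value * toLaurent s.1 = s'.2.value * toLaurent s'.1
  dvd : s'.1 ∣ s.1
  isUnit_of_dvd : ∀ g, MvPolynomial.rename i.succAbove g ∣ s'.1 → IsUnit g
  rest : IsUnit s.2.rest → IsUnit s'.2.rest
  types : ∃ T, s'.2.types = s.2.types ++ T ∧ (∀ t ∈ T, QPrimitive t.2 ∧ 0 < t.2.natDegree ∧
    Normalized t.1 ∧ t.1 i = 0) ∧ (T.map Prod.fst).Nodup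

/-- If `g` divides what is left, the content times `g` divides the original polynomial and hence the
content, so `g` is a unit. The constant of the call is a unit because a divisor of a primitive
polynomial is primitive. -/
theorem contentStep_spec [IsDomain A] [UniqueFactorizationMonoid A] (ch : Choices.{u})
    {call : MvPolynomial (Fin n) A → Decomp n A} (hcall : ∀ g, IsSplit g (call g))
    (hrest : ∀ g, (call g).rest = 1) {s : MvPolynomial (Fin (n + 1)) A × Decomp (n + 1) A}
    (hs : Primitive s.1) (i : Fin (n + 1)) :
    ContentStepSpec i s (contentStep ch call s i) := by
  have hs0 : s.1 ≠ 0 := fun h0 => not_isUnit_zero (hs 0 (h0 ▸ dvd_zero _))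
  have hdvd : MvPolynomial.rename i.succAbove (contVar ch i s.1) ∣ s.1 :=
    (dvd_contVar_iff ch i s.1 _).1 dvd_rfl
  have hf := exactDiv_spec hdvd
  have hg0 : contVar ch i s.1 ≠ 0 := fun h0 => hs0 (by rw [hf, h0, map_zero, zero_mul])
  have hmax : ∀ g, MvPolynomial.rename i.succAbove g ∣
      exactDiv s.1 (MvPolynomial.rename i.succAbove (contVar ch i s.1)) → IsUnit g := by
    intro g hg
    have h1 : contVar ch i s.1 * g ∣ contVar ch i s.1 := by
      rw [dvd_contVar_iff, map_mul]
      conv_rhs => rw [hf]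
      exact mul_dvd_mul_left _ hg
    obtain ⟨b, hb⟩ := h1
    refine IsUnit.of_mul_eq_one b (mul_left_cancel₀ hg0 ?_)
    rw [← mul_assoc, ← hb, mul_one]
  rw [contentStep]
  dsimp only
  generalize contVar ch i s.1 = g at hdvd hf hmax
  generalize exactDiv s.1 (MvPolynomial.rename i.succAbove g) = f at hf hmax
  split_ifs with h1
  · rw [h1, map_one, one_mul] at hf
    exact ⟨by rw [hf], by rw [hf], hmax, id, [], by simp, by simp, by simp⟩
  · have hg := hcall g
    have hgprim : Primitive g := by
      intro a ha
      apply hs a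
      have := map_dvd (MvPolynomial.rename i.succAbove) ha
      rw [MvPolynomial.rename_C] at this
      exact this.trans hdvd
    have hu := hg.isUnit_const hgprim
    refine ⟨?_, ⟨_, hf.trans (mul_comm _ _)⟩, hmax, fun hr => hr.mul ?_,
      (call g).types.map fun t => (insertZero i t.1, t.2), rfl, ?_, ?_⟩
    · have hv := value_merge s.2 (call g) (insertZero i) i.succAbove (insertZero_single i)
      refine Eq.trans ?_ (congrArg (· * toLaurent f) hv.symm)
      rw [← hg.value_eq, ← expMap_toLaurent _ _ (insertZero_single i), mul_assoc, ← map_mul, ← hf]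
    · rw [Decomp.unitRest, hrest, mul_one]
      rw [MvPolynomial.rename_C]
      exact hu.map _
    · intro t ht
      obtain ⟨t', ht', rfl⟩ := List.mem_map.1 ht
      refine ⟨hg.poly_qPrimitive t' ht', hg.poly_degree t' ht',
        (hg.type_normalized t' ht').insertZero i, ?_⟩
      simp [insertZero_apply]
    · rw [List.map_map]
      have : (Prod.fst ∘ fun t : (Fin n → ℤ) × Polynomial A => (insertZero i t.1, t.2)) =
          insertZero i ∘ Prod.fst := rfl
      rw [this, ← List.map_map]
      exact hg.types_distinct.map (insertZero_injective i)

end Contents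

/-! ### Testing the candidates; correctness in two variables -/

section Candidates

variable {A : Type u} [CommRing A] [IsDomain A] [UniqueFactorizationMonoid A] (ch : Choices.{u})

/-- The effect of testing the candidates in `l`. -/
structure TestSpec (l : List (Fin 2 → ℤ)) (s s' : MvPolynomial (Fin 2) A × Decomp 2 A) :
    Prop where
  value : s.2.value * toLaurent s.1 = s'.2.value * toLaurent s'.1
  dvd : s'.1 ∣ s.1
  isUnit_of_dvd : ∀ v ∈ l, ∀ P : Polynomial A, P.coeff 0 ≠ 0 → evalMono v P ∣ toLaurent s'.1 →
    IsUnit P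
  rest : s'.2.rest = s.2.rest
  types : ∃ T, s'.2.types = s.2.types ++ T ∧ (∀ t ∈ T, QPrimitive t.2 ∧ 0 < t.2.natDegree) ∧
    (T.map Prod.fst).Sublist l

/-- If `P'(x ^ v)` divides the quotient, then `(P * P')(x ^ v)` divides the original polynomial, and
the maximality of `P` makes `P'` a unit. If the content is constant, `P` is a unit by primitivity,
and every such `P'` divides it. -/
theorem testCandidate_spec {s : MvPolynomial (Fin 2) A × Decomp 2 A} (hs : Primitive s.1)
    (hX : ¬ MvPolynomial.X 1 ∣ s.1) {v : Fin 2 → ℤ} (hv : Normalized v) (h1 : v 1 ≠ 0) :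
    TestSpec [v] s (testCandidate ch s v) := by
  obtain ⟨w, hw⟩ := hv.exists_dotHom_eq_one
  have hv1 := hv.one_pos h1
  obtain ⟨P, hQP, hP0, hPd, hmax⟩ := typeContent_spec ch hw hv1 hs hX
  have hk : (v 1).toNat ≠ 0 := by omega
  have hprim : P.IsPrimitive := by
    intro a ha
    apply primitive_iff.1 hs
    rw [← evalMono_C v]
    exact (map_dvd (Polynomial.aeval (mono A v)) ha).trans hPd
  have hPne : P ≠ 0 := by
    rintro rfl
    simp at hP0
  rw [testCandidate]
  dsimp only
  rw [show v (Fin.last 1) = v 1 from rfl, hQP, Polynomial.natDegree_expand,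
    Polynomial.contract_expand _ hk]
  split_ifs with hdeg
  · have hdegP : 0 < P.natDegree := Nat.pos_of_mul_pos_right hdeg
    have hT := touchesAxes_evalMono hv.ne_zero hP0
    have hnum : num (evalMono v P) ∣ s.1 := by
      apply dvd_of_toLaurent_dvd (touchesAxes_iff.1 hT)
      rw [toLaurent_num, (isUnit_mono _).mul_left_dvd]
      exact hPd
    have hf := exactDiv_spec hnum
    have hfL : toLaurent s.1 = mono A (fun i => (den (evalMono v P) i : ℤ)) * evalMono v P *
        toLaurent (exactDiv s.1 (num (evalMono v P))) := by
      conv_lhs => rw [hf, map_mul, toLaurent_num]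
    refine ⟨?_, ⟨_, hf.trans (mul_comm _ _)⟩, ?_, rfl, [(v, P)], rfl, ?_, by simp⟩
    · dsimp only
      rw [hfL]
      simp only [Decomp.value, mono_add, List.map_append, List.prod_append, List.map_cons,
        List.map_nil, List.prod_cons, List.prod_nil, mul_one]
      ring
    · simp only [List.mem_singleton, forall_eq]
      intro P' hP' hd
      have hmul : evalMono v (P * P') ∣ toLaurent s.1 := by
        rw [hfL, evalMono_mul]
        exact mul_dvd_mul (dvd_mul_left _ _) hd
      obtain ⟨b, hb⟩ := hmax (P * P') (by
        rw [Polynomial.mul_coeff_zero]; exact mul_ne_zero hP0 hP') hmul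
      refine IsUnit.of_mul_eq_one b (mul_left_cancel₀ hPne ?_)
      rw [← mul_assoc, ← hb, mul_one]
    · simp only [List.mem_singleton, forall_eq]
      exact ⟨⟨hprim, hP0⟩, hdegP⟩
  · refine ⟨rfl, dvd_rfl, ?_, rfl, [], by simp, by simp, by simp⟩
    simp only [List.mem_singleton, forall_eq]
    intro P' hP' hd
    have hdP : P.natDegree = 0 := by
      by_contra hne
      exact hdeg (Nat.mul_pos (Nat.pos_of_ne_zero hne) (by omega))
    have hPu : IsUnit P := by
      rw [Polynomial.eq_C_of_natDegree_eq_zero hdP] at hprim ⊢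
      exact (hprim _ dvd_rfl).map _
    exact isUnit_of_dvd_unit (hmax P' hP' hd) hPu

theorem foldl_testCandidate_spec (l : List (Fin 2 → ℤ)) (hl : ∀ v ∈ l, Normalized v ∧ v 1 ≠ 0)
    {s : MvPolynomial (Fin 2) A × Decomp 2 A} (hs : Primitive s.1)
    (hX : ¬ MvPolynomial.X 1 ∣ s.1) : TestSpec l s (l.foldl (testCandidate ch) s) := by
  induction l generalizing s with
  | nil => exact ⟨rfl, dvd_rfl, by simp, rfl, [], by simp, by simp, by simp⟩
  | cons v l ih =>
    have h1 := testCandidate_spec ch hs hX (hl v (by simp)).1 (hl v (by simp)).2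
    have h2 := ih (fun v hv => hl v (by simp [hv]))
      (fun a ha => hs a (ha.trans h1.dvd)) (fun h => hX (h.trans h1.dvd))
    rw [List.foldl_cons]
    obtain ⟨T1, e1, g1, d1⟩ := h1.types
    obtain ⟨T2, e2, g2, d2⟩ := h2.types
    refine ⟨h1.value.trans h2.value, h2.dvd.trans h1.dvd, ?_, h2.rest.trans h1.rest, T1 ++ T2,
      by rw [e2, e1, List.append_assoc], ?_, ?_⟩
    · intro v' hv' P hP hd
      rcases List.mem_cons.1 hv' with rfl | hv'
      · exact h1.isUnit_of_dvd _ (by simp) P hP (hd.trans (map_dvd _ h2.dvd))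
      · exact h2.isUnit_of_dvd v' hv' P hP hd
    · intro t ht
      rcases List.mem_append.1 ht with ht | ht
      · exact g1 t ht
      · exact g2 t ht
    · rw [List.map_append]
      exact d1.append d2

omit [IsDomain A] [UniqueFactorizationMonoid A] in
theorem evalMono_single_eq {i : Fin 2} (P : Polynomial A) :
    evalMono (Pi.single (i.succAbove 0) 1) P = toLaurent (MvPolynomial.rename i.succAbove
      (Polynomial.aeval (MvPolynomial.X (0 : Fin 1) : MvPolynomial (Fin 1) A) P)) := by
  rw [← Polynomial.aeval_algHom_apply, ← Polynomial.aeval_algHom_apply, MvPolynomial.rename_X,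
    toLaurent_X]
  rfl

omit [UniqueFactorizationMonoid A] in
-- For a coordinate direction `P(x ^ v)` is a polynomial in one variable, so it belongs to the
-- content with respect to the other variable.
theorem isUnit_evalMono_single {i : Fin 2} {f : MvPolynomial (Fin 2) A}
    (h : ∀ g, MvPolynomial.rename i.succAbove g ∣ f → IsUnit g) {P : Polynomial A}
    (hP0 : P.coeff 0 ≠ 0) (hd : evalMono (Pi.single (i.succAbove 0) 1) P ∣ toLaurent f) :
    IsUnit (evalMono (Pi.single (i.succAbove 0) 1) P) := by
  have hne : (Pi.single (i.succAbove 0) 1 : Fin 2 → ℤ) ≠ 0 := by simp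
  have hT := touchesAxes_evalMono hne hP0
  rw [evalMono_single_eq] at hT hd ⊢
  exact ((h _ (dvd_of_toLaurent_dvd (touchesAxes_toLaurent.1 hT) hd)).map _).map _

theorem Normalized.eq_single {v : Fin 2 → ℤ} (hv : Normalized v) {i : Fin 2} (hi : v i = 0) :
    v = Pi.single (i.succAbove 0) 1 := by
  have hg := gcd_eq_one_iff.1 hv.1 (v (i.succAbove 0)) (by
    intro j
    refine i.succAboveCases (by rw [hi]; exact dvd_zero _) (fun j => ?_) j
    rw [Subsingleton.elim j 0])
  obtain ⟨j, hj, -⟩ := hv.2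
  have hpos : 0 < v (i.succAbove 0) := by
    revert hj
    refine i.succAboveCases (fun h => by omega) (fun j h => ?_) j
    rwa [Subsingleton.elim j 0] at h
  have h1 : v (i.succAbove 0) = 1 := by
    rcases Int.isUnit_iff.1 hg with h | h <;> omega
  ext j
  refine i.succAboveCases ?_ (fun j => ?_) j
  · rw [hi, Pi.single_eq_of_ne (Fin.succAbove_ne i 0).symm]
  · rw [Subsingleton.elim j 0, h1, Pi.single_eq_same]

omit [UniqueFactorizationMonoid A] in
/-- What is left after all candidates have been tested has no integer-linear divisors. -/
theorem noLinearDivisor_of_candidates {f r : MvPolynomial (Fin 2) A} (hf : Primitive f)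
    (hcont : ∀ i : Fin 2, ∀ g, MvPolynomial.rename i.succAbove g ∣ f → IsUnit g) (hr : r ∣ f)
    (h : ∀ v ∈ candidates ch f, ∀ P : Polynomial A, P.coeff 0 ≠ 0 →
      evalMono v P ∣ toLaurent r → IsUnit P) : NoLinearDivisor (toLaurent r) := by
  have hf0 : f ≠ 0 := fun h0 => not_isUnit_zero (hf 0 (h0 ▸ dvd_zero _))
  have hrL : toLaurent r ∣ toLaurent f := map_dvd _ hr
  refine noLinearDivisor_of_normalized ?_ ?_ ?_
  · intro h0
    rw [h0, zero_dvd_iff] at hrL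
    exact hf0 (toLaurent_eq_zero.1 hrL)
  · exact fun a ha => primitive_iff.1 hf a (ha.trans hrL)
  · intro v hv P hP0 hd
    by_cases hz : ∃ i, v i = 0
    · obtain ⟨i, hi⟩ := hz
      rw [hv.eq_single hi] at hd ⊢
      exact isUnit_evalMono_single (hcont i) hP0 (hd.trans hrL)
    · push Not at hz
      by_cases hdeg : P.natDegree = 0
      · rw [Polynomial.eq_C_of_natDegree_eq_zero hdeg, evalMono_C] at hd ⊢
        exact (primitive_iff.1 hf _ (hd.trans hrL)).map _
      · exact (h v (mem_candidates ch hv hz hf0 hP0 (Nat.pos_of_ne_zero hdeg) (hd.trans hrL)) P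
          hP0 hd).map _

/-- Once the contents are removed, a nonunit divisor `P(x ^ v)` with `v` normalized and `P(0) ≠ 0`
has its type among the candidates, which are computed before any division. Divisors of a quotient
divide the polynomial they were computed from, so one test per candidate, in any order, leaves no
integer-linear divisors. -/
theorem multivariateQILD1_two_isSplit (p : MvPolynomial (Fin 2) A) :
    IsSplit p (multivariateQILD1 ch 2 p) := by
  refine prepare_spec ch p _ (IsSplit p) isSplit_C isSplit_monomial fun c f hp hf _ => ?_
  set s₀ : MvPolynomial (Fin 2) A × Decomp 2 A := (f, ⟨c, 0, 1, []⟩) with hs₀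
  have hcall := multivariateQILD1_one_isSplit (A := A) ch
  have hcrest := multivariateQILD1_one_rest (A := A) ch
  have hrem : removeContents ch (fun g => multivariateQILD1 ch (0 + 1) g) s₀ =
      contentStep ch (fun g => multivariateQILD1 ch 1 g)
        (contentStep ch (fun g => multivariateQILD1 ch 1 g) s₀ 0) 1 := rfl
  rw [hrem]
  have h1 := contentStep_spec ch hcall hcrest (s := s₀) hf 0
  generalize contentStep ch (fun g => multivariateQILD1 ch 1 g) s₀ 0 = s₁ at h1
  have hp1 : Primitive s₁.1 := fun a ha => hf a (ha.trans h1.dvd)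
  have h2 := contentStep_spec ch hcall hcrest hp1 1
  generalize contentStep ch (fun g => multivariateQILD1 ch 1 g) s₁ 1 = s₂ at h2
  have hp2 : Primitive s₂.1 := fun a ha => hp1 a (ha.trans h2.dvd)
  -- The second removal replaces the polynomial by a divisor of it, so the first content stays
  -- trivial.
  have hcont : ∀ i : Fin 2, ∀ g, MvPolynomial.rename i.succAbove g ∣ s₂.1 → IsUnit g := by
    intro i g hg
    fin_cases i
    · exact h1.isUnit_of_dvd g (hg.trans h2.dvd)
    · exact h2.isUnit_of_dvd g hg
  have hX1 : ¬ MvPolynomial.X 1 ∣ s₂.1 := by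
    intro h
    refine MvPolynomial.X_prime.not_isUnit (hcont 0 (MvPolynomial.X 0) ?_)
    rwa [MvPolynomial.rename_X]
  have hX : ∀ j, ¬ MvPolynomial.X j ∣ s₂.1 := by
    intro j
    fin_cases j
    · intro h
      refine MvPolynomial.X_prime.not_isUnit (hcont 1 (MvPolynomial.X 0) ?_)
      rwa [MvPolynomial.rename_X]
    · exact hX1
  have hr2 : IsUnit s₂.2.rest := h2.rest (h1.rest isUnit_one)
  have hvalue : toLaurent p = s₂.2.value * toLaurent s₂.1 := by
    rw [← h2.value, ← h1.value, hp, map_mul, toLaurent_C]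
    simp [Decomp.value, hs₀, mono_zero]
  obtain ⟨T1, e1, g1, d1⟩ := h1.types
  obtain ⟨T2, e2, g2, d2⟩ := h2.types
  have e12 : s₂.2.types = T1 ++ T2 := by rw [e2, e1]; rfl
  have gT : ∀ t ∈ s₂.2.types, QPrimitive t.2 ∧ 0 < t.2.natDegree ∧ Normalized t.1 ∧
      ∃ i, t.1 i = 0 := by
    intro t ht
    rw [e12] at ht
    rcases List.mem_append.1 ht with ht | ht
    · obtain ⟨a, b, c, d⟩ := g1 t ht; exact ⟨a, b, c, _, d⟩
    · obtain ⟨a, b, c, d⟩ := g2 t ht; exact ⟨a, b, c, _, d⟩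
  have dT : (s₂.2.types.map Prod.fst).Nodup := by
    rw [e12, List.map_append]
    -- A vector in both lists would vanish in both coordinates.
    refine d1.append d2 fun v hv1 hv2 => ?_
    obtain ⟨t1, ht1, rfl⟩ := List.mem_map.1 hv1
    obtain ⟨t2, ht2, h12⟩ := List.mem_map.1 hv2
    have z0 := (g1 t1 ht1).2.2.2
    have z1 := (g2 t2 ht2).2.2.2
    rw [h12] at z1
    apply (g1 t1 ht1).2.2.1.ne_zero
    ext i
    fin_cases i
    · exact z0
    · exact z1
  clear h1 h2 e1 e2 e12 g1 g2 d1 d2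
  rw [extractTypes]
  split_ifs with hdeg
  · have hC := MvPolynomial.totalDegree_eq_zero_iff_eq_C.1 hdeg
    refine ⟨?_, mem_nonlinear_toLaurent_of_isUnit hr2, not_X_dvd_of_isUnit hr2,
      fun t ht => (gT t ht).1, fun t ht => (gT t ht).2.1, fun t ht => (gT t ht).2.2.1, dT⟩
    rw [hvalue, hC, toLaurent_C]
    simp only [Decomp.value, map_mul, MvPolynomial.coeff_zero_C]
    ring
  · have hf0 : s₂.1 ≠ 0 := fun h0 => hdeg (by rw [h0]; simp)
    have hfin := finite_candidates ch hf0
    have hl : ∀ v ∈ ch.enum (candidates ch s₂.1), Normalized v ∧ ∀ i, v i ≠ 0 := by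
      intro v hv
      obtain ⟨h0, e, -, e', -, hd⟩ := candidates_subset ch hf0 ((ch.mem_enum _ hfin v).1 hv)
      exact ⟨hd.2.2, h0⟩
    have h3 := foldl_testCandidate_spec ch (ch.enum (candidates ch s₂.1))
      (fun v hv => ⟨(hl v hv).1, (hl v hv).2 1⟩) hp2 hX1
    dsimp only
    generalize (ch.enum (candidates ch s₂.1)).foldl (testCandidate ch) s₂ = s₃ at h3
    have hNL : NoLinearDivisor (toLaurent s₃.1) :=
      noLinearDivisor_of_candidates ch hp2 hcont h3.dvd fun v hv =>
        h3.isUnit_of_dvd v ((ch.mem_enum _ hfin v).2 hv)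
    have hX3 : ∀ j, ¬ MvPolynomial.X j ∣ s₃.1 := fun j h => hX j (h.trans h3.dvd)
    have hr3 : IsUnit s₃.2.rest := h3.rest ▸ hr2
    obtain ⟨T, e3, g3, d3⟩ := h3.types
    have gT3 : ∀ t ∈ s₃.2.types, QPrimitive t.2 ∧ 0 < t.2.natDegree ∧ Normalized t.1 := by
      intro t ht
      rw [e3] at ht
      rcases List.mem_append.1 ht with ht | ht
      · exact ⟨(gT t ht).1, (gT t ht).2.1, (gT t ht).2.2.1⟩
      · exact ⟨(g3 t ht).1, (g3 t ht).2, (hl t.1 (d3.subset (List.mem_map_of_mem ht))).1⟩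
    have dT3 : (s₃.2.types.map Prod.fst).Nodup := by
      rw [e3, List.map_append]
      -- Types found in the contents have a zero coordinate, candidates have none.
      refine dT.append (d3.nodup (ch.enum_nodup _ hfin)) fun v hv1 hv2 => ?_
      obtain ⟨t1, ht1, rfl⟩ := List.mem_map.1 hv1
      obtain ⟨i, hi⟩ := (gT t1 ht1).2.2.2
      exact (hl t1.1 (d3.subset hv2)).2 i hi
    split_ifs with hdeg3
    · refine ⟨?_, ?_, ?_, fun t ht => (gT3 t ht).1, fun t ht => (gT3 t ht).2.1,
        fun t ht => (gT3 t ht).2.2, dT3⟩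
      · rw [hvalue, h3.value]
        simp only [Decomp.value, map_mul]
        ring
      · rw [map_mul]
        exact mul_mem (mem_nonlinear_toLaurent_of_isUnit hr3) (mem_nonlinear hNL)
      · intro j hj
        rcases MvPolynomial.X_dvd_mul_iff.1 hj with h | h
        · exact not_X_dvd_of_isUnit hr3 j h
        · exact hX3 j h
    · have hC := MvPolynomial.totalDegree_eq_zero_iff_eq_C.1 (Nat.eq_zero_of_not_pos hdeg3)
      refine ⟨?_, mem_nonlinear_toLaurent_of_isUnit hr3, not_X_dvd_of_isUnit hr3,
        fun t ht => (gT3 t ht).1, fun t ht => (gT3 t ht).2.1, fun t ht => (gT3 t ht).2.2, dT3⟩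
      rw [hvalue, h3.value, hC, toLaurent_C]
      simp only [Decomp.value, map_mul, MvPolynomial.coeff_zero_C]
      ring

end Candidates

/-! ### Split embeddings of exponent lattices -/

section ExpMap

variable {A : Type u} [CommRing A] {m n : ℕ}

theorem coeff_expMap {ι : (Fin m → ℤ) →+ (Fin n → ℤ)} (hι : Function.Injective ι)
    (F : Laurent m A) (u : Fin m → ℤ) : (expMap A ι F).coeff (ι u) = F.coeff u := by
  classical
  induction F using AddMonoidAlgebra.induction_linear with
  | zero => simp
  | add F G hF hG => simp only [map_add, AddMonoidAlgebra.coeff_add, Finsupp.add_apply, hF, hG]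
  | single u' a =>
    rw [expMap_single, AddMonoidAlgebra.coeff_single, AddMonoidAlgebra.coeff_single,
      Finsupp.single_apply, Finsupp.single_apply]
    simp only [hι.eq_iff]

theorem expMap_leftInverse {ι : (Fin m → ℤ) →+ (Fin n → ℤ)} {ρ : (Fin n → ℤ) →+ (Fin m → ℤ)}
    (h : ∀ u, ρ (ι u) = u) (F : Laurent m A) : expMap A ρ (expMap A ι F) = F := by
  induction F using AddMonoidAlgebra.induction_linear with
  | zero => simp
  | add F G hF hG => simp only [map_add, hF, hG]
  | single u a => rw [expMap_single, expMap_single, h]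

/-- A split embedding of exponent lattices creates no integer-linear divisors. -/
theorem NoLinearDivisor.expMap [IsDomain A] {ι : (Fin (m + 1) → ℤ) →+ (Fin n → ℤ)}
    {ρ : (Fin n → ℤ) →+ (Fin (m + 1) → ℤ)} (h : ∀ u, ρ (ι u) = u) {F : Laurent (m + 1) A}
    (hF : NoLinearDivisor F) : NoLinearDivisor (expMap A ι F) := by
  intro v P hd
  -- Every left inverse of `ι` carries a divisor of the image to a divisor of `F` itself.
  have key : ∀ ρ' : (Fin n → ℤ) →+ (Fin (m + 1) → ℤ), (∀ u, ρ' (ι u) = u) →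
      IsUnit (evalMono (ρ' v) P) := by
    intro ρ' h'
    apply hF
    have := map_dvd (QILD.expMap A ρ') hd
    rwa [expMap_leftInverse h', expMap_evalMono] at this
  by_cases hv : v = 0
  · subst hv
    have h0 := key ρ h
    have := h0.map (QILD.expMap A ι)
    rwa [map_zero, expMap_evalMono, map_zero] at this
  · obtain ⟨ρ', h', hne⟩ : ∃ ρ' : (Fin n → ℤ) →+ (Fin (m + 1) → ℤ),
        (∀ u, ρ' (ι u) = u) ∧ ρ' v ≠ 0 := by
      by_cases hρ : ρ v = 0
      · obtain ⟨j, hj⟩ := Function.ne_iff.1 hv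
        -- The map `u ↦ u - ι (ρ u)` vanishes on the image of `ι` and fixes `v` when `ρ v = 0`.
        -- Adding its `j`-th coordinate to an entry of `ρ` gives a left inverse that does not kill
        -- `v`; rank `m + 1` provides an entry to add it to.
        refine ⟨ρ + { toFun := fun u => Pi.single 0 ((u - ι (ρ u)) j)
                      map_zero' := by simp
                      map_add' := fun a b => by
                        rw [← Pi.single_add]
                        congr 1
                        simp only [map_add, Pi.sub_apply, Pi.add_apply]
                        ring }, fun u => ?_, fun h0 => hj ?_⟩
        · simp [h]
        · have := congrFun h0 0
          simpa [hρ] using this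
      · exact ⟨ρ, h, hρ⟩
    obtain ⟨a, i, ha, rfl⟩ := eq_C_mul_X_pow_of_isUnit hne (key ρ' h')
    exact isUnit_evalMono_of_monomial v ha i

theorem expMap_mem_nonlinear [IsDomain A] {ι : (Fin (m + 1) → ℤ) →+ (Fin n → ℤ)}
    {ρ : (Fin n → ℤ) →+ (Fin (m + 1) → ℤ)} (h : ∀ u, ρ (ι u) = u) {F : Laurent (m + 1) A}
    (hF : F ∈ nonlinear (m + 1) A) : expMap A ι F ∈ nonlinear n A := by
  induction hF using Submonoid.closure_induction with
  | mem F hF => exact mem_nonlinear (hF.expMap h)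
  | one => rw [map_one]; exact one_mem _
  | mul F G _ _ h1 h2 => rw [map_mul]; exact mul_mem h1 h2

end ExpMap

/-! ### Moving variables between coefficients and polynomials -/

section Flatten

variable {A : Type u} [CommRing A] {m : ℕ}

/-- Polynomials in two variables over a polynomial ring, as polynomials in all variables. -/
def flatten : MvPolynomial (Fin 2) (MvPolynomial (Fin m) A) →+* MvPolynomial (Fin (m + 2)) A :=
  MvPolynomial.eval₂Hom (MvPolynomial.rename (fun j : Fin m => j.succ.succ) :
    MvPolynomial (Fin m) A →ₐ[A] MvPolynomial (Fin (m + 2)) A) ![MvPolynomial.X 0, MvPolynomial.X 1]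

theorem flatten_C (b : MvPolynomial (Fin m) A) :
    flatten (MvPolynomial.C b) = MvPolynomial.rename (fun j : Fin m => j.succ.succ) b :=
  MvPolynomial.eval₂Hom_C _ _ _

theorem flatten_X (i : Fin 2) : flatten (MvPolynomial.X i : MvPolynomial (Fin 2)
    (MvPolynomial (Fin m) A)) = (![MvPolynomial.X 0, MvPolynomial.X 1] : Fin 2 → _) i :=
  MvPolynomial.eval₂Hom_X' _ _ _

theorem viewPair_X_zero : viewPair (MvPolynomial.X (0 : Fin (m + 2)) : MvPolynomial _ A) =
    MvPolynomial.X 0 := by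
  rw [viewPair, MvPolynomial.aeval_X, Fin.cons_zero]

theorem viewPair_X_one : viewPair (MvPolynomial.X (1 : Fin (m + 2)) : MvPolynomial _ A) =
    MvPolynomial.X 1 := by
  rw [viewPair, MvPolynomial.aeval_X, show (1 : Fin (m + 2)) = Fin.succ 0 from rfl, Fin.cons_succ,
    Fin.cons_zero]

theorem viewPair_X_succ (j : Fin m) :
    viewPair (MvPolynomial.X j.succ.succ : MvPolynomial (Fin (m + 2)) A) =
      MvPolynomial.C (MvPolynomial.X j) := by
  rw [viewPair, MvPolynomial.aeval_X, Fin.cons_succ, Fin.cons_succ]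

theorem viewPair_C (a : A) : viewPair (MvPolynomial.C a : MvPolynomial (Fin (m + 2)) A) =
    MvPolynomial.C (MvPolynomial.C a) := by
  rw [viewPair, MvPolynomial.aeval_C]; rfl

theorem viewPair_rename (b : MvPolynomial (Fin m) A) :
    viewPair (MvPolynomial.rename (fun j : Fin m => j.succ.succ) b) = MvPolynomial.C b := by
  have : ((viewPair (A := A) (n := m)).comp
      (MvPolynomial.rename (fun j : Fin m => j.succ.succ))) =
      IsScalarTower.toAlgHom A (MvPolynomial (Fin m) A)
        (MvPolynomial (Fin 2) (MvPolynomial (Fin m) A)) := by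
    apply MvPolynomial.algHom_ext
    intro j
    rw [AlgHom.comp_apply, MvPolynomial.rename_X, viewPair_X_succ]
    rfl
  exact DFunLike.congr_fun this b

theorem viewPair_flatten (g : MvPolynomial (Fin 2) (MvPolynomial (Fin m) A)) :
    viewPair (flatten g) = g := by
  have : (viewPair (A := A) (n := m)).toRingHom.comp flatten = RingHom.id _ := by
    apply MvPolynomial.ringHom_ext
    · intro b
      rw [RingHom.comp_apply, flatten_C]
      exact viewPair_rename b
    · intro i
      rw [RingHom.comp_apply, flatten_X]
      fin_cases i
      · exact viewPair_X_zero
      · exact viewPair_X_one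
  exact DFunLike.congr_fun this g

theorem flatten_viewPair (f : MvPolynomial (Fin (m + 2)) A) : flatten (viewPair f) = f := by
  have : flatten.comp (viewPair (A := A) (n := m)).toRingHom = RingHom.id _ := by
    apply MvPolynomial.ringHom_ext
    · intro a
      rw [RingHom.comp_apply]
      refine (congrArg flatten (viewPair_C a)).trans ?_
      rw [flatten_C, MvPolynomial.rename_C]; rfl
    · intro j
      rw [RingHom.comp_apply]
      refine Fin.cases ?_ (fun j => Fin.cases ?_ (fun j => ?_) j) j
      · refine (congrArg flatten viewPair_X_zero).trans ?_
        rw [flatten_X]; rfl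
      · refine (congrArg flatten viewPair_X_one).trans ?_
        rw [flatten_X]; rfl
      · refine (congrArg flatten (viewPair_X_succ j)).trans ?_
        rw [flatten_C, MvPolynomial.rename_X]; rfl
  exact DFunLike.congr_fun this f

theorem viewPair_monomial (e : Fin (m + 2) →₀ ℕ) (a : A) :
    viewPair (MvPolynomial.monomial e a) =
      MvPolynomial.monomial (Finsupp.equivFunOnFinite.symm ![e 0, e 1])
        (MvPolynomial.monomial (Finsupp.equivFunOnFinite.symm fun j => e j.succ.succ) a) := by
  rw [viewPair, MvPolynomial.aeval_monomial, Finsupp.prod_fintype _ _ (by simp),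
    Fin.prod_univ_succ, Fin.prod_univ_succ, MvPolynomial.monomial_eq, MvPolynomial.monomial_eq,
    Finsupp.prod_fintype _ _ (by simp), Finsupp.prod_fintype _ _ (by simp), Fin.prod_univ_two]
  simp only [Fin.cons_zero, Fin.cons_succ, ← MvPolynomial.C_pow, ← map_prod,
    MvPolynomial.C_mul, Finsupp.equivFunOnFinite_symm_apply_apply, Matrix.cons_val_zero,
    Matrix.cons_val_one]
  have : algebraMap A (MvPolynomial (Fin 2) (MvPolynomial (Fin m) A)) a =
    MvPolynomial.C (MvPolynomial.C a) := rfl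
  rw [this]
  have h1 : Fin.succ (0 : Fin (m + 1)) = 1 := rfl
  rw [h1]
  ring

/-- The exponent vector in all variables with the given first two entries. -/
def padPair : (Fin 2 → ℤ) →+ (Fin (m + 2) → ℤ) where
  toFun u := u 0 • Pi.single 0 1 + u 1 • Pi.single 1 1
  map_zero' := by simp
  map_add' a b := by simp only [Pi.add_apply, add_smul]; abel

/-- The extension of `flatten` to Laurent polynomials. -/
def flattenHom (A : Type u) [CommRing A] (m : ℕ) :
    Laurent 2 (MvPolynomial (Fin m) A) →+* Laurent (m + 2) A :=
  monoidLift ((toLaurent (A := A) (n := m + 2)).toRingHom.comp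
      (MvPolynomial.rename (R := A) (fun j : Fin m => j.succ.succ)).toRingHom)
    { toFun := fun u => mono A (padPair u.toAdd)
      map_one' := by rw [toAdd_one, map_zero, mono_zero]
      map_mul' := fun a b => by rw [toAdd_mul, map_add, mono_add] }

theorem flattenHom_single (u : Fin 2 → ℤ) (b : MvPolynomial (Fin m) A) :
    flattenHom A m (AddMonoidAlgebra.single u b) =
      toLaurent (MvPolynomial.rename (fun j : Fin m => j.succ.succ) b) * mono A (padPair u) :=
  monoidLift_single _ _ _ _

theorem flattenHom_mono (u : Fin 2 → ℤ) :
    flattenHom A m (mono _ u) = mono A (padPair u) := by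
  rw [mono, flattenHom_single, map_one, map_one, one_mul]

theorem flattenHom_toLaurent (g : MvPolynomial (Fin 2) (MvPolynomial (Fin m) A)) :
    flattenHom A m (toLaurent g) = toLaurent (flatten g) := by
  have : (flattenHom A m).comp (toLaurent (A := MvPolynomial (Fin m) A) (n := 2)).toRingHom =
      (toLaurent (A := A) (n := m + 2)).toRingHom.comp flatten := by
    apply MvPolynomial.ringHom_ext
    · intro b
      rw [RingHom.comp_apply, RingHom.comp_apply, flatten_C]
      refine (congrArg (flattenHom A m) (toLaurent_C b)).trans ?_
      rw [algebraMap_eq_single, flattenHom_single, map_zero, mono_zero, mul_one]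
      rfl
    · intro i
      rw [RingHom.comp_apply, RingHom.comp_apply, flatten_X]
      refine (congrArg (flattenHom A m) (toLaurent_X i)).trans ?_
      rw [var, flattenHom_mono]
      fin_cases i
      · refine Eq.trans ?_ (toLaurent_X 0).symm
        simp [padPair, var]
      · refine Eq.trans ?_ (toLaurent_X 1).symm
        simp [padPair, var]
  exact DFunLike.congr_fun this g

/-- The exponents of `r` are `β + i • v`, without collisions since `v ≠ 0`. Their first two entries
again form such a progression; the others are nonnegative because `r` is a polynomial, and go into
the coefficients. -/
theorem exists_viewPair_eq [IsDomain A] {v : Fin (m + 2) → ℤ} (hv : v ≠ 0) {P : Polynomial A}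
    {β : Fin (m + 2) → ℤ} {r : MvPolynomial (Fin (m + 2)) A}
    (hr : toLaurent r = mono A β * evalMono v P) :
    ∃ (β' a : Fin 2 → ℤ) (P' : Polynomial (MvPolynomial (Fin m) A)),
      toLaurent (viewPair r) = mono _ β' * evalMono a P' := by
  have hex : ∀ i : ℕ, ∃ e : Fin (m + 2) →₀ ℕ, i ∈ P.support → intVec e = β + i • v := by
    intro i
    by_cases hi : i ∈ P.support
    · have hc : (toLaurent r).coeff (β + i • v) ≠ 0 := by
        rw [hr, coeff_mono_mul, add_sub_cancel_left, coeff_evalMono hv]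
        exact Polynomial.mem_support_iff.1 hi
      obtain ⟨e, -, he⟩ := exists_of_coeff_toLaurent_ne_zero r _ hc
      exact ⟨e, fun _ => he⟩
    · exact ⟨0, fun h => absurd h hi⟩
  choose e he using hex
  have hrsum : r = ∑ i ∈ P.support, MvPolynomial.monomial (e i) (P.coeff i) := by
    apply toLaurent_injective
    rw [hr, evalMono_eq_sum, Polynomial.sum, Finset.mul_sum, map_sum]
    refine Finset.sum_congr rfl fun i hi => ?_
    rw [toLaurent_monomial, he i hi, mono, AddMonoidAlgebra.single_mul_single, one_mul]
  refine ⟨![β 0, β 1], ![v 0, v 1], ∑ i ∈ P.support, Polynomial.monomial i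
    (MvPolynomial.monomial (Finsupp.equivFunOnFinite.symm fun j => e i j.succ.succ)
      (P.coeff i)), ?_⟩
  rw [hrsum, map_sum, map_sum, evalMono, map_sum, Finset.mul_sum]
  refine Finset.sum_congr rfl fun i hi => ?_
  rw [viewPair_monomial, toLaurent_monomial, Polynomial.aeval_monomial, ← mono_nsmul,
    mul_left_comm, ← mono_add, single_eq_algebraMap_mul]
  congr 2
  have h := he i hi
  ext l
  fin_cases l
  · have := congrFun h 0
    simpa [intVec] using this
  · have := congrFun h 1
    simpa [intVec] using this

/-- Over the larger coefficient ring a divisor `P(x ^ v)` still has this form up to a monomial, so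
it is a unit there by hypothesis; flattening preserves units. For `v = 0` it is a constant. -/
theorem noLinearDivisor_flatten [IsDomain A] {f : MvPolynomial (Fin 2) (MvPolynomial (Fin m) A)}
    (hf : NoLinearDivisor (toLaurent f)) : NoLinearDivisor (toLaurent (flatten f)) := by
  intro v P hd
  by_cases hv : v = 0
  · subst hv
    rw [evalMono_zero_left] at hd ⊢
    have h1 := C_dvd_of_algebraMap_dvd hd
    have h2 : MvPolynomial.C (MvPolynomial.C (P.eval 1)) ∣ f := by
      have := map_dvd (viewPair (A := A) (n := m)) h1
      rwa [viewPair_flatten, viewPair_C] at this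
    have h3 := map_dvd (toLaurent (A := MvPolynomial (Fin m) A) (n := 2)) h2
    rw [toLaurent_C, ← evalMono_C 0] at h3
    have h4 := (hf 0 _ h3).map (flattenHom A m)
    rw [evalMono_C, ← toLaurent_C, flattenHom_toLaurent, flatten_C, MvPolynomial.rename_C,
      toLaurent_C] at h4
    exact h4
  -- The numerator of `P(x ^ v)` divides only up to a monomial; `r` is the part of it that divides
  -- the polynomial itself.
  · obtain ⟨e, he⟩ := exists_toLaurent_eq_mul_of_dvd hd
    obtain ⟨e', r, -, hr, hnum⟩ := MvPolynomial.dvd_monomial_mul_iff_exists.1 he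
    have hrL : toLaurent r = mono A ((fun i => (den (evalMono v P) i : ℤ)) + -intVec e') *
        evalMono v P := by
      have := congrArg toLaurent hnum
      rw [toLaurent_num, map_mul, toLaurent_monomial, ← mono] at this
      rw [mono_add, mul_right_comm, this, mul_right_comm, ← mono_add, add_neg_cancel, mono_zero,
        one_mul]
    obtain ⟨β', a, P', hP'⟩ := exists_viewPair_eq hv hrL
    have h1 : toLaurent (viewPair r) ∣ toLaurent f := by
      have := map_dvd (toLaurent (A := MvPolynomial (Fin m) A) (n := 2))
        (map_dvd (viewPair (A := A) (n := m)) hr)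
      rwa [viewPair_flatten] at this
    have h2 := hf a P' ((hP' ▸ dvd_mul_left _ _ : evalMono a P' ∣ _).trans h1)
    have h3 : IsUnit (toLaurent (viewPair r)) := hP' ▸ (isUnit_mono _).mul h2
    have h4 := h3.map (flattenHom A m)
    rw [flattenHom_toLaurent, flatten_viewPair, hrL] at h4
    exact isUnit_of_mul_isUnit_right h4

theorem flattenHom_mem_nonlinear [IsDomain A] {F : Laurent 2 (MvPolynomial (Fin m) A)}
    (hF : F ∈ nonlinear 2 (MvPolynomial (Fin m) A)) : flattenHom A m F ∈ nonlinear (m + 2) A := by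
  induction hF using Submonoid.closure_induction with
  | mem F hF =>
    have h1 : NoLinearDivisor (toLaurent (num F)) :=
      NoLinearDivisor.of_dvd hF (by rw [toLaurent_num, (isUnit_mono _).mul_left_dvd])
    have h2 := noLinearDivisor_flatten h1
    rw [← flattenHom_toLaurent, toLaurent_num, map_mul, flattenHom_mono] at h2
    exact mem_nonlinear (h2.of_dvd (dvd_mul_left _ _))
  | one => rw [map_one]; exact one_mem _
  | mul F G _ _ h1 h2 => rw [map_mul]; exact mul_mem h1 h2

/-- The first two variables are excluded by `hX`; the others are constants of the coefficient ring,
excluded by primitivity. -/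
theorem not_X_dvd_flatten [IsDomain A] {f : MvPolynomial (Fin 2) (MvPolynomial (Fin m) A)}
    (hf : Primitive f) (hX : ∀ j, ¬ MvPolynomial.X j ∣ f) (j : Fin (m + 2)) :
    ¬ MvPolynomial.X j ∣ flatten f := by
  intro h
  have h' := map_dvd (viewPair (A := A) (n := m)) h
  rw [viewPair_flatten] at h'
  revert h'
  refine Fin.cases ?_ (fun j => Fin.cases ?_ (fun j => ?_) j) j
  · rw [viewPair_X_zero]; exact hX 0
  · rw [show (Fin.succ 0 : Fin (m + 2)) = 1 from rfl, viewPair_X_one]; exact hX 1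
  · rw [viewPair_X_succ]
    exact fun h => MvPolynomial.X_prime.not_isUnit (hf _ h)

end Flatten

/-! ### The substitution `y = x ^ μ` -/

section Emb

variable {A : Type u} [CommRing A] {N : ℕ}

/-- The exponents of a polynomial in `y` and the last `m` of `N` variables after the substitution
`y = x ^ μ`. -/
def emb (m : ℕ) (μ : Fin N → ℤ) : (Fin (m + 1) → ℤ) →+ (Fin N → ℤ) where
  toFun u i := u 0 * μ i + if h : N - m ≤ i then u ⟨i - (N - m) + 1, by omega⟩ else 0
  map_zero' := by ext i; simp
  map_add' a b := by
    ext i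
    simp only [Pi.add_apply]
    split_ifs <;> ring

theorem emb_apply (m : ℕ) (μ : Fin N → ℤ) (u : Fin (m + 1) → ℤ) (i : Fin N) :
    emb m μ u i = u 0 * μ i + if h : N - m ≤ i then u ⟨i - (N - m) + 1, by omega⟩ else 0 := rfl

theorem emb_single_zero (m : ℕ) (μ : Fin N → ℤ) : emb m μ (Pi.single 0 1) = μ := by
  ext i
  rw [emb_apply, Pi.single_eq_same, one_mul]
  split_ifs
  · rw [Pi.single_eq_of_ne (by simp [Fin.ext_iff]), add_zero]
  · rw [add_zero]

theorem emb_single_succ {m : ℕ} (hm : m ≤ N) (μ : Fin N → ℤ) (j : Fin m) :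
    emb m μ (Pi.single j.succ 1) = Pi.single ⟨N - m + j, by omega⟩ 1 := by
  ext i
  rw [emb_apply, Pi.single_eq_of_ne (Fin.succ_ne_zero j).symm, zero_mul, zero_add]
  simp only [Pi.single_apply, Fin.ext_iff, Fin.val_succ]
  split_ifs <;> omega

/-- Bézout coefficients of `μ` recover the exponent of `y` from the first `N - m` coordinates. The
last `m` coordinates are the other entries of `u`, undisturbed because `μ` vanishes there. -/
theorem exists_leftInverse_emb {m : ℕ} {μ : Fin N → ℤ} (hm : m ≤ N) (hμ : Normalized μ)
    (hsupp : ∀ i : Fin N, N - m ≤ i → μ i = 0) :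
    ∃ ρ : (Fin N → ℤ) →+ (Fin (m + 1) → ℤ), ∀ u, ρ (emb m μ u) = u := by
  obtain ⟨w, hw⟩ : ∃ w : Fin N → ℤ, ∑ i, w i * μ i = 1 := by
    obtain ⟨g, hg⟩ := IsPrincipalIdealRing.principal (Ideal.span (Set.range μ))
    have hu : IsUnit g := gcd_eq_one_iff.1 hμ.1 g fun i => by
      rw [← Ideal.mem_span_singleton]
      have : μ i ∈ Ideal.span (Set.range μ) := Ideal.subset_span ⟨i, rfl⟩
      rwa [hg] at this
    have h1 : (1 : ℤ) ∈ Ideal.span (Set.range μ) := by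
      have := Ideal.eq_top_of_isUnit_mem (Ideal.span (Set.range μ))
        (by rw [hg]; exact Submodule.mem_span_singleton_self g) hu
      rw [this]; trivial
    exact Ideal.mem_span_range_iff_exists_fun.1 h1
  refine ⟨{ toFun := fun u => Fin.cons (α := fun _ => ℤ)
              (∑ i : Fin N, if N - m ≤ i then 0 else w i * u i) fun j => u ⟨N - m + j, by omega⟩
            map_zero' := ?_
            map_add' := ?_ }, fun u => ?_⟩
  · ext j
    refine Fin.cases ?_ (fun j => ?_) j <;> simp
  · intro a b
    ext j
    refine Fin.cases ?_ (fun j => ?_) j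
    · simp only [Fin.cons_zero, Pi.add_apply, ← Finset.sum_add_distrib]
      refine Finset.sum_congr rfl fun i _ => ?_
      split_ifs <;> ring
    · simp
  · ext j
    refine Fin.cases ?_ (fun j => ?_) j
    · simp only [AddMonoidHom.coe_mk, ZeroHom.coe_mk, Fin.cons_zero]
      rw [← one_mul (u 0), ← hw, Finset.sum_mul]
      refine Finset.sum_congr rfl fun i _ => ?_
      split_ifs with h
      · rw [hsupp i h]; ring
      · rw [emb_apply, dif_neg h]; ring
    · simp only [AddMonoidHom.coe_mk, ZeroHom.coe_mk, Fin.cons_succ]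
      rw [emb_apply, dif_pos (by simp), hsupp _ (by simp), mul_zero, zero_add]
      congr 1
      ext
      simp

theorem expMap_emb_X_zero (m : ℕ) (μ : Fin N → ℤ) :
    expMap A (emb m μ) (toLaurent (MvPolynomial.X 0)) = mono A μ := by
  rw [toLaurent_X, var, expMap_mono, emb_single_zero]

theorem expMap_emb_X_succ {m : ℕ} (hm : m ≤ N) (μ : Fin N → ℤ) (j : Fin m) :
    expMap A (emb m μ) (toLaurent (MvPolynomial.X j.succ)) = var A ⟨N - m + j, by omega⟩ := by
  rw [toLaurent_X, var, expMap_mono, emb_single_succ hm, var]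

/-- This reduces the evaluation in `pairStep` to the two operations that preserve `nonlinear`. -/
theorem eval₂_eq_expMap_flatten {m : ℕ} (hm : m + 1 < N) (μ : Fin N → ℤ)
    (g : MvPolynomial (Fin 2) (MvPolynomial (Fin m) A)) :
    MvPolynomial.eval₂ ((MvPolynomial.aeval fun j : Fin m => var A (⟨N - m + j, by omega⟩ : Fin N) :
      MvPolynomial (Fin m) A →ₐ[A] Laurent N A) : MvPolynomial (Fin m) A →+* Laurent N A)
      ![mono A μ, var A ⟨N - (m + 1), by omega⟩] g =
    expMap A (emb (m + 1) μ) (toLaurent (flatten g)) := by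
  have key : (MvPolynomial.aeval fun j : Fin m => var A (⟨N - m + j, by omega⟩ : Fin N) :
      MvPolynomial (Fin m) A →ₐ[A] Laurent N A) = ((expMap A (emb (m + 1) μ)).comp toLaurent).comp
        (MvPolynomial.rename fun j : Fin m => j.succ.succ) := by
    apply MvPolynomial.algHom_ext
    intro j
    rw [MvPolynomial.aeval_X, AlgHom.comp_apply, AlgHom.comp_apply, MvPolynomial.rename_X,
      expMap_emb_X_succ (by omega)]
    congr 1
    ext
    simp only [Fin.val_succ]
    omega
  induction g using MvPolynomial.induction_on with
  | C b =>
    rw [MvPolynomial.eval₂_C, flatten_C, key]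
    rfl
  | add p q hp hq => rw [MvPolynomial.eval₂_add, hp, hq, map_add, map_add, map_add]
  | mul_X p i hp =>
    rw [MvPolynomial.eval₂_mul, hp, map_mul, map_mul, map_mul, MvPolynomial.eval₂_X, flatten_X]
    congr 1
    fin_cases i
    · exact (expMap_emb_X_zero _ _).symm
    · exact (expMap_emb_X_succ (by omega) μ (0 : Fin (m + 1))).symm

theorem emb_padPair {m : ℕ} (hm : m + 1 < N) (μ : Fin N → ℤ) (v : Fin 2 → ℤ) :
    emb (m + 1) μ (padPair v) = v 0 • μ + Pi.single ⟨N - (m + 1), by omega⟩ (v 1) := by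
  have h : emb (m + 1) μ (Pi.single 1 1) = Pi.single ⟨N - (m + 1), by omega⟩ 1 :=
    emb_single_succ (by omega) μ (0 : Fin (m + 1))
  change emb (m + 1) μ (v 0 • Pi.single 0 1 + v 1 • Pi.single 1 1) = _
  rw [map_add, map_zsmul, map_zsmul, emb_single_zero, h, ← Pi.single_smul, smul_eq_mul, mul_one]

theorem expMap_flattenHom_mono {m : ℕ} (hm : m + 1 < N) (μ : Fin N → ℤ) (v : Fin 2 → ℤ) :
    expMap A (emb (m + 1) μ) (flattenHom A m (mono _ v)) =
      mono A (v 0 • μ + Pi.single ⟨N - (m + 1), by omega⟩ (v 1)) := by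
  rw [flattenHom_mono, expMap_mono, emb_padPair hm]

theorem finSuccEquiv_rename_succ (m : ℕ) (b : MvPolynomial (Fin m) A) :
    MvPolynomial.finSuccEquiv A m (MvPolynomial.rename Fin.succ b) = Polynomial.C b := by
  have : ((MvPolynomial.finSuccEquiv A m : MvPolynomial (Fin (m + 1)) A →ₐ[A] _).comp
      (MvPolynomial.rename Fin.succ)) = IsScalarTower.toAlgHom A (MvPolynomial (Fin m) A)
        (Polynomial (MvPolynomial (Fin m) A)) := by
    apply MvPolynomial.algHom_ext
    intro j
    rw [AlgHom.comp_apply, MvPolynomial.rename_X]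
    exact MvPolynomial.finSuccEquiv_X_succ
  exact DFunLike.congr_fun this b

/-- Setting `y = x ^ μ` turns `y ^ v 0` times the `v 1`-th power of the next variable into `x ^ μ'`
with the new vector `μ'`, so a bivariate factor becomes a piece of the next level with `μ'` in place
of `μ`. -/
theorem expMap_flattenHom_evalMono {m : ℕ} (hm : m + 1 < N) (μ : Fin N → ℤ) (v : Fin 2 → ℤ)
    (P : Polynomial (MvPolynomial (Fin m) A)) :
    expMap A (emb (m + 1) μ) (flattenHom A m (evalMono v P)) =
      expMap A (emb m (v 0 • μ + Pi.single ⟨N - (m + 1), by omega⟩ (v 1)))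
        (toLaurent ((MvPolynomial.finSuccEquiv A m).symm P)) := by
  set w := v 0 • μ + Pi.single (⟨N - (m + 1), by omega⟩ : Fin N) (v 1) with hw
  have key : ((expMap A (emb (m + 1) μ)).comp toLaurent).comp
        (MvPolynomial.rename fun j : Fin m => j.succ.succ) =
      ((expMap A (emb m w)).comp toLaurent).comp (MvPolynomial.rename Fin.succ) := by
    apply MvPolynomial.algHom_ext
    intro j
    simp only [AlgHom.comp_apply, MvPolynomial.rename_X]
    rw [expMap_emb_X_succ (by omega), expMap_emb_X_succ (by omega)]
    congr 1
    ext
    simp only [Fin.val_succ]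
    omega
  induction P using Polynomial.induction_on' with
  | add p q hp hq => rw [evalMono, map_add, map_add, map_add, ← evalMono, ← evalMono, hp, hq,
      map_add, map_add, map_add]
  | monomial i b =>
    have hX : (MvPolynomial.finSuccEquiv A m).symm Polynomial.X = MvPolynomial.X 0 := by
      rw [AlgEquiv.symm_apply_eq, MvPolynomial.finSuccEquiv_X_zero]
    have hC : (MvPolynomial.finSuccEquiv A m).symm (Polynomial.C b) =
        MvPolynomial.rename Fin.succ b := by
      rw [AlgEquiv.symm_apply_eq, finSuccEquiv_rename_succ]
    rw [← Polynomial.C_mul_X_pow_eq_monomial, evalMono_mul, evalMono_C, evalMono, map_pow,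
      Polynomial.aeval_X, map_mul, map_mul, map_pow, map_pow, expMap_flattenHom_mono hm, ← hw,
      map_mul, map_pow, hX, hC, map_mul, map_pow, map_mul, map_pow, expMap_emb_X_zero,
      ← toLaurent_C, flattenHom_toLaurent, flatten_C]
    congr 1
    exact DFunLike.congr_fun key b

end Emb

/-! ### What one bivariate call does to types and primitivity -/

section PairStep

variable {A : Type u} [CommRing A] {N : ℕ}

/-- A common divisor divides the entry `v 1` at `k` and every `v 0 * μ i`, hence `v 0`, because `μ`
has gcd one. The last nonzero entry is at `k`, or that of `v 0 • μ` with `v 0 > 0` if `v 1 = 0`. -/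
theorem Normalized.smul_add_single {μ : Fin N → ℤ} (hμ : Normalized μ) {k : Fin N}
    (hk : ∀ i, k ≤ i → μ i = 0) {v : Fin 2 → ℤ} (hv : Normalized v) :
    Normalized (v 0 • μ + Pi.single k (v 1)) := by
  constructor
  · rw [gcd_eq_one_iff]
    intro d hd
    have h1 : d ∣ v 1 := by simpa [hk k le_rfl] using hd k
    have h0 : d ∣ v 0 := by
      have : d ∣ Finset.univ.gcd fun i => v 0 * μ i := by
        refine Finset.dvd_gcd fun i _ => ?_
        by_cases hi : i = k
        · rw [hi, hk k le_rfl, mul_zero]; exact dvd_zero _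
        · simpa [hi] using hd i
      rwa [Finset.gcd_mul_left, hμ.1, mul_one, dvd_normalize_iff] at this
    refine gcd_eq_one_iff.1 hv.1 d fun i => ?_
    fin_cases i
    · exact h0
    · exact h1
  · obtain ⟨i, hi, hi'⟩ := hv.2
    obtain ⟨l, hl, hl'⟩ := hμ.2
    have hlk : l < k := by
      by_contra h
      exact hl.ne' (hk l (not_lt.1 h))
    by_cases h1 : v 1 = 0
    · have h0 : 0 < v 0 := by
        fin_cases i
        · exact hi
        · exact absurd h1 hi.ne'
      refine ⟨l, ?_, fun j hj => ?_⟩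
      · simpa [h1] using mul_pos h0 hl
      · simp [h1, hl' j hj]
    · have h1' : 0 < v 1 := by
        fin_cases i
        · exact absurd (hi' 1 (by simp)) h1
        · exact hi
      refine ⟨k, ?_, fun j hj => ?_⟩
      · simpa [hk k le_rfl] using h1'
      · simp [hk j hj.le, hj.ne']

/-- The last `m` exponents are exponents of `f`; the others are multiples of the exponent of `y`, so
a term of `f` free of `y` serves for all of them. -/
theorem touchesAxes_expMap_emb {m : ℕ} (hm : m ≤ N) {μ : Fin N → ℤ} (hμ : Normalized μ)
    (hsupp : ∀ i : Fin N, N - m ≤ i → μ i = 0) {f : MvPolynomial (Fin (m + 1)) A}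
    (hf : ∀ j, ¬ MvPolynomial.X j ∣ f) : TouchesAxes (expMap A (emb m μ) (toLaurent f)) := by
  obtain ⟨ρ, hρ⟩ := exists_leftInverse_emb hm hμ hsupp
  have hinj : Function.Injective (emb m μ) := Function.LeftInverse.injective hρ
  have hT := touchesAxes_toLaurent.2 hf
  intro i
  by_cases hi : N - m ≤ i
  · obtain ⟨e, he, hej⟩ := hT ⟨i - (N - m) + 1, by omega⟩
    refine ⟨emb m μ e, by rwa [coeff_expMap hinj], ?_⟩
    rw [emb_apply, hsupp i hi, dif_pos hi, mul_zero, zero_add]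
    exact hej
  · obtain ⟨e, he, hej⟩ := hT 0
    obtain ⟨e', -, rfl⟩ := exists_of_coeff_toLaurent_ne_zero f e he
    have h0 : intVec e' 0 = 0 := le_antisymm hej (Int.natCast_nonneg _)
    refine ⟨emb m μ (intVec e'), by rwa [coeff_expMap hinj], ?_⟩
    rw [emb_apply, dif_neg hi, h0, zero_mul, zero_add]

theorem primitive_viewPair {m : ℕ} {h : MvPolynomial (Fin (m + 2)) A}
    (hh : (MvPolynomial.finSuccEquiv A (m + 1) h).IsPrimitive) : Primitive (viewPair h) := by
  intro b hb
  have h1 := map_dvd flatten hb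
  rw [flatten_viewPair, flatten_C] at h1
  have h2 : MvPolynomial.rename (fun j : Fin m => j.succ.succ) b =
      MvPolynomial.rename Fin.succ (MvPolynomial.rename Fin.succ b) := by
    rw [MvPolynomial.rename_rename]; rfl
  have h3 := map_dvd (MvPolynomial.finSuccEquiv A (m + 1)) h1
  rw [h2, finSuccEquiv_rename_succ] at h3
  have h4 := ((hh _ h3).map (MvPolynomial.rename (R := A) Fin.succ)).map
    (viewPair (A := A) (n := m))
  rw [← h2, viewPair_rename] at h4
  have h5 := h4.map (MvPolynomial.constantCoeff (R := MvPolynomial (Fin m) A) (σ := Fin 2))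
  rwa [MvPolynomial.constantCoeff_C] at h5

theorem isUnit_of_rename_dvd_viewPair {m : ℕ} {h : MvPolynomial (Fin (m + 2)) A}
    (hh : (MvPolynomial.finSuccEquiv A (m + 1) h).IsPrimitive)
    {g : MvPolynomial (Fin 1) (MvPolynomial (Fin m) A)}
    (hg : MvPolynomial.rename (Fin.succAbove 0) g ∣ viewPair h) : IsUnit g := by
  obtain ⟨g', hg'⟩ : ∃ g' : MvPolynomial (Fin (m + 1)) A,
      flatten (MvPolynomial.rename (Fin.succAbove 0) g) = MvPolynomial.rename Fin.succ g' := by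
    have key : (flatten (A := A) (m := m)).comp
        (MvPolynomial.rename (Fin.succAbove (0 : Fin 2))).toRingHom =
        (MvPolynomial.rename (R := A) (Fin.succ : Fin (m + 1) → Fin (m + 2))).toRingHom.comp
          (MvPolynomial.eval₂Hom (MvPolynomial.rename (R := A) Fin.succ).toRingHom
            fun _ => MvPolynomial.X 0) := by
      apply MvPolynomial.ringHom_ext
      · intro b
        refine (congrArg flatten (MvPolynomial.rename_C _ b)).trans ?_
        rw [flatten_C, RingHom.comp_apply, MvPolynomial.eval₂Hom_C]
        refine Eq.trans ?_ (MvPolynomial.rename_rename _ _ _).symm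
        rfl
      · intro i
        refine (congrArg flatten (MvPolynomial.rename_X _ i)).trans ?_
        rw [flatten_X, RingHom.comp_apply, MvPolynomial.eval₂Hom_X']
        refine Eq.trans ?_ (MvPolynomial.rename_X _ _).symm
        fin_cases i
        rfl
    exact ⟨_, DFunLike.congr_fun key g⟩
  have h1 := map_dvd flatten hg
  rw [flatten_viewPair, hg'] at h1
  have h3 := map_dvd (MvPolynomial.finSuccEquiv A (m + 1)) h1
  rw [finSuccEquiv_rename_succ] at h3
  have h4 := ((hh _ h3).map (MvPolynomial.rename (R := A) Fin.succ))
  rw [← hg'] at h4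
  have h5 := h4.map (viewPair (A := A) (n := m))
  rw [viewPair_flatten] at h5
  have h6 := h5.map (viewVar (A := MvPolynomial (Fin m) A) (0 : Fin 2))
  rw [viewVar_rename] at h6
  have h7 := h6.map (Polynomial.constantCoeff)
  rwa [Polynomial.constantCoeff_apply, Polynomial.coeff_C_zero] at h7

theorem evalMono_dvd_value {n : ℕ} {d : Decomp n A} {r : (Fin n → ℤ) × Polynomial A}
    (hr : r ∈ d.types) : evalMono r.1 r.2 ∣ d.value := by
  have h : evalMono r.1 r.2 ∣ (d.types.map fun t => evalMono t.1 t.2).prod :=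
    List.dvd_prod (List.mem_map.2 ⟨r, hr, rfl⟩)
  rw [Decomp.value]
  exact Dvd.dvd.mul_left h _

/-- A type with first entry zero is `(0, 1)`, so its factor is free of `y` and a unit by primitivity
in `y`, contrary to its positive degree and nonzero constant term. -/
theorem type_zero_ne_zero [IsDomain A] [UniqueFactorizationMonoid A] {m : ℕ}
    {h : MvPolynomial (Fin (m + 2)) A}
    (hh : (MvPolynomial.finSuccEquiv A (m + 1) h).IsPrimitive)
    {d : Decomp 2 (MvPolynomial (Fin m) A)} (hd : IsSplit (viewPair h) d)
    {r : (Fin 2 → ℤ) × Polynomial (MvPolynomial (Fin m) A)} (hr : r ∈ d.types) : r.1 0 ≠ 0 := by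
  intro h0
  have hn := (hd.type_normalized r hr).eq_single h0
  have hdvd : evalMono r.1 r.2 ∣ toLaurent (viewPair h) := by
    rw [hd.value_eq]
    exact evalMono_dvd_value hr
  rw [hn] at hdvd
  have hu := isUnit_evalMono_single (i := 0) (f := viewPair h)
    (fun g => isUnit_of_rename_dvd_viewPair hh)
    (hd.poly_qPrimitive r hr).2 hdvd
  obtain ⟨a, i, -, ha⟩ := eq_C_mul_X_pow_of_isUnit (by simp) hu
  have h1 := (hd.poly_qPrimitive r hr).2
  have h2 := hd.poly_degree r hr
  rw [ha] at h1 h2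
  rcases Nat.eq_zero_or_pos i with rfl | hi
  · simp at h2
  · simp [hi.ne] at h1

end PairStep

/-! ### One pass of the main loop -/

section PairLoop

variable {A : Type u} [CommRing A] {N : ℕ}

/-- The product of all factors in a state of the main loop of the second algorithm. -/
def total (m : ℕ)
    (s : ((Fin N → ℤ) × Laurent N A) × List ((Fin N → ℤ) × MvPolynomial (Fin (m + 1)) A)) :
    Laurent N A :=
  mono A s.1.1 * s.1.2 * (s.2.map fun t => expMap A (emb m t.1) (toLaurent t.2)).prod

/-- The properties of the elements of the lists in the second algorithm. -/
structure IsPiece (m : ℕ) (t : (Fin N → ℤ) × MvPolynomial (Fin (m + 1)) A) : Prop where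
  normalized : Normalized t.1
  eq_zero : ∀ i : Fin N, N - m ≤ i → t.1 i = 0
  qPrimitive : QPrimitive (MvPolynomial.finSuccEquiv A m t.2)
  natDegree_pos : 0 < (MvPolynomial.finSuccEquiv A m t.2).natDegree

/-- The effect of one step of the main loop. -/
structure PairStepSpec (m : ℕ) (hm : m + 1 < N)
    (t : (Fin N → ℤ) × MvPolynomial (Fin (m + 2)) A)
    (s s' : ((Fin N → ℤ) × Laurent N A) × List ((Fin N → ℤ) × MvPolynomial (Fin (m + 1)) A)) :
    Prop where
  total_eq : total m s' = total m s * expMap A (emb (m + 1) t.1) (toLaurent t.2)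
  rest_mem : s.1.2 ∈ nonlinear N A → s'.1.2 ∈ nonlinear N A
  touchesAxes : TouchesAxes s.1.2 → TouchesAxes s'.1.2
  pieces : ∃ T, s'.2 = s.2 ++ T ∧ (∀ u ∈ T, IsPiece m u ∧ ∃ a b : ℤ,
    ((MvPolynomial.finSuccEquiv A (m + 1) t.2).IsPrimitive → a ≠ 0) ∧
    u.1 = a • t.1 + Pi.single ⟨N - (m + 1), by omega⟩ b) ∧ (T.map Prod.fst).Nodup

theorem smul_add_single_injective {μ : Fin N → ℤ} (hμ : Normalized μ) {k : Fin N}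
    (hk : μ k = 0) :
    Function.Injective fun v : Fin 2 → ℤ => v 0 • μ + Pi.single k (v 1) := by
  intro v v' h
  have h1 : v 1 = v' 1 := by simpa [hk] using congrFun h k
  have h0 : v 0 = v' 0 := by
    have h2 : v 0 • μ = v' 0 • μ := by simpa [h1] using h
    exact smul_left_injective ℤ hμ.ne_zero h2
  ext i
  fin_cases i
  · exact h0
  · exact h1

variable [IsDomain A] [UniqueFactorizationMonoid A] (ch : Choices.{u})

/-- The bivariate result is carried over by `flattenHom` and `emb`. Primitivity is required only
with respect to the first two variables, so that the first pass is covered; the multiple of `t.1` is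
known to be nonzero only under primitivity in `y`. -/
theorem pairStep_spec (m : ℕ) (hm : m + 1 < N)
    (s : ((Fin N → ℤ) × Laurent N A) × List ((Fin N → ℤ) × MvPolynomial (Fin (m + 1)) A))
    {t : (Fin N → ℤ) × MvPolynomial (Fin (m + 2)) A} (ht : Normalized t.1)
    (hsupp : ∀ i : Fin N, N - (m + 1) ≤ i → t.1 i = 0) (hprim : Primitive (viewPair t.2)) :
    PairStepSpec m hm t s (pairStep ch m hm s t) := by
  have hd := multivariateQILD1_two_isSplit ch (viewPair t.2)
  have hunit := hd.isUnit_const hprim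
  have hne : viewPair t.2 ≠ 0 := fun h0 => not_isUnit_zero (hprim 0 (h0 ▸ dvd_zero _))
  have hq := hd.isQILD hne
  obtain ⟨ρ, hρ⟩ := exists_leftInverse_emb (by omega) ht hsupp
  rw [pairStep]
  rw [eval₂_eq_expMap_flatten hm]
  generalize multivariateQILD1 ch 2 (viewPair t.2) = d at hd hunit hq
  have hX : ∀ j, ¬ MvPolynomial.X j ∣ flatten d.unitRest := by
    have hCu : IsUnit (MvPolynomial.C d.const : MvPolynomial (Fin 2) (MvPolynomial (Fin m) A)) :=
      hunit.map MvPolynomial.C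
    refine not_X_dvd_flatten (fun a ha => hq.rest_primitive a ?_) fun j hj => hd.not_X_dvd j ?_
    · rwa [Decomp.unitRest, hCu.dvd_mul_left] at ha
    · rwa [Decomp.unitRest, hCu.dvd_mul_left] at hj
  refine ⟨?_, fun h => mul_mem h ?_, fun h => h.mul ?_, _, rfl, ?_, ?_⟩
  · have hv : toLaurent t.2 = flattenHom A m d.value := by
      rw [← hd.value_eq, flattenHom_toLaurent, flatten_viewPair]
    rw [hv, Decomp.value, map_mul, map_mul, map_mul, map_mul, map_mul, map_mul,
      expMap_flattenHom_mono hm, map_list_prod, map_list_prod, List.map_map, List.map_map, total,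
      total, mono_add, mono_add, ← flattenHom_toLaurent, Decomp.unitRest, map_mul, map_mul,
      map_mul, toLaurent_C, List.map_append, List.prod_append, List.map_map, mono_add]
    have hl : (d.types.map ((⇑(expMap A (emb (m + 1) t.1)) ∘ ⇑(flattenHom A m)) ∘
        fun r => evalMono r.1 r.2)) = d.types.map
        ((fun u : (Fin N → ℤ) × MvPolynomial (Fin (m + 1)) A =>
          expMap A (emb m u.1) (toLaurent u.2)) ∘ fun r =>
        (r.1 0 • t.1 + Pi.single ⟨N - (m + 1), by omega⟩ (r.1 1),
          (MvPolynomial.finSuccEquiv A m).symm r.2)) :=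
      List.map_congr_left fun r _ => expMap_flattenHom_evalMono hm t.1 r.1 r.2
    rw [hl]
    dsimp only
    ring
  · refine expMap_mem_nonlinear hρ ?_
    rw [← flattenHom_toLaurent]
    refine flattenHom_mem_nonlinear ?_
    rw [Decomp.unitRest, map_mul]
    exact mul_mem (mem_nonlinear_toLaurent_of_isUnit (hunit.map MvPolynomial.C)) hd.rest_mem
  · exact touchesAxes_expMap_emb (by omega) ht hsupp hX
  · intro u hu
    obtain ⟨r, hr, rfl⟩ := List.mem_map.1 hu
    refine ⟨⟨ht.smul_add_single (fun i hi => hsupp i hi) (hd.type_normalized r hr), ?_, ?_, ?_⟩,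
      r.1 0, r.1 1, fun hh => type_zero_ne_zero hh hd hr, rfl⟩
    · intro i hi
      have hne : i ≠ ⟨N - (m + 1), by omega⟩ := fun h => by rw [h] at hi; simp at hi; omega
      simp [hsupp i (by omega), hne]
    · rw [AlgEquiv.apply_symm_apply]
      exact hd.poly_qPrimitive r hr
    · rw [AlgEquiv.apply_symm_apply]
      exact hd.poly_degree r hr
  · rw [List.map_map]
    have := hd.types_distinct.map (smul_add_single_injective ht
      (hsupp (⟨N - (m + 1), by omega⟩ : Fin N) le_rfl))
    rwa [List.map_map] at this

/-- The effect of a pass through a list in the main loop. -/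
theorem foldl_pairStep_spec (m : ℕ) (hm : m + 1 < N)
    (L : List ((Fin N → ℤ) × MvPolynomial (Fin (m + 2)) A)) (hL : ∀ t ∈ L, IsPiece (m + 1) t)
    (hnd : (L.map Prod.fst).Nodup)
    (s : ((Fin N → ℤ) × Laurent N A) × List ((Fin N → ℤ) × MvPolynomial (Fin (m + 1)) A)) :
    let s' := L.foldl (pairStep ch m hm) s
    total m s' = total m s *
      (L.map fun t => expMap A (emb (m + 1) t.1) (toLaurent t.2)).prod ∧
    (s.1.2 ∈ nonlinear N A → s'.1.2 ∈ nonlinear N A) ∧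
    (TouchesAxes s.1.2 → TouchesAxes s'.1.2) ∧
    ∃ T, s'.2 = s.2 ++ T ∧ (∀ u ∈ T, IsPiece m u ∧ ∃ t ∈ L, ∃ a b : ℤ, a ≠ 0 ∧
      u.1 = a • t.1 + Pi.single ⟨N - (m + 1), by omega⟩ b) ∧ (T.map Prod.fst).Nodup := by
  induction L generalizing s with
  | nil => exact ⟨by simp, id, id, [], by simp, by simp, by simp⟩
  | cons t L ih =>
    have ht := hL t (by simp)
    have h1 := pairStep_spec ch m hm s ht.normalized ht.eq_zero
      (primitive_viewPair ht.qPrimitive.1)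
    rw [List.map_cons, List.nodup_cons] at hnd
    obtain ⟨h2, h3, h4, T, h5, h6, h7⟩ :=
      ih (fun t' ht' => hL t' (by simp [ht'])) hnd.2 (pairStep ch m hm s t)
    obtain ⟨T₁, e1, g1, d1⟩ := h1.pieces
    rw [List.foldl_cons]
    refine ⟨?_, fun h => h3 (h1.rest_mem h), fun h => h4 (h1.touchesAxes h), T₁ ++ T, ?_, ?_, ?_⟩
    · rw [h2, h1.total_eq, List.map_cons, List.prod_cons, mul_assoc]
    · rw [h5, e1, List.append_assoc]
    · intro u hu
      rcases List.mem_append.1 hu with hu | hu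
      · obtain ⟨hp, a, b, ha, hab⟩ := g1 u hu
        exact ⟨hp, t, by simp, a, b, ha ht.qPrimitive.1, hab⟩
      · obtain ⟨hp, t', ht', a, b, ha, hab⟩ := h6 u hu
        exact ⟨hp, t', by simp [ht'], a, b, ha, hab⟩
    · rw [List.map_append]
      refine d1.append h7 fun v hv1 hv2 => ?_
      obtain ⟨u1, hu1, rfl⟩ := List.mem_map.1 hv1
      obtain ⟨u2, hu2, h12⟩ := List.mem_map.1 hv2
      obtain ⟨-, a, b, ha, hab⟩ := g1 u1 hu1
      obtain ⟨-, t', ht', a', b', ha', hab'⟩ := h6 u2 hu2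
      have ht'' := hL t' (by simp [ht'])
      apply hnd.1
      rw [hab, hab'] at h12
      -- The entry at position `N - (m + 1)`, where both old vectors vanish, gives `b' = b`. The
      -- equal multiples that remain force equal normalized vectors, which `hnd.1` forbids.
      have hb : b' = b := by
        have := congrFun h12 ⟨N - (m + 1), by omega⟩
        simpa [ht.eq_zero (⟨N - (m + 1), by omega⟩ : Fin N) le_rfl,
          ht''.eq_zero (⟨N - (m + 1), by omega⟩ : Fin N) le_rfl] using this
      rw [hb, add_left_inj] at h12
      rw [← ht''.normalized.eq_of_smul_eq ht.normalized ha' h12]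
      exact List.mem_map_of_mem ht'

end PairLoop

/-! ### The whole main loop -/

section FinalLevel

variable {A : Type u} [CommRing A] {N : ℕ}

theorem expMap_emb_zero (μ : Fin N → ℤ) (h : MvPolynomial (Fin 1) A) :
    expMap A (emb 0 μ) (toLaurent h) = evalMono μ (toUni h) := by
  rw [← evalMono_toUni, expMap_evalMono]
  congr 1
  ext i
  rw [emb_apply, dif_neg (by omega), one_mul, add_zero]

/-- In the end the coefficients lie in `MvPolynomial (Fin 0) A`, isomorphic to `A`; through this
isomorphism degree and `q`-primitivity pass to `toUni h`. -/
theorem toUni_eq_map (h : MvPolynomial (Fin 1) A) :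
    toUni h = (MvPolynomial.finSuccEquiv A 0 h).map
      (MvPolynomial.isEmptyRingEquiv A (Fin 0) : MvPolynomial (Fin 0) A →+* A) := by
  induction h using MvPolynomial.induction_on with
  | C a =>
    rw [toUni, MvPolynomial.aeval_C, ← MvPolynomial.algebraMap_eq, AlgEquiv.commutes]
    rw [Polynomial.algebraMap_apply, Polynomial.algebraMap_apply, Polynomial.map_C]
    congr 1
    exact (MvPolynomial.isEmptyAlgEquiv A (Fin 0)).commutes a |>.symm
  | add p q hp hq => rw [map_add, hp, hq, map_add, Polynomial.map_add]
  | mul_X p i hp =>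
    rw [map_mul, hp, map_mul, Polynomial.map_mul]
    congr 1
    rw [Subsingleton.elim i 0, MvPolynomial.finSuccEquiv_X_zero, Polynomial.map_X, toUni,
      MvPolynomial.aeval_X]

theorem natDegree_toUni (h : MvPolynomial (Fin 1) A) :
    (toUni h).natDegree = (MvPolynomial.finSuccEquiv A 0 h).natDegree := by
  rw [toUni_eq_map]
  exact Polynomial.natDegree_map_eq_of_injective (RingEquiv.injective _) _

theorem qPrimitive_toUni {h : MvPolynomial (Fin 1) A}
    (hh : QPrimitive (MvPolynomial.finSuccEquiv A 0 h)) : QPrimitive (toUni h) := by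
  rw [toUni_eq_map]
  constructor
  · intro a ha
    have h1 := map_dvd (Polynomial.mapRingHom
      ((MvPolynomial.isEmptyRingEquiv A (Fin 0)).symm : A →+* MvPolynomial (Fin 0) A)) ha
    rw [Polynomial.coe_mapRingHom, Polynomial.map_C, Polynomial.map_map,
      RingEquiv.symm_comp, Polynomial.map_id] at h1
    exact (MulEquiv.isUnit_map (MvPolynomial.isEmptyRingEquiv A (Fin 0)).symm).1 (hh.1 _ h1)
  · rw [Polynomial.coeff_map]
    intro h0
    exact hh.2 ((map_eq_zero_iff _ (RingEquiv.injective _)).1 h0)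

variable [IsDomain A] [UniqueFactorizationMonoid A] (ch : Choices.{u})

/-- The properties of the result `r` of the main loop of the second algorithm; `F` is the product
of all factors. -/
structure LoopSpec (s : (Fin N → ℤ) × Laurent N A) (F : Laurent N A)
    (r : ((Fin N → ℤ) × Laurent N A) × List ((Fin N → ℤ) × Polynomial A)) : Prop where
  value_eq : mono A r.1.1 * r.1.2 * (r.2.map fun t => evalMono t.1 t.2).prod =
    mono A s.1 * s.2 * F
  rest_mem : s.2 ∈ nonlinear N A → r.1.2 ∈ nonlinear N A
  touchesAxes : TouchesAxes s.2 → TouchesAxes r.1.2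
  poly_qPrimitive : ∀ t ∈ r.2, QPrimitive t.2
  poly_degree : ∀ t ∈ r.2, 0 < t.2.natDegree
  type_normalized : ∀ t ∈ r.2, Normalized t.1
  exists_ne_zero : ∀ t ∈ r.2, ∃ i : Fin N, (i : ℕ) < 2 ∧ t.1 i ≠ 0
  types_distinct : (r.2.map Prod.fst).Nodup

/-- Away from the position of the new variable, a new vector is a nonzero multiple of an old one. By
`m + 2 ≤ N` that position is at least two, counted from zero, so a nonzero entry among the first two
survives. -/
theorem pairLoop_spec (m : ℕ) (hm : m < N) (hm2 : m + 2 ≤ N)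
    (L : List ((Fin N → ℤ) × MvPolynomial (Fin (m + 1)) A)) (hL : ∀ t ∈ L, IsPiece m t)
    (hne : ∀ t ∈ L, ∃ i : Fin N, (i : ℕ) < 2 ∧ t.1 i ≠ 0)
    (hnd : (L.map Prod.fst).Nodup) (s : (Fin N → ℤ) × Laurent N A) :
    LoopSpec s (L.map fun t => expMap A (emb m t.1) (toLaurent t.2)).prod
      (pairLoop ch m hm s L) := by
  induction m generalizing s with
  | zero =>
    refine ⟨?_, id, id, ?_, ?_, ?_, ?_, ?_⟩
    · rw [pairLoop, List.map_map]
      congr 2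
      exact List.map_congr_left fun t _ => (expMap_emb_zero t.1 t.2).symm
    · intro u hu
      obtain ⟨t, ht, rfl⟩ := List.mem_map.1 hu
      exact qPrimitive_toUni (hL t ht).qPrimitive
    · intro u hu
      obtain ⟨t, ht, rfl⟩ := List.mem_map.1 hu
      exact (natDegree_toUni t.2).symm ▸ (hL t ht).natDegree_pos
    · intro u hu
      obtain ⟨t, ht, rfl⟩ := List.mem_map.1 hu
      exact (hL t ht).normalized
    · intro u hu
      obtain ⟨t, ht, rfl⟩ := List.mem_map.1 hu
      exact hne t ht
    · rw [pairLoop, List.map_map]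
      exact hnd
  | succ m ih =>
    obtain ⟨h1, h2, h3, T, h4, h5, h6⟩ := foldl_pairStep_spec ch m hm L hL hnd (s, [])
    rw [List.nil_append] at h4
    rw [pairLoop]
    generalize L.foldl (pairStep ch m hm) (s, []) = r at h1 h2 h3 h4
    subst h4
    have key := ih (by omega) (by omega) r.2 (fun u hu => (h5 u hu).1) (fun u hu => by
      obtain ⟨-, t, ht, a, b, ha, hab⟩ := h5 u hu
      obtain ⟨i, hi, hti⟩ := hne t ht
      refine ⟨i, hi, ?_⟩
      have : i ≠ ⟨N - (m + 1), by omega⟩ := fun h => by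
        have := congrArg Fin.val h
        dsimp only at this
        omega
      rw [hab]
      simp [this, ha, hti]) h6 r.1
    refine ⟨?_, fun h => key.rest_mem (h2 h), fun h => key.touchesAxes (h3 h),
      key.poly_qPrimitive, key.poly_degree, key.type_normalized, key.exists_ne_zero,
      key.types_distinct⟩
    rw [key.value_eq]
    simpa [total] using h1

/-- The main loop, started with a single polynomial. -/
theorem pairLoop_single_spec {m : ℕ} (h : MvPolynomial (Fin (m + 3)) A)
    (hh : Primitive (viewPair h)) (s : (Fin (m + 3) → ℤ) × Laurent (m + 3) A) :
    LoopSpec s (toLaurent h) (pairLoop ch (m + 2) (by omega) s [(Pi.single 0 1, h)]) := by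
  have hμ : Normalized (Pi.single 0 1 : Fin (m + 3) → ℤ) := by
    refine ⟨gcd_eq_one_iff.2 fun d hd => ?_, 0, by simp, fun j hj => by simp [hj.ne']⟩
    exact isUnit_of_dvd_one (by simpa using hd 0)
  have hsupp : ∀ i : Fin (m + 3), m + 3 - (m + 1 + 1) ≤ i →
      (Pi.single 0 1 : Fin (m + 3) → ℤ) i = 0 := by
    intro i hi
    have : i ≠ 0 := fun h => by rw [h] at hi; simp at hi
    simp [this]
  -- For the first unit vector the embedding is the identity.
  have hid : expMap A (emb (m + 1 + 1) (Pi.single 0 1 : Fin (m + 3) → ℤ)) (toLaurent h) =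
      toLaurent h := by
    have := expMap_toLaurent (emb (m + 1 + 1) (Pi.single 0 1 : Fin (m + 3) → ℤ)) id (fun j => by
      refine Fin.cases ?_ (fun j => ?_) j
      · exact emb_single_zero _ _
      · rw [emb_single_succ (by omega)]
        congr 1
        ext
        simp only [id, Fin.val_succ]
        omega) h
    rw [← this, MvPolynomial.rename_id, AlgHom.id_apply]
  -- The first pass is separate, since `h` need not be primitive in `y`. With a single element in
  -- the list, distinctness is that of one bivariate decomposition.
  have h1 := pairStep_spec ch (m + 1) (by omega : m + 1 + 1 < m + 3) (s, [])
    (t := (Pi.single 0 1, h)) hμ hsupp hh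
  obtain ⟨T, e, g, d⟩ := h1.pieces
  have h2 := h1.total_eq
  have h3 := h1.rest_mem
  have h4 := h1.touchesAxes
  rw [pairLoop, List.foldl_cons, List.foldl_nil]
  generalize pairStep ch (m + 1) _ (s, []) (Pi.single 0 1, h) = r at e h2 h3 h4 ⊢
  rw [List.nil_append] at e
  subst e
  -- The vectors now vanish beyond the first two positions and are nonzero, so one of these two
  -- entries is nonzero.
  have key := pairLoop_spec ch (m + 1) (by omega) (by omega) r.2 (fun u hu => (g u hu).1)
    (fun u hu => by
      have hu := (g u hu).1
      obtain ⟨i, hi⟩ := Function.ne_iff.1 hu.normalized.ne_zero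
      refine ⟨i, ?_, hi⟩
      by_contra hlt
      exact hi (hu.eq_zero i (by omega))) d r.1
  refine ⟨?_, fun h => key.rest_mem (h3 h), fun h => key.touchesAxes (h4 h),
    key.poly_qPrimitive, key.poly_degree, key.type_normalized, key.exists_ne_zero,
    key.types_distinct⟩
  rw [key.value_eq]
  simpa [total, hid] using h2

end FinalLevel

/-! ### The recursive step and the correctness of the second algorithm -/

section ManyVariables

variable {A : Type u} [CommRing A] {n : ℕ}

/-- Put two zeros in front of a vector. -/
def padTwo : (Fin n → ℤ) →+ (Fin (n + 2) → ℤ) := (insertZero 0).comp (insertZero 0)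

theorem padTwo_apply (u : Fin n → ℤ) :
    padTwo u = Fin.cons (α := fun _ => ℤ) 0 (Fin.cons (α := fun _ => ℤ) 0 u) := by
  rw [padTwo, AddMonoidHom.comp_apply, insertZero_apply, insertZero_apply, Fin.insertNth_zero',
    Fin.insertNth_zero']

theorem padTwo_single (j : Fin n) : padTwo (Pi.single j 1) = Pi.single j.succ.succ 1 := by
  rw [padTwo, AddMonoidHom.comp_apply, insertZero_single, insertZero_single,
    Fin.succAbove_zero, Fin.succAbove_zero]

theorem padTwo_leftInverse : ∃ ρ : (Fin (n + 2) → ℤ) →+ (Fin n → ℤ), ∀ u, ρ (padTwo u) = u := by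
  refine ⟨{ toFun := fun u j => u j.succ.succ, map_zero' := rfl, map_add' := fun _ _ => rfl },
    fun u => ?_⟩
  ext j
  simp [padTwo_apply]

/-- Viewed in the first two variables the renamed polynomial is a nonzero constant, so neither of
them divides it; the other variables are excluded by `hq`. -/
theorem not_X_dvd_rename {q : MvPolynomial (Fin n) A} (hq0 : q ≠ 0)
    (hq : ∀ j, ¬ MvPolynomial.X j ∣ q) (j : Fin (n + 2)) :
    ¬ MvPolynomial.X j ∣ MvPolynomial.rename (fun j : Fin n => j.succ.succ) q := by
  intro h
  have h1 := map_dvd (MvPolynomial.constantCoeff (R := MvPolynomial (Fin n) A) (σ := Fin 2))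
    (map_dvd (viewPair (A := A) (n := n)) h)
  rw [viewPair_rename, MvPolynomial.constantCoeff_C] at h1
  revert h1
  refine Fin.cases ?_ (fun j => Fin.cases ?_ (fun j => ?_) j) j
  · rw [viewPair_X_zero, MvPolynomial.constantCoeff_X, zero_dvd_iff]
    exact hq0
  · rw [show (Fin.succ 0 : Fin (n + 2)) = 1 from rfl, viewPair_X_one,
      MvPolynomial.constantCoeff_X, zero_dvd_iff]
    exact hq0
  · rw [viewPair_X_succ, MvPolynomial.constantCoeff_C]
    exact hq j

theorem IsSplit.mul_monomial {p : MvPolynomial (Fin n) A} {s : Decomp n A} (hs : IsSplit p s)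
    (e : Fin n →₀ ℕ) (b : A) : IsSplit (p * MvPolynomial.monomial e b)
      ⟨s.const * b, s.expo + fun i => (e i : ℤ), s.rest, s.types⟩ := by
  refine ⟨?_, hs.rest_mem, hs.not_X_dvd, hs.poly_qPrimitive, hs.poly_degree, hs.type_normalized,
    hs.types_distinct⟩
  rw [map_mul, hs.value_eq, toLaurent_monomial, single_eq_algebraMap_mul, Decomp.value,
    Decomp.value, map_mul, mono_add]
  change _ = _ * (_ * mono A (intVec e)) * _ * _
  ring

/-- The result of the main loop yields a decomposition. -/
theorem IsSplit.mul_loop {p f : MvPolynomial (Fin n) A} {s : Decomp n A} (hs : IsSplit p s)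
    (hs2 : ∀ t ∈ s.types, ∀ i : Fin n, (i : ℕ) < 2 → t.1 i = 0)
    {r : ((Fin n → ℤ) × Laurent n A) × List ((Fin n → ℤ) × Polynomial A)}
    (hr : LoopSpec (s.expo, toLaurent s.rest) (toLaurent f) r) : IsSplit (p * f)
      ⟨s.const, r.1.1 - fun i => (den r.1.2 i : ℤ), num r.1.2, s.types ++ r.2⟩ := by
  have append : ∀ {q : (Fin n → ℤ) × Polynomial A → Prop}, (∀ t ∈ s.types, q t) →
      (∀ t ∈ r.2, q t) → ∀ t ∈ s.types ++ r.2, q t := fun h1 h2 t ht =>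
    (List.mem_append.1 ht).elim (h1 t) (h2 t)
  refine ⟨?_, ?_, ?_, append hs.poly_qPrimitive hr.poly_qPrimitive,
    append hs.poly_degree hr.poly_degree, append hs.type_normalized hr.type_normalized, ?_⟩
  · have h1 : mono A (r.1.1 - fun i => (den r.1.2 i : ℤ)) * toLaurent (num r.1.2) =
        mono A r.1.1 * r.1.2 := by
      rw [toLaurent_num, ← mul_assoc, ← mono_add, sub_add_cancel]
    have h2 := hr.value_eq
    rw [map_mul, hs.value_eq, Decomp.value, Decomp.value]
    dsimp only at h2 ⊢
    rw [mul_assoc (algebraMap _ _ _) (mono A (_ - _)), h1, List.map_append, List.prod_append]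
    linear_combination (-(algebraMap A (Laurent n A) s.const *
      (s.types.map fun t => evalMono t.1 t.2).prod)) * h2
  · rw [toLaurent_num]
    exact mul_mem (mem_nonlinear_of_isUnit (isUnit_mono _)) (hr.rest_mem hs.rest_mem)
  · exact touchesAxes_iff.1 (hr.touchesAxes (touchesAxes_toLaurent.2 hs.not_X_dvd))
  · rw [List.map_append]
    refine hs.types_distinct.append hr.types_distinct fun v hv1 hv2 => ?_
    obtain ⟨t1, ht1, rfl⟩ := List.mem_map.1 hv1
    obtain ⟨t2, ht2, h12⟩ := List.mem_map.1 hv2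
    -- The types already present vanish in the first two positions, those of the loop do not.
    obtain ⟨i, hi, hne⟩ := hr.exists_ne_zero t2 ht2
    exact hne (h12 ▸ hs2 t1 ht1 i hi)

/-- Zero is handled apart: the sign of the exponents in `IsSplit.isQILD` is read off from a nonzero
term of `p`. -/
theorem isQILD_zero : IsQILD (0 : MvPolynomial (Fin n) A) ⟨0, 0, 1, []⟩ where
  value_eq := by simp [Decomp.value]
  expo_nonneg i := le_rfl
  rest_primitive a ha := by
    have := (isUnit_of_dvd_one ha).map (MvPolynomial.constantCoeff (R := A) (σ := Fin n))
    rwa [MvPolynomial.constantCoeff_C] at this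
  rest_factors r hr _ hd := absurd (isUnit_of_dvd_one hd) hr.not_isUnit
  poly_qPrimitive := by simp
  poly_degree := by simp
  type_ne_zero := by simp
  type_normalized := by simp
  types_distinct := by simp

theorem multivariateQILD2_zero (ch : Choices.{u}) (n : ℕ) :
    multivariateQILD2 ch n (0 : MvPolynomial (Fin n) A) = ⟨0, 0, 1, []⟩ := by
  have h : ∀ {n : ℕ} (next : A → MvPolynomial (Fin n) A → Decomp n A),
      prepare ch 0 next = ⟨0, 0, 1, []⟩ := fun next => by
    rw [prepare, if_pos ⟨0, MvPolynomial.C_0.symm⟩, MvPolynomial.coeff_zero]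
  match n with
  | 0 => rfl
  | 1 => exact h _
  | 2 => exact h _
  | n + 3 => exact h _

variable [IsDomain A]

/-- The decomposition of a polynomial in all variables but the first two, multiplied by a
constant. -/
theorem IsSplit.padTwo {g : MvPolynomial (Fin (n + 1)) A} {d : Decomp (n + 1) A}
    (hd : IsSplit g d) (hu : IsUnit d.const) (c : A) :
    IsSplit (MvPolynomial.C c * MvPolynomial.rename (fun j : Fin (n + 1) => j.succ.succ) g)
      ⟨c, QILD.padTwo d.expo, MvPolynomial.rename (fun j : Fin (n + 1) => j.succ.succ) d.unitRest,
        d.types.map fun t => (QILD.padTwo t.1, t.2)⟩ := by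
  obtain ⟨ρ, hρ⟩ := padTwo_leftInverse (n := n + 1)
  have hCu : IsUnit (MvPolynomial.C d.const : MvPolynomial (Fin (n + 1)) A) :=
    hu.map MvPolynomial.C
  refine ⟨?_, ?_, ?_, ?_, ?_, ?_, ?_⟩
  · rw [map_mul, toLaurent_C, expMap_toLaurent QILD.padTwo _ padTwo_single, hd.value_eq,
      expMap_value]
    simp only [Decomp.value, Decomp.unitRest, map_mul, MvPolynomial.rename_C, toLaurent_C,
      expMap_toLaurent QILD.padTwo _ padTwo_single]
    ring
  · rw [expMap_toLaurent QILD.padTwo _ padTwo_single]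
    refine expMap_mem_nonlinear hρ ?_
    rw [Decomp.unitRest, map_mul]
    exact mul_mem (mem_nonlinear_toLaurent_of_isUnit hCu) hd.rest_mem
  · have h0 : d.rest ≠ 0 := fun h0 =>
      ne_zero_of_mem_nonlinear hd.rest_mem (by rw [h0, map_zero])
    refine not_X_dvd_rename (mul_ne_zero hCu.ne_zero h0) fun j hj => hd.not_X_dvd j ?_
    rwa [Decomp.unitRest, hCu.dvd_mul_left] at hj
  · intro u hu
    obtain ⟨t, ht, rfl⟩ := List.mem_map.1 hu
    exact hd.poly_qPrimitive t ht
  · intro u hu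
    obtain ⟨t, ht, rfl⟩ := List.mem_map.1 hu
    exact hd.poly_degree t ht
  · intro u hu
    obtain ⟨t, ht, rfl⟩ := List.mem_map.1 hu
    exact ((hd.type_normalized t ht).insertZero 0).insertZero 0
  · have := hd.types_distinct.map (Function.LeftInverse.injective hρ)
    rw [List.map_map] at this ⊢
    exact this

variable [UniqueFactorizationMonoid A] (ch : Choices.{u})

open scoped Classical in
-- After division by the content, what remains is primitive with respect to the first two variables,
-- which is all that the first pass needs. The content divides a primitive polynomial, so its
-- decomposition has a unit constant.
theorem manyVariables_isSplit {call : MvPolynomial (Fin (n + 1)) A → Decomp (n + 1) A}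
    (hcall : ∀ g, IsSplit g (call g)) {p f₀ : MvPolynomial (Fin (n + 3)) A} {c : A}
    (hp : p = MvPolynomial.C c * f₀) (hf₀ : Primitive f₀) :
    IsSplit p (manyVariables ch call c f₀) := by
  have hne : f₀ ≠ 0 := fun h0 => not_isUnit_zero (hf₀ 0 (h0 ▸ dvd_zero _))
  have hdvd : MvPolynomial.rename (fun j : Fin (n + 1) => j.succ.succ) (cont ch (viewPair f₀)) ∣
      f₀ := by
    have := map_dvd flatten (MvPolynomial.C_dvd_iff_dvd_coeff _ _ |>.2
      ((dvd_cont_iff ch _ _).1 (dvd_refl (cont ch (viewPair f₀)))))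
    rwa [flatten_viewPair, flatten_C] at this
  have hf := exactDiv_spec hdvd
  have hprim : Primitive (viewPair (exactDiv f₀ (MvPolynomial.rename
      (fun j : Fin (n + 1) => j.succ.succ) (cont ch (viewPair f₀))))) := by
    intro b hb
    have hg0 : cont ch (viewPair f₀) ≠ 0 := fun h0 => hne (by rw [hf, h0, map_zero, zero_mul])
    have h1 : cont ch (viewPair f₀) * b ∣ cont ch (viewPair f₀) := by
      rw [dvd_cont_iff, ← MvPolynomial.C_dvd_iff_dvd_coeff]
      have := mul_dvd_mul_left (MvPolynomial.C (cont ch (viewPair f₀))) hb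
      rw [← viewPair_rename, ← map_mul, ← hf, viewPair_rename] at this
      rwa [map_mul]
    obtain ⟨b', hb'⟩ := h1
    refine IsUnit.of_mul_eq_one b' (mul_left_cancel₀ hg0 ?_)
    rw [← mul_assoc, ← hb', mul_one]
  rw [manyVariables]
  dsimp only
  generalize cont ch (viewPair f₀) = g at hdvd hf hprim
  generalize exactDiv f₀ (MvPolynomial.rename (fun j : Fin (n + 1) => j.succ.succ) g) = f
    at hf hprim
  have hg : Primitive g := by
    intro a ha
    apply hf₀ a
    have := map_dvd (MvPolynomial.rename (R := A) (fun j : Fin (n + 1) => j.succ.succ)) ha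
    rw [MvPolynomial.rename_C] at this
    exact this.trans hdvd
  obtain ⟨s, hs, hsplit, hs2⟩ : ∃ s, s = (if g = 1 then (⟨c, 0, 1, []⟩ : Decomp (n + 3) A) else
      { const := c
        expo := Fin.cons (α := fun _ => ℤ) 0 (Fin.cons (α := fun _ => ℤ) 0 (call g).expo)
        rest := MvPolynomial.rename (fun j : Fin (n + 1) => j.succ.succ) (call g).unitRest
        types := (call g).types.map fun t =>
          (Fin.cons (α := fun _ => ℤ) 0 (Fin.cons (α := fun _ => ℤ) 0 t.1), t.2) }) ∧
      IsSplit (MvPolynomial.C c * MvPolynomial.rename (fun j : Fin (n + 1) => j.succ.succ) g) s ∧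
      ∀ t ∈ s.types, ∀ i : Fin (n + 3), (i : ℕ) < 2 → t.1 i = 0 := by
    refine ⟨_, rfl, ?_⟩
    split_ifs with h1
    · subst h1
      have := isSplit_C (p := MvPolynomial.C (σ := Fin (n + 3)) c) c rfl
      rw [MvPolynomial.coeff_zero_C] at this
      refine ⟨by rwa [map_one, mul_one], by simp⟩
    · have := (hcall g).padTwo ((hcall g).isUnit_const hg) c
      simp only [padTwo_apply] at this
      refine ⟨this, fun u hu i hi => ?_⟩
      obtain ⟨t, ht, rfl⟩ := List.mem_map.1 hu
      revert hi
      refine Fin.cases ?_ (fun j => Fin.cases ?_ (fun j => ?_) j) i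
      · simp
      · simp
      · intro hi
        simp at hi
  rw [← hs, hp, hf, ← mul_assoc]
  split_ifs with h
  · have := hsplit.mul_monomial h.choose (f.coeff h.choose)
    rwa [← eq_monomial_of_support h.choose_spec] at this
  · exact hsplit.mul_loop hs2 (pairLoop_single_spec ch f hprim _)

theorem multivariateQILD2_isSplit (n : ℕ) (p : MvPolynomial (Fin n) A) :
    IsSplit p (multivariateQILD2 ch n p) := by
  induction n using Nat.strong_induction_on with
  | _ n ih =>
    match n, p, ih with
    | 0, p, _ => exact isSplit_C (p.coeff 0) (MvPolynomial.eq_C_of_isEmpty p)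
    | 1, p, _ => exact multivariateQILD1_one_isSplit ch p
    | 2, p, _ =>
      refine prepare_spec ch p _ (IsSplit p) (fun a h => isSplit_C a h)
        (fun a e h => isSplit_monomial a e h) fun c f hp hf _ => ?_
      have hd := multivariateQILD1_two_isSplit ch f
      have hu : IsUnit (MvPolynomial.C (multivariateQILD1 ch 2 f).const :
          MvPolynomial (Fin 2) A) := (hd.isUnit_const hf).map MvPolynomial.C
      refine ⟨?_, ?_, fun j hj => hd.not_X_dvd j ?_, hd.poly_qPrimitive, hd.poly_degree,
        hd.type_normalized, hd.types_distinct⟩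
      · rw [hp, map_mul, hd.value_eq, toLaurent_C]
        simp only [Decomp.value, Decomp.unitRest, map_mul, toLaurent_C]
        ring
      · simp only [Decomp.unitRest, map_mul]
        exact mul_mem (mem_nonlinear_toLaurent_of_isUnit hu) hd.rest_mem
      · exact hu.dvd_mul_left.1 hj
    | n + 3, p, ih =>
      exact prepare_spec ch p _ (IsSplit p) (fun a h => isSplit_C a h)
        (fun a e h => isSplit_monomial a e h) fun c f hp hf _ =>
          manyVariables_isSplit ch (fun g => ih (n + 1) (by omega) g) hp hf

theorem multivariateQILD2_isQILD (n : ℕ) (p : MvPolynomial (Fin n) A) :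
    IsQILD p (multivariateQILD2 ch n p) := by
  by_cases hp : p = 0
  · rw [hp, multivariateQILD2_zero]
    exact isQILD_zero
  · exact (multivariateQILD2_isSplit ch n p).isQILD hp

end ManyVariables

end QILD

end

theorem theorem4p4 {D : Type u} [CommRing D] [IsDomain D] [UniqueFactorizationMonoid D]
    [CharZero D] (ch : QILD.Choices.{u}) (n : ℕ)
    (p : MvPolynomial (Fin n) (LaurentPolynomial D)) :
    QILD.IsQILD p (QILD.multivariateQILD2 ch n p) := by
  -- `D[q, q⁻¹]` is the localization of the unique factorization domain `D[q]` at the powers of `q`.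
  have : UniqueFactorizationMonoid (LaurentPolynomial D) :=
    UniqueFactorizationMonoid.of_isLocalization (M := Polynomial D) (.powers Polynomial.X) _
  exact QILD.multivariateQILD2_isQILD ch n p
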